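/- Let $V$ be a vertex operator algebra over $\mathbb C$ (with $\dim V_{(n)}<\infty$ and $V_{(n)}=0$ for $n\ll 0$; negative weights are allowed). A weak $V$-module satisfies all axioms of a module except that no grading is required. For a weak $V$-module $M$, $M_{(h)}$ denotes the $L(0)$-eigenspace of eigenvalue $h$. $M$ is a *lowest weight generalized $V$-module* if $M=\coprod_{n\in\mathbb N}M_{(h+n)}$ for some $h\in\mathbb C$ and $M_{(h)}$ generates $M$; then $M'=\coprod_{h}M_{(h)}^*\subset M^*$ with the contragredient action $\langle Y'(v,x)f,w\rangle=\langle f,Y^o(v,x)w\rangle$, $Y^o(v,x)=Y(e^{xL(1)}(-x^{-2})^{L(0)}v,x^{-1})$. For a weak $V$-module $M$, let $O(M)$ be the span of $\mathrm{Res}_x x^{-2}(1+x)^{\mathrm{wt}\,v}Y(v,x)w$ ($v\in V$ homogeneous, $w\in M$) and $A(M)=M/O(M)$. With $v*w=\mathrm{Res}_x x^{-1}(1+x)^{\mathrm{wt}\,v}Y(v,x)w$ and $w*v=\mathrm{Res}_x x^{-1}(1+x)^{\mathrm{wt}\,v-1}Y(v,x)w$, $A(V)$ is Zhu's associative algebra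 (product induced by $u*v$, unit $\mathbf 1+O(V)$) and $A(M)$ is an $A(V)$-bimodule. Let $\theta$ be the anti-involution of $A(V)$ induced by $v\mapsto e^{L(1)}(-1)^{L(0)}v$; $A(V)\otimes A(V)$ acts on $A(M)^*$ by $((a_1\otimes a_2)f)(w)=f(\theta(a_2)\,w\,a_1)$. Let $g(V)=(V\otimes\mathbb C[t,t^{-1}])/(L(-1)\otimes 1+1\otimes\frac{d}{dt})(V\otimes\mathbb C[t,t^{-1}])$ be the Lie algebra with $[u(m),v(n)]=\sum_{i\ge0}\binom mi(u_iv)(m+n-i)$, graded by $\deg v(m)=\mathrm{wt}\,v-m-1$. For an $A(V)$-module $U$, let $F(U)$ be the weak $V$-module obtained from the induced module $U(g(V))\otimes_{U(g(V)_-+g(V)_0)}U$ (where $g(V)_-$ acts on $U$ by $0$ and $v(\mathrm{wt}\,v-1)$ acts as $v+O(V)$) by dividing out the Jacobi identity relations, and let $e_U:U\to F(U)$ be the natural map. For $z\in\mathbb C^\times$ let $\mathcal D_{P(z)}(M)\subset M^*$ consist of those $\alpha$ such that for each $v\in V$ there are $k,l\in\mathbb N$ with $x^l(x-z)^k\langle\alpha,Y^o(v,x)w\rangle\in\mathbb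 C[x]$ for all $w\in M$; it is a weak $V\otimes V$-module under $Y^L_{P(z)}\otimes Y^R_{P(z)}$, where $\langle Y^L_{P(z)}(v,x)\alpha,w\rangle$ and $\langle Y^R_{P(z)}(v,x)\alpha,w\rangle$ are the expansions at $x=0$ of the rational functions represented by $\langle\alpha,Y^o(v,x+z)w\rangle$ and $\langle\alpha,Y^o(v,x)w\rangle$, respectively. **Theorem.** Let $W$ be a lowest weight generalized $V$-module and let $U_1,U_2$ be finite-dimensional irreducible $A(V)$-modules. Let $\mathcal V^{W'}_{F(U_1)F(U_2)}$ be the space of intertwining operators $\mathcal Y(a,x)b=\sum_{n\in\mathbb C}(a_nb)\,x^{-n-1}$ of type $\binom{W'}{F(U_1)\,F(U_2)}$. Then there is a linear map $$\mathcal F:\ \mathcal V^{W'}_{F(U_1)F(U_2)}\to\mathrm{Hom}_{V\otimes V}\bigl(F(U_1)\otimes F(U_2),\mathcal D_{P(-1)}(W)\bigr),\qquad \mathcal F(\mathcal Y)(a\otimes b)=\mathcal Y(a,e^{\pi i})b=\sum_{n\in\mathbb C}e^{(-n-1)\pi i}\,a_nb\in W^*,$$ and a linear restriction map $$\Omega_T:\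 \mathrm{Hom}_{V\otimes V}\bigl(F(U_1)\otimes F(U_2),\mathcal D_{P(-1)}(W)\bigr)\to\mathrm{Hom}_{A(V)\otimes A(V)}\bigl(U_1\otimes U_2,A(W)^*\bigr),\qquad \Omega_T(\psi)(u_1\otimes u_2)(w+O(W))=\psi(e_{U_1}(u_1)\otimes e_{U_2}(u_2))(w),$$ and the composite $\Omega_T\circ\mathcal F:\mathcal V^{W'}_{F(U_1)F(U_2)}\to\mathrm{Hom}_{A(V)\otimes A(V)}(U_1\otimes U_2,A(W)^*)$ is a linear isomorphism. -/

import Mathlib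

open scoped TensorProduct

noncomputable section

/-! ## Vertex operators, the Jacobi identity, vertex operator algebras and weak modules -/

/-- A linear map `Y(·, x) : V → (End M)[[x, x⁻¹]]`, written through its modes:
`Y(v, x) = ∑ n : ℤ, v_n x^(-n-1)` with `v_n = modes v n`. -/
class HasModes (V M : Type*) [AddCommGroup V] [Module ℂ V] [AddCommGroup M] [Module ℂ M] where
  modes : V →ₗ[ℂ] (ℤ → Module.End ℂ M)

/-- The mode `v_n` acting on `M`. -/
def mode {V : Type*} (M : Type*) [AddCommGroup V] [Module ℂ V] [AddCommGroup M] [Module ℂ M]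
    [HasModes V M] (v : V) (n : ℤ) : Module.End ℂ M :=
  HasModes.modes v n

/-- The difference of the two sides of the coefficient of `x₀^(-r-1) x₁^(-p-1) x₂^(-q-1)` in the
Jacobi identity
`x₂⁻¹ δ((x₁-x₀)/x₂) I(Y₁(v,x₀)a,x₂)b
  = x₀⁻¹ δ((x₁-x₂)/x₀) Y₃(v,x₁)I(a,x₂)b - x₀⁻¹ δ((x₂-x₁)/(-x₀)) I(a,x₂)Y₂(v,x₁)b`,
where `Yⱼ(v,x) = ∑ n : ℤ, Yⱼ v n x^(-n-1)` and `I(a,x) = ∑ n : G, I a n x^(-n-1)`, the exponents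
of `I` running over `G = ℤ` or `G = ℂ`. -/
def jacobiDefect {V A B C G : Type*} [AddCommGroup A] [AddCommGroup B] [AddCommGroup C]
    [AddGroupWithOne G]
    (Y₁ : V → ℤ → A → A) (Y₂ : V → ℤ → B → B) (Y₃ : V → ℤ → C → C) (I : A → G → B → C)
    (v : V) (a : A) (b : B) (p : ℤ) (q : G) (r : ℤ) : C :=
  (∑ᶠ i : ℕ, Ring.choose p i • I (Y₁ v (r + i) a) (q + ((p - i : ℤ) : G)) b)
    - ((∑ᶠ i : ℕ, ((-1) ^ i * Ring.choose r i) • Y₃ v (p + r - i) (I a (q + (i : G)) b))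
      - (∑ᶠ i : ℕ, ((r.negOnePow : ℤ) * ((-1) ^ i * Ring.choose r i)) •
          I a (q + ((r - i : ℤ) : G)) (Y₂ v (p + i) b)))

/-- A vertex operator algebra `(V, Y, 𝟏, ω)` over `ℂ`. The weight space `V_(n)` is the
`L(0)`-eigenspace of eigenvalue `n`, where `L(n) = ω_(n+1)`. -/
class VertexOperatorAlgebra (V : Type*) [AddCommGroup V] [Module ℂ V] extends HasModes V V where
  /-- the vacuum vector -/
  vac : V
  /-- the Virasoro element -/
  conf : V
  /-- the central charge -/
  charge : ℂ
  truncation : ∀ u v : V, ∃ N : ℤ, ∀ n : ℤ, N ≤ n → mode V u n v = 0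
  vacuum_left : ∀ (n : ℤ) (v : V), mode V vac n v = if n = -1 then v else 0
  creation : ∀ v : V, mode V v (-1) vac = v ∧ ∀ n : ℤ, 0 ≤ n → mode V v n vac = 0
  jacobi : ∀ (u v w : V) (p q r : ℤ),
    jacobiDefect (fun v n => mode V v n) (fun v n => mode V v n) (fun v n => mode V v n)
      (fun v n => mode V v n) u v w p q r = 0
  virasoro : ∀ m n : ℤ,
    mode V conf (m + 1) * mode V conf (n + 1) - mode V conf (n + 1) * mode V conf (m + 1)
      = ((m : ℂ) - n) • mode V conf (m + n + 1)
        + (if m + n = 0 then ((m : ℂ) ^ 3 - m) / 12 * charge else 0) • (1 : Module.End ℂ V)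
  derivative : ∀ (v : V) (n : ℤ), mode V (mode V conf 0 v) n = (-n : ℂ) • mode V v (n - 1)
  graded : DirectSum.IsInternal
    (fun n : ℤ => Module.End.eigenspace (mode V conf 1) (n : ℂ))
  finite_weight : ∀ n : ℤ, FiniteDimensional ℂ (Module.End.eigenspace (mode V conf 1) (n : ℂ))
  bounded_weight : ∃ N : ℤ, ∀ n : ℤ, n < N → Module.End.eigenspace (mode V conf 1) (n : ℂ) = ⊥

/-- A weak module for a vertex operator algebra `V`: all the axioms of a module except that no
grading is required. -/
class WeakModule (V M : Type*) [AddCommGroup V] [Module ℂ V] [VertexOperatorAlgebra V]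
    [AddCommGroup M] [Module ℂ M] extends HasModes V M where
  truncation : ∀ (v : V) (w : M), ∃ N : ℤ, ∀ n : ℤ, N ≤ n → mode M v n w = 0
  vacuum : ∀ (n : ℤ) (w : M),
    mode M (VertexOperatorAlgebra.vac : V) n w = if n = -1 then w else 0
  jacobi : ∀ (u v : V) (w : M) (p q r : ℤ),
    jacobiDefect (fun v n => mode V v n) (fun v n => mode M v n) (fun v n => mode M v n)
      (fun v n => mode M v n) u v w p q r = 0
  derivative : ∀ (v : V) (n : ℤ),
    mode M (mode V (VertexOperatorAlgebra.conf : V) 0 v) n = (-n : ℂ) • mode M v (n - 1)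

section Basic

variable (V : Type*) [AddCommGroup V] [Module ℂ V] [VertexOperatorAlgebra V]

/-- The adjoint module. -/
instance adjointWeakModule : WeakModule V V where
  truncation := VertexOperatorAlgebra.truncation
  vacuum := VertexOperatorAlgebra.vacuum_left
  jacobi := VertexOperatorAlgebra.jacobi
  derivative := VertexOperatorAlgebra.derivative

/-- The Virasoro operator `L(n) = ω_(n+1)` on `M`. -/
def vir (M : Type*) [AddCommGroup M] [Module ℂ M] [HasModes V M] (n : ℤ) : Module.End ℂ M :=
  mode M (VertexOperatorAlgebra.conf : V) (n + 1)

/-- The weight space `M_(h)`, the eigenspace of `L(0)` of eigenvalue `h`. -/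
def weightSpace (M : Type*) [AddCommGroup M] [Module ℂ M] [HasModes V M] (h : ℂ) :
    Submodule ℂ M :=
  Module.End.eigenspace (vir V M 0) h

/-- A lowest weight generalized `V`-module: a weak module such that `M = ∐_{n ∈ ℕ} M_(h+n)` for
some `h`, and `M_(h)` generates `M`. -/
def IsLowestWeight (M : Type*) [AddCommGroup M] [Module ℂ M] [WeakModule V M] : Prop :=
  ∃ h : ℂ, DirectSum.IsInternal (fun n : ℕ => weightSpace V M (h + n)) ∧
    ∀ S : Submodule ℂ M, weightSpace V M h ≤ S →
      (∀ (v : V) (n : ℤ), ∀ w ∈ S, mode M v n w ∈ S) → S = ⊤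

end Basic

/-! ### Elementary facts about modes -/

theorem mode_add {V M : Type*} [AddCommGroup V] [Module ℂ V] [AddCommGroup M] [Module ℂ M]
    [HasModes V M] (u v : V) (n : ℤ) : mode M (u + v) n = mode M u n + mode M v n := by
  simp [mode]

theorem mode_smul {V M : Type*} [AddCommGroup V] [Module ℂ V] [AddCommGroup M] [Module ℂ M]
    [HasModes V M] (c : ℂ) (v : V) (n : ℤ) : mode M (c • v) n = c • mode M v n := by
  simp [mode]

theorem mode_zero {V M : Type*} [AddCommGroup V] [Module ℂ V] [AddCommGroup M] [Module ℂ M]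
    [HasModes V M] (n : ℤ) : mode M (0 : V) n = 0 := by
  simp [mode]

theorem finite_support_of_eventually_zero {X : Type*} [Zero X] (f : ℕ → X) (N : ℕ)
    (h : ∀ i, N ≤ i → f i = 0) : (Function.support f).Finite := by
  refine (Set.finite_lt_nat N).subset fun i hi => ?_
  by_contra hc
  exact hi (h i (not_lt.mp hc))

theorem choose_zero_of_pos (i : ℕ) (hi : 0 < i) : Ring.choose (0 : ℤ) i = 0 := by
  have := Ring.choose_natCast (R := ℤ) 0 i
  rw [Nat.choose_eq_zero_of_lt hi] at this
  simpa using this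

theorem choose_one_of_lt (i : ℕ) (hi : 1 < i) : Ring.choose (1 : ℤ) i = 0 := by
  have := Ring.choose_natCast (R := ℤ) 1 i
  rw [Nat.choose_eq_zero_of_lt hi] at this
  simpa using this

section Helpers

variable {V : Type*} [AddCommGroup V] [Module ℂ V] [VertexOperatorAlgebra V]

theorem exists_nat_truncation {M : Type*} [AddCommGroup M] [Module ℂ M] [WeakModule V M]
    (v : V) (w : M) (k : ℤ) : ∃ N : ℕ, ∀ i : ℕ, N ≤ i → mode M v (k + i) w = 0 := by
  obtain ⟨N, hN⟩ := WeakModule.truncation v w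
  exact ⟨(N - k).toNat, fun i hi => hN _ (by omega)⟩

/-- `v_m M_(h) ⊆ M_(h+k-m-1)` for `v ∈ V_(k)`. -/
theorem mode_mem_weightSpace {M : Type*} [AddCommGroup M] [Module ℂ M] [WeakModule V M]
    {k h : ℂ} {v : V} {w : M} (hv : v ∈ weightSpace V V k) (hw : w ∈ weightSpace V M h) (m : ℤ) :
    mode M v m w ∈ weightSpace V M (h + k - m - 1) := by
  have hv' : mode V (VertexOperatorAlgebra.conf : V) 1 v = k • v := by
    simpa [weightSpace, vir, Module.End.mem_eigenspace_iff] using hv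
  have hw' : mode M (VertexOperatorAlgebra.conf : V) 1 w = h • w := by
    simpa [weightSpace, vir, Module.End.mem_eigenspace_iff] using hw
  have hJ := WeakModule.jacobi (VertexOperatorAlgebra.conf : V) v w 1 m 0
  unfold jacobiDefect at hJ
  rw [finsum_eq_sum_of_support_subset (s := Finset.range 2),
    finsum_eq_sum_of_support_subset (s := Finset.range 1),
    finsum_eq_sum_of_support_subset (s := Finset.range 1)] at hJ
  · have hD := WeakModule.derivative (M := M) v (m + 1)
    simp only [Finset.sum_range_succ, Finset.sum_range_zero] at hJ
    simp [hv', hw', mode_smul, hD] at hJ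
    rw [weightSpace, Module.End.mem_eigenspace_iff]
    change mode M (VertexOperatorAlgebra.conf : V) (0 + 1) (mode M v m w) = _
    rw [zero_add]
    rw [sub_eq_zero, eq_sub_iff_add_eq] at hJ
    rw [← hJ]
    module
  all_goals
    intro i hi
    by_contra hc
    apply hi
    simp at hc
    first
      | (simp [choose_zero_of_pos i (by omega)]; done)
      | simp [choose_one_of_lt i hc]

theorem vir_one_mem {k : ℂ} {v : V} (hv : v ∈ weightSpace V V k) :
    vir V V 1 v ∈ weightSpace V V (k - 1) := by
  have h := VertexOperatorAlgebra.virasoro (V := V) 0 1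
  have h2 := congrArg (fun f : Module.End ℂ V => f v) h
  have hv' : mode V (VertexOperatorAlgebra.conf : V) 1 v = k • v := by
    simpa [weightSpace, vir, Module.End.mem_eigenspace_iff] using hv
  simp [hv'] at h2
  rw [weightSpace, Module.End.mem_eigenspace_iff]
  change mode V (VertexOperatorAlgebra.conf : V) (0 + 1)
    (mode V (VertexOperatorAlgebra.conf : V) (1 + 1) v) = (k - 1) •
      (mode V (VertexOperatorAlgebra.conf : V) (1 + 1) v)
  rw [sub_eq_iff_eq_add] at h2
  simp [h2]
  module

theorem vir_one_pow_mem {k : ℂ} {v : V} (hv : v ∈ weightSpace V V k) (i : ℕ) :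
    (vir V V 1 ^ i) v ∈ weightSpace V V (k - i) := by
  induction i with
  | zero => simpa using hv
  | succ i ih =>
    rw [pow_succ']
    have := vir_one_mem ih
    rw [show k - ((i + 1 : ℕ) : ℂ) = k - i - 1 by push_cast; ring]
    exact this

theorem isInternal_weightSpace : DirectSum.IsInternal fun n : ℤ => weightSpace V V (n : ℂ) :=
  VertexOperatorAlgebra.graded

theorem iSup_weightSpace : ⨆ n : ℤ, weightSpace V V (n : ℂ) = ⊤ :=
  (isInternal_weightSpace (V := V)).submodule_iSup_eq_top

theorem exists_vir_one_pow_eq_zero (v : V) :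
    ∃ N : ℕ, ∀ i : ℕ, N ≤ i → (vir V V 1 ^ i) v = 0 := by
  have hv : v ∈ ⨆ n : ℤ, weightSpace V V (n : ℂ) := by rw [iSup_weightSpace]; trivial
  induction hv using Submodule.iSup_induction' with
  | mem k v hv =>
    obtain ⟨N, hN⟩ := VertexOperatorAlgebra.bounded_weight (V := V)
    refine ⟨(k - N + 1).toNat, fun i hi => ?_⟩
    have h1 := vir_one_pow_mem hv i
    have h2 : weightSpace V V ((k : ℂ) - i) = ⊥ := by
      have := hN (k - i) (by omega)
      push_cast at this
      exact this
    rw [h2] at h1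
    simpa using h1
  | zero => exact ⟨0, by simp⟩
  | add x y _ _ hx hy =>
    obtain ⟨N, hN⟩ := hx
    obtain ⟨N', hN'⟩ := hy
    exact ⟨max N N', fun i hi => by
      rw [map_add, hN i (le_trans (le_max_left _ _) hi), hN' i (le_trans (le_max_right _ _) hi),
        add_zero]⟩

/-- Extension by linearity of a linear function of homogeneous vectors, given on each weight
space `V_(k)`. -/
def extendHomogeneous {X : Type*} [AddCommGroup X] [Module ℂ X]
    (f : ∀ k : ℤ, weightSpace V V (k : ℂ) →ₗ[ℂ] X) : V →ₗ[ℂ] X :=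
  DirectSum.toModule ℂ ℤ X f ∘ₗ
    (LinearEquiv.ofBijective
      (DirectSum.coeLinearMap (fun k : ℤ => weightSpace V V (k : ℂ)))
      isInternal_weightSpace).symm.toLinearMap

theorem extendHomogeneous_apply {X : Type*} [AddCommGroup X] [Module ℂ X]
    (f : ∀ k : ℤ, weightSpace V V (k : ℂ) →ₗ[ℂ] X) (k : ℤ) (v : V)
    (hv : v ∈ weightSpace V V (k : ℂ)) : extendHomogeneous f v = f k ⟨v, hv⟩ := by
  have : (LinearEquiv.ofBijective
      (DirectSum.coeLinearMap (fun k : ℤ => weightSpace V V (k : ℂ)))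
      isInternal_weightSpace).symm v = DirectSum.lof ℂ ℤ _ k ⟨v, hv⟩ := by
    rw [LinearEquiv.symm_apply_eq]
    exact (DirectSum.coeLinearMap_lof (fun k : ℤ => weightSpace V V (k : ℂ)) k ⟨v, hv⟩).symm
  simp [extendHomogeneous, this]

/-- `v ↦ ∑ i ≥ 0, (1/i!) g_i (L(1)^i v)`, for instance `e^(L(1)) v`. The sum is finite. -/
def expVirOne {X : Type*} [AddCommGroup X] [Module ℂ X] (g : ℕ → V →ₗ[ℂ] X) : V →ₗ[ℂ] X where
  toFun v := ∑ᶠ i : ℕ, ((i.factorial : ℂ)⁻¹) • g i ((vir V V 1 ^ i) v)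
  map_add' u v := by
    obtain ⟨N, hN⟩ := exists_vir_one_pow_eq_zero u
    obtain ⟨N', hN'⟩ := exists_vir_one_pow_eq_zero v
    rw [← finsum_add_distrib
      (finite_support_of_eventually_zero _ N fun i hi => by simp [hN i hi])
      (finite_support_of_eventually_zero _ N' fun i hi => by simp [hN' i hi])]
    simp
  map_smul' c v := by
    obtain ⟨N, hN⟩ := exists_vir_one_pow_eq_zero v
    rw [RingHom.id_apply, smul_finsum' _
      (finite_support_of_eventually_zero _ N fun i hi => by simp [hN i hi])]
    simp [smul_comm c]

end Helpers

/-! ## The opposite vertex operator and the contragredient module -/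

section Contragredient

variable (V M : Type*) [AddCommGroup V] [Module ℂ V] [VertexOperatorAlgebra V]
  [AddCommGroup M] [Module ℂ M] [WeakModule V M]

/-- The coefficient of `x^(-n-1)` in `Y°(v, x) = Y(e^(xL(1)) (-x⁻²)^(L(0)) v, x⁻¹)`: for
`v ∈ V_(k)` it is `(-1)^k ∑ i ≥ 0, (1/i!) (L(1)^i v)_(2k-n-i-2)`. -/
def oppositeMode (n : ℤ) : V →ₗ[ℂ] Module.End ℂ M :=
  extendHomogeneous fun k => ((k.negOnePow : ℤ) : ℂ) •
    (expVirOne fun i =>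
      (LinearMap.proj (2 * k - n - i - 2)) ∘ₗ (HasModes.modes : V →ₗ[ℂ] ℤ → Module.End ℂ M)) ∘ₗ
      (weightSpace V V (k : ℂ)).subtype

/-- The restricted dual `M' = ∐_h (M_(h))^*`, realized inside `M^*` (which is `∏_h (M_(h))^*` for
a generalized module) as the functionals vanishing on all but finitely many weight spaces. -/
def restrictedDual : Submodule ℂ (Module.Dual ℂ M) where
  carrier := {f | {h : ℂ | ∃ w ∈ weightSpace V M h, f w ≠ 0}.Finite}
  zero_mem' := by simp
  add_mem' {f g} hf hg := by
    refine (Set.Finite.union hf hg).subset ?_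
    rintro h ⟨w, hw, hne⟩
    by_cases h0 : f w = 0
    · exact Or.inr ⟨w, hw, fun h1 => hne (by simp [h0, h1])⟩
    · exact Or.inl ⟨w, hw, h0⟩
  smul_mem' c f hf := by
    refine Set.Finite.subset hf ?_
    rintro h ⟨w, hw, hne⟩
    exact ⟨w, hw, fun h0 => hne (by simp [h0])⟩

variable {V M}

theorem oppositeMode_mem_weightSpace {k : ℤ} {h : ℂ} {v : V} {w : M}
    (hv : v ∈ weightSpace V V (k : ℂ)) (hw : w ∈ weightSpace V M h) (n : ℤ) :
    oppositeMode V M n v w ∈ weightSpace V M (h - k + n + 1) := by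
  rw [oppositeMode, extendHomogeneous_apply _ k v hv]
  obtain ⟨N, hN⟩ := exists_vir_one_pow_eq_zero v
  simp only [LinearMap.smul_apply, LinearMap.comp_apply, Submodule.subtype_apply]
  refine Submodule.smul_mem _ _ ?_
  change (∑ᶠ i : ℕ, ((i.factorial : ℂ)⁻¹) •
    mode M ((vir V V 1 ^ i) v) (2 * k - n - i - 2)) w ∈ _
  rw [finsum_eq_sum_of_support_subset (s := Finset.range N)]
  · rw [LinearMap.sum_apply]
    refine Submodule.sum_mem _ fun i _ => ?_
    rw [LinearMap.smul_apply]
    refine Submodule.smul_mem _ _ ?_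
    have := mode_mem_weightSpace (vir_one_pow_mem hv i) hw (2 * k - n - i - 2)
    convert this using 2
    push_cast
    ring
  · intro i hi
    by_contra hc
    apply hi
    simp at hc
    simp [hN i hc, mode_zero]

theorem oppositeMode_dual_mem (n : ℤ) (v : V) (f : Module.Dual ℂ M) (hf : f ∈ restrictedDual V M) :
    f ∘ₗ oppositeMode V M n v ∈ restrictedDual V M := by
  have hv : v ∈ ⨆ n : ℤ, weightSpace V V (n : ℂ) := by rw [iSup_weightSpace]; trivial
  induction hv using Submodule.iSup_induction' with
  | mem k v hv =>
    have hinj : Set.InjOn (fun h : ℂ => h - k + n + 1)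
        ((fun h : ℂ => h - k + n + 1) ⁻¹' {h : ℂ | ∃ w ∈ weightSpace V M h, f w ≠ 0}) := by
      intro a _ b _ hab
      simpa using hab
    refine (Set.Finite.preimage hinj hf).subset ?_
    rintro h ⟨w, hw, hne⟩
    exact ⟨_, oppositeMode_mem_weightSpace hv hw n, hne⟩
  | zero => simp
  | add x y _ _ hx hy =>
    rw [map_add, LinearMap.comp_add]
    exact Submodule.add_mem _ hx hy

/-- The contragredient action on `M'`: `⟨Y'(v, x)f, w⟩ = ⟨f, Y°(v, x)w⟩`. -/
instance contragredientModes : HasModes V (restrictedDual V M) where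
  modes :=
    { toFun := fun v n =>
        { toFun := fun f => ⟨f.1 ∘ₗ oppositeMode V M n v, oppositeMode_dual_mem n v f.1 f.2⟩
          map_add' := fun f g => by ext; simp
          map_smul' := fun c f => by ext; simp }
      map_add' := fun u v => by ext; simp
      map_smul' := fun c v => by ext; simp }

end Contragredient

/-! ## Intertwining operators -/

/-- The three sums of the Jacobi identity are finite. -/
def JacobiFinite {V A B C G : Type*} [AddCommGroup A] [AddCommGroup B] [AddCommGroup C]
    [AddGroupWithOne G]
    (Y₁ : V → ℤ → A → A) (Y₂ : V → ℤ → B → B) (Y₃ : V → ℤ → C → C) (I : A → G → B → C)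
    (v : V) (a : A) (b : B) (p : ℤ) (q : G) (r : ℤ) : Prop :=
  (Function.support fun i : ℕ =>
      Ring.choose p i • I (Y₁ v (r + i) a) (q + ((p - i : ℤ) : G)) b).Finite ∧
  (Function.support fun i : ℕ =>
      ((-1) ^ i * Ring.choose r i) • Y₃ v (p + r - i) (I a (q + (i : G)) b)).Finite ∧
  (Function.support fun i : ℕ =>
      ((r.negOnePow : ℤ) * ((-1) ^ i * Ring.choose r i)) •
        I a (q + ((r - i : ℤ) : G)) (Y₂ v (p + i) b)).Finite

section Intertwining

variable {V A B C : Type*} [AddCommGroup V] [Module ℂ V] [VertexOperatorAlgebra V]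
  [AddCommGroup A] [Module ℂ A] [WeakModule V A] [AddCommGroup B] [Module ℂ B] [WeakModule V B]
  [AddCommGroup C] [Module ℂ C] [HasModes V C]

theorem jacobiFinite_of_truncation (I : A →ₗ[ℂ] (ℂ → (B →ₗ[ℂ] C)))
    (hI : ∀ (a : A) (b : B), ∃ N : ℝ, ∀ n : ℂ, N ≤ n.re → I a n b = 0)
    (v : V) (a : A) (b : B) (p : ℤ) (q : ℂ) (r : ℤ) :
    JacobiFinite (fun v n => mode A v n) (fun v n => mode B v n) (fun v n => mode C v n)
      (fun a n => I a n) v a b p q r := by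
  obtain ⟨N₁, h₁⟩ := exists_nat_truncation v a r
  obtain ⟨N₂, h₂⟩ := hI a b
  obtain ⟨N₃, h₃⟩ := exists_nat_truncation v b p
  refine ⟨finite_support_of_eventually_zero _ N₁ fun i hi => by simp [h₁ i hi],
    finite_support_of_eventually_zero _ ⌈N₂ - q.re⌉₊ fun i hi => ?_,
    finite_support_of_eventually_zero _ N₃ fun i hi => by simp [h₃ i hi]⟩
  have h4 : N₂ - q.re ≤ i := Nat.ceil_le.mp hi
  have h5 : I a (q + (i : ℂ)) b = 0 := h₂ _ (by simp; linarith)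
  simp [h5]

theorem jacobiDefect_add (I J : A →ₗ[ℂ] (ℂ → (B →ₗ[ℂ] C)))
    (v : V) (a : A) (b : B) (p : ℤ) (q : ℂ) (r : ℤ)
    (hI : JacobiFinite (fun v n => mode A v n) (fun v n => mode B v n) (fun v n => mode C v n)
      (fun a n => I a n) v a b p q r)
    (hJ : JacobiFinite (fun v n => mode A v n) (fun v n => mode B v n) (fun v n => mode C v n)
      (fun a n => J a n) v a b p q r) :
    jacobiDefect (fun v n => mode A v n) (fun v n => mode B v n) (fun v n => mode C v n)
      (fun a n => (I + J) a n) v a b p q r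
    = jacobiDefect (fun v n => mode A v n) (fun v n => mode B v n) (fun v n => mode C v n)
      (fun a n => I a n) v a b p q r
    + jacobiDefect (fun v n => mode A v n) (fun v n => mode B v n) (fun v n => mode C v n)
      (fun a n => J a n) v a b p q r := by
  unfold jacobiDefect
  simp only [LinearMap.add_apply, Pi.add_apply, map_add, smul_add]
  rw [finsum_add_distrib hI.1 hJ.1, finsum_add_distrib hI.2.1 hJ.2.1,
    finsum_add_distrib hI.2.2 hJ.2.2]
  abel

theorem jacobiDefect_smul (c : ℂ) (I : A →ₗ[ℂ] (ℂ → (B →ₗ[ℂ] C)))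
    (v : V) (a : A) (b : B) (p : ℤ) (q : ℂ) (r : ℤ) :
    jacobiDefect (fun v n => mode A v n) (fun v n => mode B v n) (fun v n => mode C v n)
      (fun a n => (c • I) a n) v a b p q r
    = c • jacobiDefect (fun v n => mode A v n) (fun v n => mode B v n) (fun v n => mode C v n)
      (fun a n => I a n) v a b p q r := by
  unfold jacobiDefect
  simp only [LinearMap.smul_apply, Pi.smul_apply, map_smul, smul_sub, smul_finsum,
    smul_comm _ c]

variable (V A B C)

/-- The space of intertwining operators of type `(C over A B)`: linear maps
`𝒴(·, x) : A → Hom(B, C){x}`, `𝒴(a, x) = ∑ n : ℂ, a_n x^(-n-1)` with `a_n = 𝒴 a n`, satisfying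
lower truncation, the `L(-1)`-derivative property and the Jacobi identity. -/
def intertwiningOperators : Submodule ℂ (A →ₗ[ℂ] (ℂ → (B →ₗ[ℂ] C))) where
  carrier := {I |
    (∀ (a : A) (b : B), ∃ N : ℝ, ∀ n : ℂ, N ≤ n.re → I a n b = 0) ∧
    (∀ (a : A) (n : ℂ), I (vir V A (-1) a) n = (-n) • I a (n - 1)) ∧
    (∀ (v : V) (a : A) (b : B) (p : ℤ) (q : ℂ) (r : ℤ),
      jacobiDefect (fun v n => mode A v n) (fun v n => mode B v n) (fun v n => mode C v n)
        (fun a n => I a n) v a b p q r = 0)}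
  zero_mem' := by
    refine ⟨fun _ _ => ⟨0, by simp⟩, by simp, fun v a b p q r => ?_⟩
    simp [jacobiDefect]
  add_mem' {I J} hI hJ := by
    have key : ∀ (a : A) (b : B), ∃ N : ℝ, ∀ n : ℂ, N ≤ n.re → I a n b = 0 ∧ J a n b = 0 := by
      intro a b
      obtain ⟨N, hN⟩ := hI.1 a b
      obtain ⟨N', hN'⟩ := hJ.1 a b
      exact ⟨max N N', fun n hn =>
        ⟨hN n (le_trans (le_max_left _ _) hn), hN' n (le_trans (le_max_right _ _) hn)⟩⟩
    refine ⟨fun a b => ?_, fun a n => ?_, fun v a b p q r => ?_⟩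
    · obtain ⟨N, hN⟩ := key a b
      exact ⟨N, fun n hn => by simp [hN n hn]⟩
    · simp [hI.2.1 a n, hJ.2.1 a n]
    · rw [jacobiDefect_add I J v a b p q r (jacobiFinite_of_truncation I hI.1 v a b p q r)
        (jacobiFinite_of_truncation J hJ.1 v a b p q r), hI.2.2, hJ.2.2, add_zero]
  smul_mem' c I hI := by
    refine ⟨fun a b => ?_, fun a n => ?_, fun v a b p q r => ?_⟩
    · obtain ⟨N, hN⟩ := hI.1 a b
      exact ⟨N, fun n hn => by simp [hN n hn]⟩
    · simp [hI.2.1 a n, smul_comm c]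
    · rw [jacobiDefect_smul, hI.2.2, smul_zero]

end Intertwining

/-! ## Zhu's algebra `A(V)`, its modules, and the bimodules `A(M)` -/

section Zhu

variable (V M : Type*) [AddCommGroup V] [Module ℂ V] [VertexOperatorAlgebra V]
  [AddCommGroup M] [Module ℂ M] [WeakModule V M]

/-- `Res_x x^(-a) (1+x)^(wt v + b) Y(v, x)w` for homogeneous `v`, extended linearly in `v`. For
`v ∈ V_(k)` it is `∑ i ≥ 0, (k+b choose i) v_(i-a) w`. -/
def residueProduct (a b : ℤ) : V →ₗ[ℂ] M →ₗ[ℂ] M :=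
  extendHomogeneous fun k =>
    (LinearMap.mk₂ ℂ
      (fun (v : V) (w : M) => ∑ᶠ i : ℕ, Ring.choose (k + b) i • mode M v (-a + i) w)
      (fun u v w => by
        obtain ⟨N, hN⟩ := exists_nat_truncation u w (-a)
        obtain ⟨N', hN'⟩ := exists_nat_truncation v w (-a)
        rw [← finsum_add_distrib
          (finite_support_of_eventually_zero _ N fun i hi => by simp [hN i hi])
          (finite_support_of_eventually_zero _ N' fun i hi => by simp [hN' i hi])]
        simp [mode_add])
      (fun c v w => by simp [mode_smul, smul_finsum, smul_comm c])
      (fun v w w' => by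
        obtain ⟨N, hN⟩ := exists_nat_truncation v w (-a)
        obtain ⟨N', hN'⟩ := exists_nat_truncation v w' (-a)
        rw [← finsum_add_distrib
          (finite_support_of_eventually_zero _ N fun i hi => by simp [hN i hi])
          (finite_support_of_eventually_zero _ N' fun i hi => by simp [hN' i hi])]
        simp)
      (fun c v w => by simp [smul_finsum, smul_comm c])) ∘ₗ
      (weightSpace V V (k : ℂ)).subtype

/-- `O(M)`, the span of `Res_x x⁻² (1+x)^(wt v) Y(v, x)w`. -/
def zhuO : Submodule ℂ M :=
  Submodule.span ℂ {x | ∃ (v : V) (w : M), x = residueProduct V M 2 0 v w}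

/-- `A(M) = M / O(M)`; in particular `A(V) = V / O(V)`. -/
abbrev ZhuA : Type _ := M ⧸ zhuO V M

variable {V M}

/-- The left action `v * w = Res_x x⁻¹ (1+x)^(wt v) Y(v, x)w`; for `M = V` this is the product
inducing the multiplication of `A(V)`. -/
def zhuLeft (v : V) (w : M) : M := residueProduct V M 1 0 v w

/-- The right action `w * v = Res_x x⁻¹ (1+x)^(wt v - 1) Y(v, x)w`. -/
def zhuRight (w : M) (v : V) : M := residueProduct V M 1 (-1) v w

/-- `θ(v) = e^(L(1)) (-1)^(L(0)) v`, inducing the anti-involution of `A(V)`. -/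
def zhuTheta : V →ₗ[ℂ] V :=
  extendHomogeneous fun k => ((k.negOnePow : ℤ) : ℂ) •
    (expVirOne fun _ => LinearMap.id) ∘ₗ (weightSpace V V (k : ℂ)).subtype

end Zhu

/-- A (left, unital) `A(V)`-module `U`: a linear action of `A(V)` on `U` compatible with the
identity element `𝟏 + O(V)` and with the product of `A(V)` induced by `u * v`. -/
class ZhuModule (V U : Type*) [AddCommGroup V] [Module ℂ V] [VertexOperatorAlgebra V]
    [AddCommGroup U] [Module ℂ U] where
  act : ZhuA V V →ₗ[ℂ] Module.End ℂ U
  act_one : act (Submodule.Quotient.mk (VertexOperatorAlgebra.vac : V)) = 1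
  act_mul : ∀ u v : V, act (Submodule.Quotient.mk (zhuLeft u v))
    = act (Submodule.Quotient.mk u) * act (Submodule.Quotient.mk v)

section ZhuModules

variable (V U : Type*) [AddCommGroup V] [Module ℂ V] [VertexOperatorAlgebra V]
  [AddCommGroup U] [Module ℂ U] [ZhuModule V U]

/-- The action of `v + O(V) ∈ A(V)` on `U`. -/
def zhuAct (v : V) : Module.End ℂ U := ZhuModule.act (Submodule.Quotient.mk v : ZhuA V V)

/-- Irreducibility of an `A(V)`-module. -/
def IsIrreducibleZhu : Prop :=
  Nontrivial U ∧ ∀ S : Submodule ℂ U, (∀ (v : V), ∀ u ∈ S, zhuAct V U v u ∈ S) → S = ⊥ ∨ S = ⊤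

/-- `Hom_{A(V) ⊗ A(V)}(U₁ ⊗ U₂, A(M)^*)`, where `A(V) ⊗ A(V)` acts on `A(M)^*` by
`((a₁ ⊗ a₂) f)(w) = f(θ(a₂) w a₁)`. -/
def zhuHom (U' M : Type*) [AddCommGroup U'] [Module ℂ U'] [ZhuModule V U']
    [AddCommGroup M] [Module ℂ M] [WeakModule V M] :
    Submodule ℂ (U ⊗[ℂ] U' →ₗ[ℂ] Module.Dual ℂ (ZhuA V M)) where
  carrier := {φ | ∀ (v v' : V) (u : U) (u' : U') (w : M),
    φ (zhuAct V U v u ⊗ₜ zhuAct V U' v' u') (Submodule.Quotient.mk w)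
      = φ (u ⊗ₜ u') (Submodule.Quotient.mk (zhuLeft (zhuTheta v') (zhuRight w v)))}
  zero_mem' := by simp
  add_mem' hf hg := fun v v' u u' w => by simp [hf v v' u u' w, hg v v' u u' w]
  smul_mem' c f hf := fun v v' u u' w => by simp [hf v v' u u' w]

end ZhuModules

/-! ## The Lie algebra `g(V)` and the universal weak module `F(U)` -/

section Universal

open LaurentPolynomial

variable (V : Type*) [AddCommGroup V] [Module ℂ V] [VertexOperatorAlgebra V]

/-- `v(m) = v ⊗ t^m`, viewed in the tensor algebra of `V ⊗ ℂ[t, t⁻¹]`. -/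
def loopGen : V →ₗ[ℂ] ℤ → TensorAlgebra ℂ (V ⊗[ℂ] ℂ[T;T⁻¹]) where
  toFun v m := TensorAlgebra.ι ℂ (v ⊗ₜ T m)
  map_add' u v := by ext m; simp [TensorProduct.add_tmul]
  map_smul' c v := by ext m; simp [← TensorProduct.smul_tmul']

/-- The defining relations of the universal enveloping algebra of
`g(V) = (V ⊗ ℂ[t, t⁻¹]) / (L(-1) ⊗ 1 + 1 ⊗ d/dt)(V ⊗ ℂ[t, t⁻¹])`, with the Lie bracket
`[u(m), v(n)] = ∑ i ≥ 0, (m choose i) (u_i v)(m+n-i)`. -/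
inductive EnvRel : TensorAlgebra ℂ (V ⊗[ℂ] ℂ[T;T⁻¹]) → TensorAlgebra ℂ (V ⊗[ℂ] ℂ[T;T⁻¹]) → Prop
  | translation (v : V) (m : ℤ) :
      EnvRel (loopGen V (vir V V (-1) v) m + (m : ℂ) • loopGen V v (m - 1)) 0
  | bracket (u v : V) (m n : ℤ) :
      EnvRel (loopGen V u m * loopGen V v n - loopGen V v n * loopGen V u m)
        (∑ᶠ i : ℕ, Ring.choose m i • loopGen V (mode V u i v) (m + n - i))

/-- The universal enveloping algebra `U(g(V))`, presented as the tensor algebra of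
`V ⊗ ℂ[t, t⁻¹]` modulo the relations of `g(V)`. -/
def EnvAlg : Type _ := RingQuot (EnvRel V)

instance : Ring (EnvAlg V) := inferInstanceAs (Ring (RingQuot (EnvRel V)))
instance : Algebra ℂ (EnvAlg V) := inferInstanceAs (Algebra ℂ (RingQuot (EnvRel V)))

/-- The quotient map from the tensor algebra onto `U(g(V))`. -/
def envMk : TensorAlgebra ℂ (V ⊗[ℂ] ℂ[T;T⁻¹]) →ₐ[ℂ] EnvAlg V := RingQuot.mkAlgHom ℂ (EnvRel V)

/-- `v(m)` as an element of `U(g(V))`. -/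
def envGen : V →ₗ[ℂ] ℤ → EnvAlg V :=
  (LinearMap.compLeft (envMk V).toLinearMap ℤ) ∘ₗ loopGen V

variable (U : Type*) [AddCommGroup U] [Module ℂ U] [ZhuModule V U]

/-- The submodule of `U(g(V)) ⊗ U` generated by the relations `v(m) ⊗ u = 0` for
`deg v(m) = wt v - m - 1 < 0` and `v(wt v - 1) ⊗ u = 1 ⊗ (v + O(V))u`. -/
def inducedRel : Submodule (EnvAlg V) (EnvAlg V ⊗[ℂ] U) :=
  Submodule.span (EnvAlg V)
    ({x | ∃ (k m : ℤ) (v : V) (u : U), v ∈ weightSpace V V (k : ℂ) ∧ k - m - 1 < 0 ∧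
        x = envGen V v m ⊗ₜ[ℂ] u} ∪
     {x | ∃ (k : ℤ) (v : V) (u : U), v ∈ weightSpace V V (k : ℂ) ∧
        x = envGen V v (k - 1) ⊗ₜ[ℂ] u - (1 : EnvAlg V) ⊗ₜ[ℂ] zhuAct V U v u})

/-- The induced `g(V)`-module `U(g(V)) ⊗_{U(g(V)₋ + g(V)₀)} U`, where `g(V)₋` acts on `U` by zero
and `g(V)₀` acts through `v(wt v - 1) ↦ v + O(V)`. -/
abbrev InducedModule : Type _ := (EnvAlg V ⊗[ℂ] U) ⧸ inducedRel V U

/-- The submodule generated by the coefficients of the Jacobi identity. -/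
def jacobiRel : Submodule (EnvAlg V) (InducedModule V U) :=
  Submodule.span (EnvAlg V)
    {x | ∃ (u v : V) (w : InducedModule V U) (p q r : ℤ),
      x = jacobiDefect (fun u n => mode V u n) (fun u n w => envGen V u n • w)
        (fun u n w => envGen V u n • w) (fun v n w => envGen V v n • w) u v w p q r}

/-- The universal weak `V`-module `F(U)`: the quotient of the induced module by the Jacobi
identity relations. -/
def UniversalModule : Type _ := InducedModule V U ⧸ jacobiRel V U

instance : AddCommGroup (UniversalModule V U) :=
  inferInstanceAs (AddCommGroup (InducedModule V U ⧸ jacobiRel V U))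
instance : Module (EnvAlg V) (UniversalModule V U) :=
  inferInstanceAs (Module (EnvAlg V) (InducedModule V U ⧸ jacobiRel V U))
instance : Module ℂ (UniversalModule V U) :=
  inferInstanceAs (Module ℂ (InducedModule V U ⧸ jacobiRel V U))
instance : IsScalarTower ℂ (EnvAlg V) (UniversalModule V U) :=
  inferInstanceAs (IsScalarTower ℂ (EnvAlg V) (InducedModule V U ⧸ jacobiRel V U))

instance : HasModes V (UniversalModule V U) where
  modes := (LinearMap.compLeft
    (Algebra.lsmul ℂ ℂ (UniversalModule V U) : EnvAlg V →ₐ[ℂ] _).toLinearMap ℤ) ∘ₗ envGen V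

/-- The quotient map onto `F(U)`. -/
def universalMk : InducedModule V U →ₗ[EnvAlg V] UniversalModule V U := (jacobiRel V U).mkQ

variable {V U}

theorem universalMk_surjective : Function.Surjective (universalMk V U) :=
  (jacobiRel V U).mkQ_surjective

theorem universalMk_eq_zero {w : InducedModule V U} (hw : w ∈ jacobiRel V U) :
    universalMk V U w = 0 :=
  (Submodule.Quotient.mk_eq_zero _).mpr hw

theorem mode_universal (v : V) (n : ℤ) (w : UniversalModule V U) :
    mode (UniversalModule V U) v n w = envGen V v n • w := rfl

theorem env_translation (v : V) (m : ℤ) :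
    envGen V (mode V (VertexOperatorAlgebra.conf : V) 0 v) m = (-m : ℂ) • envGen V v (m - 1) := by
  have h : envMk V _ = envMk V _ := RingQuot.mkAlgHom_rel ℂ (EnvRel.translation v m)
  rw [map_add, map_smul, map_zero] at h
  have h' : envGen V (mode V (VertexOperatorAlgebra.conf : V) 0 v) m
      + (m : ℂ) • envGen V v (m - 1) = 0 := h
  rw [neg_smul]
  exact eq_neg_of_add_eq_zero_left h'

theorem env_bracket (u v : V) (m n : ℤ) :
    envGen V u m * envGen V v n = envGen V v n * envGen V u m +
      ∑ᶠ i : ℕ, Ring.choose m i • envGen V (mode V u i v) (m + n - i) := by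
  have h : envMk V _ = envMk V _ := RingQuot.mkAlgHom_rel ℂ (EnvRel.bracket u v m n)
  obtain ⟨N, hN⟩ := exists_nat_truncation u v 0
  rw [map_sub, map_mul, map_mul, map_finsum (envMk V)
    (finite_support_of_eventually_zero _ N fun i hi => by
      have := hN i hi
      rw [zero_add] at this
      simp [this])] at h
  simp only [map_zsmul] at h
  rw [← sub_eq_iff_eq_add']
  exact h

theorem env_induction {P : EnvAlg V → Prop} (hs : ∀ c : ℂ, P (algebraMap ℂ (EnvAlg V) c))
    (hg : ∀ (v : V) (m : ℤ), P (envGen V v m)) (hm : ∀ x y, P x → P y → P (x * y))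
    (ha : ∀ x y, P x → P y → P (x + y)) (x : EnvAlg V) : P x := by
  obtain ⟨y, rfl⟩ : ∃ y, envMk V y = x := RingQuot.mkAlgHom_surjective ℂ (EnvRel V) x
  induction y using TensorAlgebra.induction with
  | algebraMap c => rw [AlgHom.commutes]; exact hs c
  | ι t =>
    induction t using TensorProduct.induction_on with
    | zero => simpa using hs 0
    | add a b h1 h2 => rw [map_add, map_add]; exact ha _ _ h1 h2
    | tmul v p =>
      induction p using LaurentPolynomial.induction_on' with
      | add a b h1 h2 => rw [TensorProduct.tmul_add, map_add, map_add]; exact ha _ _ h1 h2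
      | C_mul_T n c =>
        have : v ⊗ₜ[ℂ] (LaurentPolynomial.C c * T n) = (c • v) ⊗ₜ[ℂ] (T n : ℂ[T;T⁻¹]) := by
          rw [← LaurentPolynomial.smul_eq_C_mul, TensorProduct.tmul_smul, TensorProduct.smul_tmul']
        rw [this]
        exact hg (c • v) n
  | mul a b h1 h2 => rw [map_mul]; exact hm _ _ h1 h2
  | add a b h1 h2 => rw [map_add]; exact ha _ _ h1 h2

theorem induced_induction {P : InducedModule V U → Prop} (h0 : P 0)
    (ha : ∀ x y, P x → P y → P (x + y))
    (h1 : ∀ (x : EnvAlg V) (u : U), P (x • (inducedRel V U).mkQ ((1 : EnvAlg V) ⊗ₜ[ℂ] u)))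
    (w : InducedModule V U) : P w := by
  obtain ⟨t, rfl⟩ := (inducedRel V U).mkQ_surjective w
  induction t using TensorProduct.induction_on with
  | zero => simpa using h0
  | add a b ha' hb' => rw [map_add]; exact ha _ _ ha' hb'
  | tmul x u =>
    have := h1 x u
    rwa [← map_smul, TensorProduct.smul_tmul', smul_eq_mul, mul_one] at this

theorem induced_truncation (v : V) (w : InducedModule V U) :
    ∃ N : ℤ, ∀ n : ℤ, N ≤ n → envGen V v n • w = 0 := by
  have hstep : ∀ x : EnvAlg V, ∀ w : InducedModule V U,
      (∀ v : V, ∃ N : ℤ, ∀ n : ℤ, N ≤ n → envGen V v n • w = 0) →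
      (∀ v : V, ∃ N : ℤ, ∀ n : ℤ, N ≤ n → envGen V v n • x • w = 0) := by
    intro x
    induction x using env_induction with
    | hs c =>
      intro w hw v
      obtain ⟨N, hN⟩ := hw v
      exact ⟨N, fun n hn => by rw [algebraMap_smul, smul_comm, hN n hn, smul_zero]⟩
    | hg a m =>
      intro w hw v
      obtain ⟨N₀, hN₀⟩ := hw v
      obtain ⟨K, hK⟩ := exists_nat_truncation v a 0
      choose N hN using fun i : ℕ => hw (mode V v i a)
      refine ⟨max N₀ ((∑ i ∈ Finset.range K, |N i|) - m + K), fun n hn => ?_⟩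
      rw [smul_smul, env_bracket, add_smul, mul_smul, hN₀ n (le_trans (le_max_left _ _) hn),
        smul_zero, zero_add, finsum_eq_sum_of_support_subset (s := Finset.range K)]
      · rw [Finset.sum_smul]
        refine Finset.sum_eq_zero fun i hi => ?_
        have h1 : |N i| ≤ ∑ i ∈ Finset.range K, |N i| :=
          Finset.single_le_sum (f := fun i => |N i|) (fun i _ => abs_nonneg (N i)) hi
        have h2 := le_trans (le_max_right _ _) hn
        have h3 := le_abs_self (N i)
        have h4 := Finset.mem_range.mp hi
        rw [smul_assoc, hN i (n + m - i) (by omega), smul_zero]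
      · intro i hi
        by_contra hc
        apply hi
        simp at hc
        have := hK i hc
        rw [zero_add] at this
        simp [this]
    | hm x y hx hy =>
      intro w hw
      rw [mul_smul]
      exact hx _ (hy w hw)
    | ha x y hx hy =>
      intro w hw v
      obtain ⟨N, hN⟩ := hx w hw v
      obtain ⟨N', hN'⟩ := hy w hw v
      exact ⟨max N N', fun n hn => by
        rw [add_smul, smul_add, hN n (le_trans (le_max_left _ _) hn),
          hN' n (le_trans (le_max_right _ _) hn), add_zero]⟩
  revert v
  induction w using induced_induction with
  | h0 => exact fun v => ⟨0, by simp⟩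
  | ha x y hx hy =>
    intro v
    obtain ⟨N, hN⟩ := hx v
    obtain ⟨N', hN'⟩ := hy v
    exact ⟨max N N', fun n hn => by
      rw [smul_add, hN n (le_trans (le_max_left _ _) hn),
        hN' n (le_trans (le_max_right _ _) hn), add_zero]⟩
  | h1 x u =>
    refine hstep x _ fun v => ?_
    have hv : v ∈ ⨆ n : ℤ, weightSpace V V (n : ℂ) := by rw [iSup_weightSpace]; trivial
    induction hv using Submodule.iSup_induction' with
    | mem k v hv =>
      refine ⟨k, fun n hn => ?_⟩
      rw [← map_smul, TensorProduct.smul_tmul', smul_eq_mul, mul_one, Submodule.mkQ_apply,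
        Submodule.Quotient.mk_eq_zero]
      exact Submodule.subset_span (Or.inl ⟨k, n, v, u, hv, by omega, rfl⟩)
    | zero => exact ⟨0, by simp⟩
    | add a b _ _ ha hb =>
      obtain ⟨N, hN⟩ := ha
      obtain ⟨N', hN'⟩ := hb
      exact ⟨max N N', fun n hn => by
        rw [map_add, Pi.add_apply, add_smul, hN n (le_trans (le_max_left _ _) hn),
          hN' n (le_trans (le_max_right _ _) hn), add_zero]⟩

theorem mode_vac_nonneg (v : V) (i : ℕ) : mode V (VertexOperatorAlgebra.vac : V) i v = 0 := by
  rw [VertexOperatorAlgebra.vacuum_left, if_neg (by omega)]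

theorem env_vac_of_ne (n : ℤ) (hn : n ≠ -1) :
    envGen V (VertexOperatorAlgebra.vac : V) n = 0 := by
  have h := env_translation (VertexOperatorAlgebra.vac : V) (n + 1)
  rw [(VertexOperatorAlgebra.creation (VertexOperatorAlgebra.conf : V)).2 0 le_rfl, map_zero,
    Pi.zero_apply, add_sub_cancel_right] at h
  rcases smul_eq_zero.mp h.symm with h | h
  · rw [neg_eq_zero] at h
    exact absurd (by exact_mod_cast h : n + 1 = 0) (by omega)
  · exact h

theorem env_vac_commute (x : EnvAlg V) :
    envGen V (VertexOperatorAlgebra.vac : V) (-1) * x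
      = x * envGen V (VertexOperatorAlgebra.vac : V) (-1) := by
  induction x using env_induction with
  | hs c => exact (Algebra.commutes c _).symm
  | hg v m => rw [env_bracket]; simp [mode_vac_nonneg]
  | hm x y hx hy => rw [← mul_assoc, hx, mul_assoc, hy, mul_assoc]
  | ha x y hx hy => rw [mul_add, add_mul, hx, hy]

theorem vac_mem : (VertexOperatorAlgebra.vac : V) ∈ weightSpace V V ((0 : ℤ) : ℂ) := by
  rw [weightSpace, Module.End.mem_eigenspace_iff]
  simp [vir, (VertexOperatorAlgebra.creation (VertexOperatorAlgebra.conf : V)).2 1 (by norm_num)]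

theorem induced_vac (w : InducedModule V U) :
    envGen V (VertexOperatorAlgebra.vac : V) (-1) • w = w := by
  induction w using induced_induction with
  | h0 => simp
  | ha x y hx hy => rw [smul_add, hx, hy]
  | h1 x u =>
    rw [smul_smul, env_vac_commute, mul_smul]
    congr 1
    rw [← map_smul, TensorProduct.smul_tmul', smul_eq_mul, mul_one, ← sub_eq_zero, ← map_sub,
      Submodule.mkQ_apply, Submodule.Quotient.mk_eq_zero]
    refine Submodule.subset_span (Or.inr ⟨0, VertexOperatorAlgebra.vac, u, vac_mem, ?_⟩)
    rw [zhuAct, ZhuModule.act_one, Module.End.one_apply, zero_sub]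

theorem universal_jacobi (u v : V) (w : UniversalModule V U) (p q r : ℤ) :
    jacobiDefect (fun v n => mode V v n) (fun v n => mode (UniversalModule V U) v n)
      (fun v n => mode (UniversalModule V U) v n) (fun v n => mode (UniversalModule V U) v n)
      u v w p q r = 0 := by
  obtain ⟨w, rfl⟩ := universalMk_surjective w
  have hmem : universalMk V U
      (jacobiDefect (fun u n => mode V u n) (fun u n w => envGen V u n • w)
        (fun u n w => envGen V u n • w) (fun v n w => envGen V v n • w) u v w p q r) = 0 :=
    universalMk_eq_zero (Submodule.subset_span ⟨u, v, w, p, q, r, rfl⟩)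
  rw [← hmem]
  obtain ⟨N₁, h₁⟩ := exists_nat_truncation u v r
  obtain ⟨N₂, h₂⟩ := induced_truncation v w
  obtain ⟨N₃, h₃⟩ := induced_truncation u w
  unfold jacobiDefect
  rw [map_sub, map_sub,
    map_finsum _ (finite_support_of_eventually_zero _ N₁ fun i hi => by simp [h₁ i hi]),
    map_finsum _ (finite_support_of_eventually_zero _ (N₂ - q).toNat fun i hi => by
      have : envGen V v (q + i) • w = 0 := h₂ _ (by omega)
      simp [this]),
    map_finsum _ (finite_support_of_eventually_zero _ (N₃ - p).toNat fun i hi => by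
      have : envGen V u (p + i) • w = 0 := h₃ _ (by omega)
      simp [this])]
  simp only [map_zsmul, map_smul, mode_universal]

variable (V U)

/-- `F(U)` is a weak `V`-module. -/
instance universalWeakModule : WeakModule V (UniversalModule V U) where
  truncation v w := by
    obtain ⟨w, rfl⟩ := universalMk_surjective w
    obtain ⟨N, hN⟩ := induced_truncation v w
    refine ⟨N, fun n hn => ?_⟩
    have h := congrArg (universalMk V U) (hN n hn)
    rw [map_smul, map_zero] at h
    exact h
  vacuum n w := by
    rw [mode_universal]
    split_ifs with h
    · obtain ⟨w, rfl⟩ := universalMk_surjective w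
      have h' := congrArg (universalMk V U) (induced_vac w)
      rw [map_smul] at h'
      rw [h]
      exact h'
    · rw [env_vac_of_ne n h, zero_smul]
  jacobi := universal_jacobi
  derivative v n := by
    ext w
    rw [mode_universal, env_translation, LinearMap.smul_apply, mode_universal, smul_assoc]

/-- The natural map `e_U : U → F(U)`. -/
def universalMap : U →ₗ[ℂ] UniversalModule V U :=
  ((universalMk V U).restrictScalars ℂ) ∘ₗ ((inducedRel V U).mkQ.restrictScalars ℂ) ∘ₗ
    (TensorProduct.mk ℂ (EnvAlg V) U 1)

end Universal

/-! ## The `V ⊗ V`-module `D_{P(z)}(M)` inside `M^*` -/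

section Regular

open Polynomial

variable {F : Type*} [Field F]

/-- Multiplication by `x` on `F[[x, x⁻¹]]`, the series `∑ n : ℤ, s n x^n` being written as
`s : ℤ → F`. -/
def seriesMulX : Module.End F (ℤ → F) where
  toFun s n := s (n - 1)
  map_add' _ _ := rfl
  map_smul' _ _ := rfl

/-- The product of the polynomial `P(x)` and the series `s(x) ∈ F[[x, x⁻¹]]`. -/
def polyMul (P : F[X]) (s : ℤ → F) : ℤ → F := aeval seriesMulX P s

/-- A polynomial, viewed in `F[[x, x⁻¹]]`. -/
def polySeries (g : F[X]) : ℤ → F := fun n => if 0 ≤ n then g.coeff n.toNat else 0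

/-- `ι_{x;∞}⁻¹ s` for a series `s ∈ F((x⁻¹))` in the range of `ι_{x;∞}`, the expansion of rational
functions at `x = ∞`: it is `g / P` if `P(x) s(x) = g(x)` with polynomials `P ≠ 0` and `g`. (It is
`0` if there are no such `P` and `g`.) -/
def iotaInftyInv (s : ℤ → F) : RatFunc F :=
  open Classical in
  if h : ∃ Pg : F[X] × F[X], Pg.1 ≠ 0 ∧ polyMul Pg.1 s = polySeries Pg.2 then
    algebraMap F[X] (RatFunc F) h.choose.2 / algebraMap F[X] (RatFunc F) h.choose.1
  else 0

/-- The coefficient of `x^n` in `ι_{x;0} f`, the Laurent expansion of `f(x)` at `x = 0`. -/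
def iotaZeroCoeff (f : RatFunc F) (n : ℤ) : F := (f : LaurentSeries F).coeff n

/-- `f(x) ↦ f(x + z)` for rational functions. -/
def ratTranslate (z : F) : RatFunc F →ₐ[F] RatFunc F :=
  RatFunc.mapAlgHom (algEquivAevalXAddC z).toAlgHom
    (nonZeroDivisors_le_comap_nonZeroDivisors_of_injective _ (algEquivAevalXAddC z).injective)

theorem polyMul_mul (P Q : F[X]) (s : ℤ → F) : polyMul (P * Q) s = polyMul P (polyMul Q s) := by
  simp [polyMul]

theorem polyMul_add (P : F[X]) (s t : ℤ → F) :
    polyMul P (s + t) = polyMul P s + polyMul P t := by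
  simp [polyMul]

theorem polyMul_smul (P : F[X]) (c : F) (s : ℤ → F) :
    polyMul P (c • s) = c • polyMul P s := by
  simp [polyMul]

theorem polySeries_add (f g : F[X]) : polySeries (f + g) = polySeries f + polySeries g := by
  ext n
  by_cases h : 0 ≤ n <;> simp [polySeries, h]

theorem polySeries_smul (c : F) (g : F[X]) : polySeries (c • g) = c • polySeries g := by
  ext n
  by_cases h : 0 ≤ n <;> simp [polySeries, h]

theorem polySeries_injective : Function.Injective (polySeries (F := F)) := by
  intro f g h
  ext n
  simpa [polySeries] using congrFun h n

theorem polySeries_mul (P g : F[X]) : polySeries (P * g) = polyMul P (polySeries g) := by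
  induction P using Polynomial.induction_on' with
  | add p q hp hq => rw [add_mul, polySeries_add, hp, hq]; simp [polyMul]
  | monomial n a =>
    induction n with
    | zero =>
      rw [Polynomial.monomial_zero_left, ← Polynomial.smul_eq_C_mul, polySeries_smul]
      simp [polyMul, Module.algebraMap_end_apply]
    | succ n ih =>
      rw [← Polynomial.monomial_mul_X, mul_comm (monomial n a) X, mul_assoc, polyMul_mul, ← ih]
      ext m
      simp only [polyMul, aeval_X, seriesMulX, LinearMap.coe_mk, AddHom.coe_mk, polySeries]
      by_cases h1 : 0 ≤ m - 1
      · rw [if_pos (by omega), if_pos h1, show m.toNat = (m - 1).toNat + 1 by omega,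
          coeff_X_mul]
      · rw [if_neg h1]
        by_cases h2 : 0 ≤ m
        · rw [if_pos h2, show m.toNat = 0 by omega]
          simp
        · rw [if_neg h2]

theorem iotaInftyInv_eq {s : ℤ → F} {P g : F[X]} (hP : P ≠ 0)
    (h : polyMul P s = polySeries g) :
    iotaInftyInv s = algebraMap F[X] (RatFunc F) g / algebraMap F[X] (RatFunc F) P := by
  have hex : ∃ Pg : F[X] × F[X], Pg.1 ≠ 0 ∧ polyMul Pg.1 s = polySeries Pg.2 := ⟨(P, g), hP, h⟩
  rw [iotaInftyInv, dif_pos hex]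
  obtain ⟨h1, h2⟩ := hex.choose_spec
  rw [div_eq_div_iff (by simpa using h1) (by simpa using hP), ← map_mul, ← map_mul]
  congr 1
  apply polySeries_injective
  rw [mul_comm, polySeries_mul, ← h2, mul_comm g, polySeries_mul, ← h, ← polyMul_mul,
    ← polyMul_mul, mul_comm]

theorem iotaInftyInv_add {s t : ℤ → F} (hs : ∃ P g, P ≠ 0 ∧ polyMul P s = polySeries g)
    (ht : ∃ P g, P ≠ 0 ∧ polyMul P t = polySeries g) :
    iotaInftyInv (s + t) = iotaInftyInv s + iotaInftyInv t := by
  obtain ⟨P, g, hP, hg⟩ := hs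
  obtain ⟨Q, f, hQ, hf⟩ := ht
  have h : polyMul (P * Q) (s + t) = polySeries (Q * g + P * f) := by
    rw [polyMul_add, polySeries_add, polySeries_mul, polySeries_mul, ← hg, ← hf, ← polyMul_mul,
      ← polyMul_mul, mul_comm Q P]
  rw [iotaInftyInv_eq (mul_ne_zero hP hQ) h, iotaInftyInv_eq hP hg, iotaInftyInv_eq hQ hf]
  have hP' : algebraMap F[X] (RatFunc F) P ≠ 0 := by simpa using hP
  have hQ' : algebraMap F[X] (RatFunc F) Q ≠ 0 := by simpa using hQ
  simp only [map_mul, map_add]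
  field_simp

theorem iotaInftyInv_smul (c : F) {s : ℤ → F} (hs : ∃ P g, P ≠ 0 ∧ polyMul P s = polySeries g) :
    iotaInftyInv (c • s) = algebraMap F[X] (RatFunc F) (C c) * iotaInftyInv s := by
  obtain ⟨P, g, hP, hg⟩ := hs
  have h : polyMul P (c • s) = polySeries (c • g) := by
    rw [polyMul_smul, polySeries_smul, hg]
  rw [iotaInftyInv_eq hP h, iotaInftyInv_eq hP hg, Polynomial.smul_eq_C_mul, map_mul,
    mul_div_assoc]

theorem iotaInftyInv_zero : iotaInftyInv (0 : ℤ → F) = 0 := by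
  rw [iotaInftyInv_eq (F := F) (P := 1) (g := 0) one_ne_zero
    (by rw [polyMul, map_zero]; ext n; simp [polySeries])]
  simp

theorem iotaZeroCoeff_add (f g : RatFunc F) (n : ℤ) :
    iotaZeroCoeff (f + g) n = iotaZeroCoeff f n + iotaZeroCoeff g n := by
  simp [iotaZeroCoeff]

open scoped RatFunc in
theorem iotaZeroCoeff_C_mul (c : F) (f : RatFunc F) (n : ℤ) :
    iotaZeroCoeff (algebraMap F[X] (RatFunc F) (C c) * f) n = c * iotaZeroCoeff f n := by
  have h : ((algebraMap F[X] (RatFunc F) (C c) : RatFunc F) : LaurentSeries F)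
      = HahnSeries.C c := by
    rw [← IsScalarTower.algebraMap_apply F[X] (RatFunc F) (LaurentSeries F)]
    simp
  rw [iotaZeroCoeff, map_mul, h, HahnSeries.C_mul_eq_smul]
  rfl

theorem ratTranslate_C_mul (z c : F) (f : RatFunc F) :
    ratTranslate z (algebraMap F[X] (RatFunc F) (C c) * f)
      = algebraMap F[X] (RatFunc F) (C c) * ratTranslate z f := by
  rw [map_mul, ← Polynomial.algebraMap_eq, ← IsScalarTower.algebraMap_apply, AlgHom.commutes]

theorem iotaZeroCoeff_zero (n : ℤ) : iotaZeroCoeff (0 : RatFunc F) n = 0 := by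
  simp [iotaZeroCoeff]

variable (V : Type*) {M : Type*} [AddCommGroup V] [Module ℂ V] [VertexOperatorAlgebra V]
  [AddCommGroup M] [Module ℂ M] [WeakModule V M]

/-- The series `⟨α, Y°(v, x)w⟩ ∈ ℂ[x, x⁻¹]]`. -/
def oppositeSeries (α : Module.Dual ℂ M) (v : V) (w : M) : ℤ → ℂ :=
  fun n => α (oppositeMode V M (-n - 1) v w)

/-- The coefficient of `x^(-n-1)` in `⟨Y^L_{P(z)}(v, x)α, w⟩ = ι_{x;0} ι_{x;∞}⁻¹ ⟨α, Y°(v, x+z)w⟩`. -/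
def leftRegular (z : ℂ) (α : Module.Dual ℂ M) (v : V) (n : ℤ) (w : M) : ℂ :=
  iotaZeroCoeff (ratTranslate z (iotaInftyInv (oppositeSeries V α v w))) (-n - 1)

/-- The coefficient of `x^(-n-1)` in `⟨Y^R_{P(z)}(v, x)α, w⟩ = ι_{x;0} ι_{x;∞}⁻¹ ⟨α, Y°(v, x)w⟩`. -/
def rightRegular (α : Module.Dual ℂ M) (v : V) (n : ℤ) (w : M) : ℂ :=
  iotaZeroCoeff (iotaInftyInv (oppositeSeries V α v w)) (-n - 1)

variable {V}

theorem oppositeSeries_add (α β : Module.Dual ℂ M) (v : V) (w : M) :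
    oppositeSeries V (α + β) v w = oppositeSeries V α v w + oppositeSeries V β v w := rfl

theorem oppositeSeries_smul (c : ℂ) (α : Module.Dual ℂ M) (v : V) (w : M) :
    oppositeSeries V (c • α) v w = c • oppositeSeries V α v w := rfl

theorem oppositeSeries_zero (v : V) (w : M) :
    oppositeSeries V (0 : Module.Dual ℂ M) v w = 0 := rfl

variable (V M)

/-- `D_{P(z)}(M)`: the functionals `α ∈ M^*` such that for each `v` there are `k, l ∈ ℕ` with
`x^l (x-z)^k ⟨α, Y°(v, x)w⟩ ∈ ℂ[x]` for all `w`. -/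
def regularDual (z : ℂ) : Submodule ℂ (Module.Dual ℂ M) where
  carrier := {α | ∀ v : V, ∃ k l : ℕ, ∀ w : M, ∃ g : ℂ[X],
    polyMul (X ^ l * (X - C z) ^ k) (oppositeSeries V α v w) = polySeries g}
  zero_mem' := fun v => ⟨0, 0, fun w => ⟨0, by
    rw [oppositeSeries_zero, polyMul, map_zero]; ext n; simp [polySeries]⟩⟩
  add_mem' {α β} hα hβ := fun v => by
    obtain ⟨k, l, h⟩ := hα v
    obtain ⟨k', l', h'⟩ := hβ v
    refine ⟨k + k', l + l', fun w => ?_⟩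
    obtain ⟨g, hg⟩ := h w
    obtain ⟨g', hg'⟩ := h' w
    refine ⟨(X ^ l' * (X - C z) ^ k') * g + (X ^ l * (X - C z) ^ k) * g', ?_⟩
    rw [oppositeSeries_add, polyMul_add, polySeries_add, polySeries_mul, polySeries_mul, ← hg,
      ← hg', ← polyMul_mul, ← polyMul_mul]
    congr 2 <;> ring
  smul_mem' c α hα := fun v => by
    obtain ⟨k, l, h⟩ := hα v
    refine ⟨k, l, fun w => ?_⟩
    obtain ⟨g, hg⟩ := h w
    exact ⟨c • g, by rw [oppositeSeries_smul, polyMul_smul, hg, polySeries_smul]⟩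

variable {V M}

theorem exists_of_mem_regularDual {z : ℂ} {α : Module.Dual ℂ M} (hα : α ∈ regularDual V M z)
    (v : V) (w : M) : ∃ P g : ℂ[X], P ≠ 0 ∧ polyMul P (oppositeSeries V α v w) = polySeries g := by
  obtain ⟨k, l, h⟩ := hα v
  obtain ⟨g, hg⟩ := h w
  exact ⟨_, g, mul_ne_zero (pow_ne_zero _ X_ne_zero) (pow_ne_zero _ (X_sub_C_ne_zero z)), hg⟩

variable (V) (A B M : Type*) [AddCommGroup A] [Module ℂ A] [HasModes V A]
  [AddCommGroup B] [Module ℂ B] [HasModes V B] [AddCommGroup M] [Module ℂ M] [WeakModule V M]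

/-- `Hom_{V ⊗ V}(A ⊗ B, D_{P(z)}(M))`: the linear maps `A ⊗ B → M^*` with values in `D_{P(z)}(M)`
which commute with the actions of `V ⊗ 𝟏` (through `Y` on `A` and `Y^L_{P(z)}` on `D_{P(z)}(M)`)
and of `𝟏 ⊗ V` (through `Y` on `B` and `Y^R_{P(z)}` on `D_{P(z)}(M)`); these two actions generate
the action of `V ⊗ V`. -/
def regularHom (z : ℂ) : Submodule ℂ (A ⊗[ℂ] B →ₗ[ℂ] Module.Dual ℂ M) where
  carrier := {ψ | (∀ t, ψ t ∈ regularDual V M z) ∧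
    (∀ (v : V) (n : ℤ) (a : A) (b : B) (w : M),
      ψ (mode A v n a ⊗ₜ b) w = leftRegular V z (ψ (a ⊗ₜ b)) v n w) ∧
    (∀ (v : V) (n : ℤ) (a : A) (b : B) (w : M),
      ψ (a ⊗ₜ mode B v n b) w = rightRegular V (ψ (a ⊗ₜ b)) v n w)}
  zero_mem' := by
    refine ⟨fun t => Submodule.zero_mem _, fun v n a b w => ?_, fun v n a b w => ?_⟩
    · simp [leftRegular, oppositeSeries_zero, iotaInftyInv_zero, iotaZeroCoeff_zero]
    · simp [rightRegular, oppositeSeries_zero, iotaInftyInv_zero, iotaZeroCoeff_zero]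
  add_mem' {φ ψ} hφ hψ := by
    refine ⟨fun t => Submodule.add_mem _ (hφ.1 t) (hψ.1 t), fun v n a b w => ?_,
      fun v n a b w => ?_⟩
    · simp only [LinearMap.add_apply, hφ.2.1, hψ.2.1, leftRegular, oppositeSeries_add]
      rw [iotaInftyInv_add (exists_of_mem_regularDual (hφ.1 _) v w)
        (exists_of_mem_regularDual (hψ.1 _) v w), map_add, iotaZeroCoeff_add]
    · simp only [LinearMap.add_apply, hφ.2.2, hψ.2.2, rightRegular, oppositeSeries_add]
      rw [iotaInftyInv_add (exists_of_mem_regularDual (hφ.1 _) v w)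
        (exists_of_mem_regularDual (hψ.1 _) v w), iotaZeroCoeff_add]
  smul_mem' c ψ hψ := by
    refine ⟨fun t => Submodule.smul_mem _ _ (hψ.1 t), fun v n a b w => ?_,
      fun v n a b w => ?_⟩
    · simp only [LinearMap.smul_apply, hψ.2.1, leftRegular, oppositeSeries_smul]
      rw [iotaInftyInv_smul c (exists_of_mem_regularDual (hψ.1 _) v w),
        ratTranslate_C_mul, iotaZeroCoeff_C_mul, smul_eq_mul]
    · simp only [LinearMap.smul_apply, hψ.2.2, rightRegular, oppositeSeries_smul]
      rw [iotaInftyInv_smul c (exists_of_mem_regularDual (hψ.1 _) v w), iotaZeroCoeff_C_mul,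
        smul_eq_mul]

end Regular

/-- `⟨𝒴(a, e^ζ)b, w⟩` for an intertwining operator `𝒴` of type `(M' over A B)`, that is,
`∑ n, e^((-n-1)ζ) ⟨a_n b, w⟩`. For generalized modules only finitely many terms are nonzero. -/
def intertwiningEval {V A B M : Type*} [AddCommGroup V] [Module ℂ V] [VertexOperatorAlgebra V]
    [AddCommGroup A] [Module ℂ A] [AddCommGroup B] [Module ℂ B]
    [AddCommGroup M] [Module ℂ M] [WeakModule V M]
    (I : A →ₗ[ℂ] (ℂ → (B →ₗ[ℂ] restrictedDual V M))) (ζ : ℂ) (a : A) (b : B) (w : M) : ℂ :=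
  ∑ᶠ n : ℂ, Complex.exp ((-n - 1) * ζ) * (I a n b : Module.Dual ℂ M) w

end

/-!
Both `Ω_T` and `𝓕` are shown to be bijective, so that their composite is. Throughout, the opposite
vertex operators `Y°(v, x)` are paired with the test functions `x^p (1+x)^r`, expanded at infinity
(`oppositeTest`); a functional `α` on `W` belongs to `𝒟_{P(-1)}(W)` precisely if for each `v` it
annihilates the resulting operators for all large `p` and `r` (`mem_regularDual_iff`).

*The two actions.* The opposite vertex operators satisfy the Jacobi identity with products in the
reversed order (`opposite_jacobi`). As `L(1)` is locally nilpotent on `W`, conjugation with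
`e^(-L(1))` turns `Y°(v, x)` into `Y°(v, x - 1)`, which therefore satisfies the same identity
(`oppositeTest_jacobi`). The actions `Y^R` and `Y^L` are obtained from these two by transposition
and by replacing the expansion at infinity with the one at the pole `0` or `-1`. On regular
functionals the two expansions agree after multiplication by a power of `x + 1` or of `x`, and these
powers can be cancelled (`eq_zero_of_shiftAdd_pow`); hence the Jacobi identity persists
(`modeDefect_eq_zero_of_localization`). For the same reason `Y^L` and `Y^R` commute
(`leftMode_rightMode_commute`).

*`Ω_T` is bijective.* A regular functional annihilates `O(W)` if and only if it is annihilated by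
the modes of negative degree of both actions (`eq_zero_of_mem_zhuO`, `mem_killSpace_of_lowest`); on
such functionals the modes of degree zero are the two actions of `A(V)` (`rightMode_eq_zhuLeft`,
`leftMode_eq_zhuRight`). A homomorphism into `A(W)^*` therefore extends to `F(U₁) ⊗ F(U₂)` by the
universal properties of the two factors (`exists_universal_lift`), and uniquely so, since `F(U)` is
generated by `U` (`universal_eq_top`). See `regularToZhu_bijective`.

*`𝓕` is bijective.* A linear map `ψ : F(U₁) ⊗ F(U₂) → W^*` is a homomorphism into `𝒟_{P(-1)}(W)` if
and only if the residue of `x^p (1+x)^r ⟨ψ(a ⊗ b), Y°(v, x)w⟩` at infinity is the sum of those at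
`-1` and `0`, where the action on `a` and the action on `b` give the expansions (`RegularJacobi`).
This is the Jacobi identity of an intertwining operator `𝒴(a, x₂)b` at `x₂ = e^(πi)`. Weights are
conserved (`intertwining_eq_zero`), and `F(Uᵢ)` is spanned by weight vectors, because `ω` acts on
the irreducible finite-dimensional module `Uᵢ` by a scalar (`iSup_weightSpace_universal`). Between
homogeneous vectors the series `𝒴` thus has one term, so that it is recovered from its value at
`e^(πi)` (`formalExpansion`). See `intertwiningToRegular_bijective`.
-/

open scoped TensorProduct
open Finset.HasAntidiagonal (antidiagonal mem_antidiagonal)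

noncomputable section

/-! ### Binomial coefficients -/

theorem choose_upper_negation (a : ℤ) (j : ℕ) :
    Ring.choose a j = (-1) ^ j * Ring.choose (j - a - 1) j := by
  have h := Ring.choose_neg (-a) j
  rw [neg_neg, Units.smul_def, Int.negOnePow_def] at h
  rw [h, show -a + (j : ℤ) - 1 = j - a - 1 by ring]
  simp

theorem sum_antidiagonal_alternating_choose (p a : ℤ) (t : ℕ) :
    ∑ x ∈ antidiagonal t,
      (-1) ^ x.1 * Ring.choose p x.1 * Ring.choose (a - x.1) x.2 = Ring.choose (a - p) t := by
  rw [choose_upper_negation (a - p) t, show (t : ℤ) - (a - p) - 1 = p + (t - a - 1) by ring,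
    Ring.add_choose_eq t (Commute.all _ _), Finset.mul_sum]
  refine Finset.sum_congr rfl fun x hx => ?_
  rw [mem_antidiagonal] at hx
  subst hx
  rw [choose_upper_negation (a - x.1) x.2,
    show (x.2 : ℤ) - (a - x.1) - 1 = ((x.1 + x.2 : ℕ) : ℤ) - a - 1 by push_cast; ring]
  ring

theorem sub_mul_choose (a : ℤ) (j : ℕ) :
    (a - j) * Ring.choose a j = (j + 1) * Ring.choose a (j + 1) := by
  have h := Ring.choose_smul_choose a (Nat.le_succ j)
  simp only [Nat.succ_eq_add_one, Nat.choose_succ_self_right, Nat.add_sub_cancel_left,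
    Ring.choose_one_right, nsmul_eq_mul] at h
  push_cast at h
  linarith

/-- Both sides are the coefficient of `x^(b+m-s-i)` in the `i`-th divided derivative of
`x^b (1+x)^m`. -/
theorem choose_mul_choose_eq_sum (b m : ℤ) (s i : ℕ) :
    Ring.choose m s * Ring.choose (b + (m - s)) i
      = ∑ x ∈ antidiagonal i,
          Ring.choose b x.1 * Ring.choose m x.2 * Ring.choose (m - x.2) s := by
  rw [Ring.add_choose_eq i (Commute.all _ _), Finset.mul_sum]
  refine Finset.sum_congr rfl fun x _ => ?_
  have h1 := Ring.choose_smul_choose m (Nat.le_add_right s x.2)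
  have h2 := Ring.choose_smul_choose m (Nat.le_add_left x.2 s)
  rw [Nat.add_sub_cancel_left] at h1
  rw [Nat.add_sub_cancel] at h2
  rw [← Nat.choose_symm_add] at h2
  rw [h1] at h2
  linear_combination Ring.choose b x.1 * h2

theorem choose_eq_zero_of_lt {m : ℤ} {i : ℕ} (hm : 0 ≤ m) (hi : m < i) : Ring.choose m i = 0 := by
  lift m to ℕ using hm
  rw [Ring.choose_natCast, Nat.choose_eq_zero_of_lt (by exact_mod_cast hi), Nat.cast_zero]

/-! ### Finite sums -/

theorem finsum_eq_sum_range {X : Type*} [AddCommMonoid X] (f : ℕ → X) (N : ℕ)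
    (h : ∀ i, N ≤ i → f i = 0) : ∑ᶠ i, f i = ∑ i ∈ Finset.range N, f i := by
  refine finsum_eq_sum_of_support_subset _ fun i hi => ?_
  by_contra hc
  exact hi (h i (by simpa using hc))

/-- A double sum over a box, grouped along antidiagonals, when all terms `x (i + j)` with
`i + j ≥ T` vanish. -/
theorem sum_range_sum_range_add {X : Type*} [AddCommGroup X] (c : ℕ → ℕ → ℤ) (x : ℕ → X) (T : ℕ)
    (hx : ∀ t, T ≤ t → x t = 0) :
    ∑ i ∈ Finset.range T, ∑ j ∈ Finset.range T, c i j • x (i + j)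
      = ∑ t ∈ Finset.range T, (∑ y ∈ antidiagonal t, c y.1 y.2) • x t := by
  rw [← Finset.sum_product']
  simp only [Finset.sum_smul]
  have h1 : ∀ y ∈ Finset.range T ×ˢ Finset.range T, y.1 + y.2 ∉ Finset.range T →
      c y.1 y.2 • x (y.1 + y.2) = 0 := fun y _ hy => by
    rw [hx _ (by simpa using hy), smul_zero]
  rw [← Finset.sum_filter_of_ne (p := fun y => y.1 + y.2 ∈ Finset.range T)
    fun y hy hne => by by_contra hc; exact hne (h1 y hy hc)]
  rw [← Finset.sum_fiberwise_of_maps_to (t := Finset.range T) (g := fun y : ℕ × ℕ => y.1 + y.2)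
    (fun y hy => (Finset.mem_filter.mp hy).2)]
  refine Finset.sum_congr rfl fun t ht => ?_
  refine Finset.sum_congr ?_ fun y hy => ?_
  · ext y
    simp only [Finset.mem_filter, Finset.mem_product, Finset.mem_range, mem_antidiagonal]
    have := Finset.mem_range.mp ht
    omega
  · rw [mem_antidiagonal.mp hy]

theorem sum_antidiagonal_fst_smul {X : Type*} [AddCommGroup X] (f : ℕ → ℕ → X) (N : ℕ) :
    ∑ x ∈ antidiagonal (N + 1), (x.1 : ℤ) • f x.1 x.2
      = ∑ x ∈ antidiagonal N, ((x.1 + 1 : ℕ) : ℤ) • f (x.1 + 1) x.2 := by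
  rw [Finset.Nat.sum_antidiagonal_succ]
  simp

theorem sum_antidiagonal_snd_smul {X : Type*} [AddCommGroup X] (f : ℕ → ℕ → X) (N : ℕ) :
    ∑ x ∈ antidiagonal (N + 1), (x.2 : ℤ) • f x.1 x.2
      = ∑ x ∈ antidiagonal N, ((x.2 + 1 : ℕ) : ℤ) • f x.1 (x.2 + 1) := by
  rw [Finset.Nat.sum_antidiagonal_succ']
  simp

/-! ### The commutator formula on weak modules -/

section Commutator

variable {V : Type*} [AddCommGroup V] [Module ℂ V] [VertexOperatorAlgebra V]
  {M : Type*} [AddCommGroup M] [Module ℂ M] [WeakModule V M]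

/-- The Jacobi identity of a weak module, in components. -/
theorem mode_jacobi (u v : V) (w : M) (p q r : ℤ) :
    ∑ᶠ i : ℕ, Ring.choose p i • mode M (mode V u (r + i) v) (p + q - i) w
      = ∑ᶠ i : ℕ, ((-1) ^ i * Ring.choose r i) • mode M u (p + r - i) (mode M v (q + i) w)
        - ∑ᶠ i : ℕ, ((r.negOnePow : ℤ) * ((-1) ^ i * Ring.choose r i)) •
            mode M v (q + r - i) (mode M u (p + i) w) := by
  have h := WeakModule.jacobi u v w p q r
  unfold jacobiDefect at h
  rw [sub_eq_zero] at h
  simp only [Int.cast_id] at h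
  convert h using 3
  · congr 2
    ring_nf
  · funext i
    rw [add_sub_assoc]

theorem finsum_alternating_choose_zero {X : Type*} [AddCommGroup X] (c : ℤ) (f : ℕ → X) :
    ∑ᶠ i : ℕ, (c * ((-1) ^ i * Ring.choose (0 : ℤ) i)) • f i = c • f 0 := by
  rw [finsum_eq_single _ 0 fun i hi => by
    simp [choose_zero_of_pos i (Nat.pos_of_ne_zero hi)]]
  simp

/-- The Jacobi identity for `r = 0`. -/
theorem mode_commutator (u v : V) (m n : ℤ) (w : M) :
    mode M u m (mode M v n w) - mode M v n (mode M u m w)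
      = ∑ᶠ i : ℕ, Ring.choose m i • mode M (mode V u i v) (m + n - i) w := by
  have h := mode_jacobi u v w m n 0
  have h1 := finsum_alternating_choose_zero 1
    fun i : ℕ => mode M u (m + 0 - i) (mode M v (n + i) w)
  have h2 := finsum_alternating_choose_zero ((0 : ℤ).negOnePow : ℤ)
    fun i : ℕ => mode M v (n + 0 - i) (mode M u (m + i) w)
  simp only [one_mul] at h1
  rw [h1, h2] at h
  simpa using h.symm

theorem conf_mode_zero (u : V) : mode V (VertexOperatorAlgebra.conf : V) 0 u = vir V V (-1) u := rfl

theorem conf_mode_one {k : ℂ} {w : M} (hw : w ∈ weightSpace V M k) :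
    mode M (VertexOperatorAlgebra.conf : V) 1 w = k • w := by
  simpa [weightSpace, vir, Module.End.mem_eigenspace_iff] using hw

/-- The commutator formula for `ω` and `m = 2`, in the form
`[L(1), u_n] = (L(1)u)_n + (2 wt u - n - 2) u_(n+1)`. -/
theorem vir_one_mode {k : ℤ} {u : V} (hu : u ∈ weightSpace V V (k : ℂ)) (n : ℤ) (w : M) :
    vir V M 1 (mode M u n w) = mode M u n (vir V M 1 w) + mode M (vir V V 1 u) n w
      + (2 * k - n - 2) • mode M u (n + 1) w := by
  have h := mode_commutator (VertexOperatorAlgebra.conf : V) u 2 n w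
  rw [finsum_eq_sum_range _ 3 fun i hi => by
    rw [choose_eq_zero_of_lt (by norm_num) (by omega), zero_smul]] at h
  have c1 : Ring.choose (2 : ℤ) 0 = 1 := Ring.choose_zero_right _
  have c2 : Ring.choose (2 : ℤ) 1 = 2 := Ring.choose_one_right _
  have c3 : Ring.choose (2 : ℤ) 2 = 1 := by
    have := Ring.choose_natCast (R := ℤ) 2 2
    simpa using this
  simp only [Finset.sum_range_succ, Finset.sum_range_zero, c1, c2, c3, Nat.cast_zero, Nat.cast_one,
    Nat.cast_ofNat, zero_add, sub_zero, one_smul] at h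
  rw [WeakModule.derivative, conf_mode_one hu, mode_smul] at h
  change mode M (VertexOperatorAlgebra.conf : V) (1 + 1) (mode M u n w)
    = mode M u n (mode M (VertexOperatorAlgebra.conf : V) (1 + 1) w)
      + mode M (mode V (VertexOperatorAlgebra.conf : V) (1 + 1) u) n w + _
  rw [show (1 : ℤ) + 1 = 2 by norm_num, sub_eq_iff_eq_add.mp h]
  rw [show 2 + n - 1 = n + 1 by ring, show 2 + n - 2 = n by ring]
  simp only [LinearMap.smul_apply, ← Int.cast_smul_eq_zsmul ℂ]
  push_cast
  module

end Commutator

/-! ### Conjugation of vertex operators by `e^(L(1))` -/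

section DividedPowers

variable {V : Type*} [AddCommGroup V] [Module ℂ V] [VertexOperatorAlgebra V]

variable (V) in
/-- The divided power `L(1)^i / i!`. -/
def virOneDiv (i : ℕ) : Module.End ℂ V := ((i.factorial : ℂ)⁻¹) • vir V V 1 ^ i

theorem virOneDiv_zero : virOneDiv V 0 = 1 := by simp [virOneDiv]

theorem vir_one_virOneDiv (i : ℕ) (v : V) :
    vir V V 1 (virOneDiv V i v) = ((i + 1 : ℕ) : ℤ) • virOneDiv V (i + 1) v := by
  simp only [virOneDiv, LinearMap.smul_apply, map_smul, ← Int.cast_smul_eq_zsmul ℂ, smul_smul,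
    pow_succ' _ i, Module.End.mul_apply, Nat.factorial_succ]
  congr 1
  have : ((i : ℂ) + 1) ≠ 0 := by exact_mod_cast Nat.succ_ne_zero i
  push_cast
  field_simp

theorem virOneDiv_mem {k : ℤ} {v : V} (hv : v ∈ weightSpace V V (k : ℂ)) (i : ℕ) :
    virOneDiv V i v ∈ weightSpace V V ((k - i : ℤ) : ℂ) := by
  have := Submodule.smul_mem _ ((i.factorial : ℂ)⁻¹) (vir_one_pow_mem hv i)
  push_cast
  exact this

theorem exists_virOneDiv_eq_zero (v : V) : ∃ N : ℕ, ∀ i : ℕ, N ≤ i → virOneDiv V i v = 0 := by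
  obtain ⟨N, hN⟩ := exists_vir_one_pow_eq_zero v
  exact ⟨N, fun i hi => by rw [virOneDiv, LinearMap.smul_apply, hN i hi, smul_zero]⟩

/-- The component of degree `m` of `e^(L(1)) Y(u, x) e^(-L(1))` in the coefficient of `x^(-n-1)`,
for `u` of weight `k`. -/
def conjMode (k : ℤ) (u : V) (n : ℤ) (m : ℕ) : Module.End ℂ V :=
  ∑ x ∈ antidiagonal m,
    Ring.choose (2 * k - x.1 - n - 2) x.2 • mode V (virOneDiv V x.1 u) (n + x.2)

/-- The defining recursion of an exponential: bracketing with `L(1)` raises the degree by one. -/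
theorem vir_one_conjMode {k : ℤ} {u : V} (hu : u ∈ weightSpace V V (k : ℂ)) (n : ℤ) (m : ℕ)
    (v : V) : vir V V 1 (conjMode k u n m v)
      = conjMode k u n m (vir V V 1 v) + ((m + 1 : ℕ) : ℤ) • conjMode k u n (m + 1) v := by
  have h1 : ((m + 1 : ℕ) : ℤ) • conjMode k u n (m + 1) v
      = ∑ x ∈ antidiagonal (m + 1), (x.1 : ℤ) •
          (Ring.choose (2 * k - x.1 - n - 2) x.2 • mode V (virOneDiv V x.1 u) (n + x.2) v)
        + ∑ x ∈ antidiagonal (m + 1), (x.2 : ℤ) •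
          (Ring.choose (2 * k - x.1 - n - 2) x.2 • mode V (virOneDiv V x.1 u) (n + x.2) v) := by
    rw [conjMode, LinearMap.sum_apply, Finset.smul_sum, ← Finset.sum_add_distrib]
    refine Finset.sum_congr rfl fun x hx => ?_
    rw [← add_smul, ← mem_antidiagonal.mp hx]
    push_cast
    rfl
  -- the coefficient of `(L(1)^i u)_(n+j)` is compared through Pascal's rule and
  -- `(a - j) * choose a j = (j + 1) * choose a (j + 1)`
  rw [h1, sum_antidiagonal_fst_smul (fun i j => Ring.choose (2 * k - i - n - 2) j •
      mode V (virOneDiv V i u) (n + j) v) m]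
  have h2 : ∀ i j : ℕ, (((j + 1 : ℕ) : ℤ)) • (Ring.choose (2 * k - i - n - 2) (j + 1) •
      mode V (virOneDiv V i u) (n + (j + 1 : ℕ)) v)
      = (2 * (k - i) - (n + j) - 2) • (Ring.choose (2 * k - i - n - 2) j •
        mode V (virOneDiv V i u) (n + (j + 1 : ℕ)) v)
        + (i : ℤ) • (Ring.choose (2 * k - i - n - 2) j •
        mode V (virOneDiv V i u) (n + (j + 1 : ℕ)) v) := by
    intro i j
    rw [smul_smul, smul_smul, smul_smul, ← add_smul]
    congr 1
    have := sub_mul_choose (2 * k - i - n - 2) j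
    push_cast
    linear_combination -this
  rw [sum_antidiagonal_snd_smul (fun i j => Ring.choose (2 * k - i - n - 2) j •
      mode V (virOneDiv V i u) (n + j) v) m]
  have h3 : ∀ i j : ℕ, vir V V 1 (Ring.choose (2 * k - i - n - 2) j •
      mode V (virOneDiv V i u) (n + j) v)
      = Ring.choose (2 * k - i - n - 2) j • mode V (virOneDiv V i u) (n + j) (vir V V 1 v)
        + (((i + 1 : ℕ) : ℤ) • (Ring.choose (2 * k - (i + 1 : ℕ) - n - 2) j •
          mode V (virOneDiv V (i + 1) u) (n + j) v)
        + (((i + 1 : ℕ) : ℤ) * (Ring.choose (2 * k - i - n - 2) j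
            - Ring.choose (2 * k - i - n - 3) j)) • mode V (virOneDiv V (i + 1) u) (n + j) v)
        + (2 * (k - i) - (n + j) - 2) • (Ring.choose (2 * k - i - n - 2) j •
          mode V (virOneDiv V i u) (n + (j + 1 : ℕ)) v) := by
    intro i j
    rw [map_zsmul, vir_one_mode (virOneDiv_mem hu i), vir_one_virOneDiv]
    have h4 : mode V (((i + 1 : ℕ) : ℤ) • virOneDiv V (i + 1) u) (n + j) v
        = ((i + 1 : ℕ) : ℤ) • mode V (virOneDiv V (i + 1) u) (n + j) v := by
      simp only [← Int.cast_smul_eq_zsmul ℂ, mode_smul, LinearMap.smul_apply]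
    rw [h4, show (2 * k - (i + 1 : ℕ) - n - 2 : ℤ) = 2 * k - i - n - 3 by push_cast; ring,
      show n + ((j + 1 : ℕ) : ℤ) = n + j + 1 by push_cast; ring]
    module
  rw [conjMode, LinearMap.sum_apply, LinearMap.sum_apply, map_sum]
  simp only [LinearMap.smul_apply, h2, h3, Finset.sum_add_distrib]
  rw [add_assoc, add_assoc]
  congr 2
  rw [add_comm]
  congr 1
  cases m with
  | zero => simp
  | succ m =>
    refine (Finset.Nat.sum_antidiagonal_succ' ..).trans
      (Eq.trans ?_ (Finset.Nat.sum_antidiagonal_succ ..).symm)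
    simp only [Nat.cast_zero, zero_smul, zero_add, add_zero, Ring.choose_zero_right, sub_self,
      mul_zero]
    refine Finset.sum_congr rfl fun x _ => ?_
    rw [smul_smul, show 2 * k - (x.1 : ℤ) - n - 2 = (2 * k - x.1 - n - 3) + 1 by ring,
      Ring.choose_succ_succ, show 2 * k - ((x.1 + 1 : ℕ) : ℤ) - n - 2 = 2 * k - x.1 - n - 3 by
        push_cast; ring, add_sub_cancel_right]

/-- The homogeneous components of
`e^(L(1)) Y(u, x) e^(-L(1)) = Y(e^((1-x)L(1)) (1-x)^(-2L(0)) u, x/(1-x))`. -/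
theorem virOneDiv_mode {k : ℤ} {u : V} (hu : u ∈ weightSpace V V (k : ℂ)) (n : ℤ) (v : V)
    (N : ℕ) : virOneDiv V N (mode V u n v)
      = ∑ x ∈ antidiagonal N, conjMode k u n x.1 (virOneDiv V x.2 v) := by
  induction N with
  | zero => simp [virOneDiv_zero, conjMode]
  | succ N ih =>
    have hN : (((N + 1 : ℕ) : ℤ) : ℂ) ≠ 0 := by exact_mod_cast Nat.succ_ne_zero N
    refine (smul_right_injective V hN) ?_
    simp only [Int.cast_smul_eq_zsmul]
    rw [← vir_one_virOneDiv, ih, map_sum]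
    simp only [vir_one_conjMode hu, vir_one_virOneDiv, map_zsmul, Finset.sum_add_distrib]
    rw [← sum_antidiagonal_fst_smul (fun i j => conjMode k u n i (virOneDiv V j v)) N,
      ← sum_antidiagonal_snd_smul (fun i j => conjMode k u n i (virOneDiv V j v)) N,
      ← Finset.sum_add_distrib, Finset.smul_sum]
    refine Finset.sum_congr rfl fun x hx => ?_
    rw [← add_smul, ← mem_antidiagonal.mp hx, add_comm]
    push_cast
    rfl

end DividedPowers

/-! ### The opposite Jacobi identity -/

theorem sum_range_sum_antidiagonal {X : Type*} [AddCommMonoid X] (f : ℕ → ℕ → X) {I J N : ℕ}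
    (hI : ∀ i j, I ≤ i → f i j = 0) (hJ : ∀ i j, J ≤ j → f i j = 0) (hN : I + J ≤ N) :
    ∑ m ∈ Finset.range N, ∑ x ∈ antidiagonal m, f x.1 x.2
      = ∑ i ∈ Finset.range I, ∑ j ∈ Finset.range J, f i j := by
  rw [← Finset.sum_product', ← Finset.sum_fiberwise_of_maps_to (t := Finset.range N)
    (g := fun y : ℕ × ℕ => y.1 + y.2) (fun y hy => by
      simp only [Finset.mem_product, Finset.mem_range] at hy ⊢
      omega)]
  refine Finset.sum_congr rfl fun m _ =>
    (Finset.sum_subset (fun y hy => ?_) fun y hy hne => ?_).symm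
  · rw [mem_antidiagonal]
    exact (Finset.mem_filter.mp hy).2
  · by_cases h1 : I ≤ y.1
    · exact hI _ _ h1
    · by_cases h2 : J ≤ y.2
      · exact hJ _ _ h2
      · exact absurd (Finset.mem_filter.mpr ⟨Finset.mem_product.mpr
          ⟨Finset.mem_range.mpr (not_le.mp h1), Finset.mem_range.mpr (not_le.mp h2)⟩,
          (mem_antidiagonal (a := y)).mp hy⟩) hne

theorem zsmul_finsum {X ι : Type*} [AddCommGroup X] [Module ℂ X] (c : ℤ) (f : ι → X) :
    c • ∑ᶠ i, f i = ∑ᶠ i, c • f i := by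
  simp only [← Int.cast_smul_eq_zsmul ℂ, smul_finsum]

theorem finite_support_finset_sum {X ι β : Type*} [AddCommMonoid X] (s : Finset β)
    (f : ι → β → X) (h : ∀ b ∈ s, (Function.support fun i => f i b).Finite) :
    (Function.support fun i => ∑ b ∈ s, f i b).Finite := by
  refine Set.Finite.subset (Set.Finite.biUnion s.finite_toSet h) fun i hi => ?_
  obtain ⟨b, hb, hne⟩ := Finset.exists_ne_zero_of_sum_ne_zero hi
  exact Set.mem_biUnion hb hne

section Opposite

variable {V : Type*} [AddCommGroup V] [Module ℂ V] [VertexOperatorAlgebra V]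
  {M : Type*} [AddCommGroup M] [Module ℂ M] [WeakModule V M]

theorem homogeneous_induction {P : V → Prop} (h0 : P 0) (ha : ∀ u v, P u → P v → P (u + v))
    (hh : ∀ (k : ℤ) (v : V), v ∈ weightSpace V V (k : ℂ) → P v) (v : V) : P v := by
  have hv : v ∈ ⨆ n : ℤ, weightSpace V V (n : ℂ) := by rw [iSup_weightSpace]; trivial
  induction hv using Submodule.iSup_induction' with
  | mem k v hv => exact hh k v hv
  | zero => exact h0
  | add x y _ _ hx hy => exact ha x y hx hy

theorem opposite_eq_sum {k : ℤ} {v : V} (hv : v ∈ weightSpace V V (k : ℂ)) {N : ℕ}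
    (hN : ∀ i, N ≤ i → virOneDiv V i v = 0) (n : ℤ) (w : M) :
    oppositeMode V M n v w
      = (k.negOnePow : ℤ) • ∑ i ∈ Finset.range N,
          mode M (virOneDiv V i v) (2 * k - n - i - 2) w := by
  rw [oppositeMode, extendHomogeneous_apply _ k v hv]
  simp only [LinearMap.smul_apply, LinearMap.comp_apply, Submodule.subtype_apply]
  rw [Int.cast_smul_eq_zsmul]
  congr 1
  change (∑ᶠ i : ℕ, ((i.factorial : ℂ)⁻¹) •
    mode M ((vir V V 1 ^ i) v) (2 * k - n - i - 2)) w = _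
  simp only [← mode_smul, ← LinearMap.smul_apply]
  change (∑ᶠ i : ℕ, mode M (virOneDiv V i v) (2 * k - n - i - 2)) w = _
  rw [finsum_eq_sum_range _ N fun i hi => by rw [hN i hi, mode_zero], LinearMap.sum_apply]

theorem opposite_truncation (v : V) (w : M) :
    ∃ N : ℤ, ∀ n : ℤ, n ≤ N → oppositeMode V M n v w = 0 := by
  induction v using homogeneous_induction with
  | h0 => exact ⟨0, by simp⟩
  | ha u v hu hv =>
    obtain ⟨N, hN⟩ := hu
    obtain ⟨N', hN'⟩ := hv
    exact ⟨min N N', fun n hn => by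
      rw [map_add, LinearMap.add_apply, hN n (le_trans hn (min_le_left _ _)),
        hN' n (le_trans hn (min_le_right _ _)), add_zero]⟩
  | hh k v hv =>
    obtain ⟨I, hI⟩ := exists_virOneDiv_eq_zero v
    choose N hN using fun i => WeakModule.truncation (virOneDiv V i v) w
    refine ⟨2 * k - I - 2 - ∑ i ∈ Finset.range I, |N i|, fun n hn => ?_⟩
    rw [opposite_eq_sum hv hI, Finset.sum_eq_zero, smul_zero]
    intro i hi
    refine hN i _ ?_
    have h1 : |N i| ≤ ∑ i ∈ Finset.range I, |N i| :=
      Finset.single_le_sum (f := fun i => |N i|) (fun i _ => abs_nonneg (N i)) hi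
    have h2 := le_abs_self (N i)
    have h3 := Finset.mem_range.mp hi
    omega

theorem exists_nat_opposite_truncation (v : V) (w : M) (k : ℤ) :
    ∃ N : ℕ, ∀ i : ℕ, N ≤ i → oppositeMode V M (k - i) v w = 0 := by
  obtain ⟨N, hN⟩ := opposite_truncation v w
  exact ⟨(k - N).toNat, fun i hi => hN _ (by omega)⟩

theorem exists_bound_range (P : ℕ → ℕ → Prop) (hP : ∀ i, ∃ N, ∀ t, N ≤ t → P i t) (I : ℕ) :
    ∃ N, ∀ i < I, ∀ t, N ≤ t → P i t := by
  choose N hN using hP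
  exact ⟨∑ i ∈ Finset.range I, N i, fun i hi t ht => hN i t (le_trans
    (Finset.single_le_sum (fun _ _ => Nat.zero_le _) (Finset.mem_range.mpr hi)) ht)⟩

/-- The difference of the two sides of a component of the Jacobi identity for the opposite
vertex operators `Y°`, with products in the reversed order. -/
def oppositeDefect {X : Type*} [AddCommGroup X] [Module ℂ X] (o : ℤ → V →ₗ[ℂ] Module.End ℂ X)
    (u v : V) (w : X) (p q r : ℤ) : X :=
  ∑ᶠ i : ℕ, Ring.choose p i • o (p + q - i) (mode V u (r + i) v) w
    - (∑ᶠ i : ℕ, ((-1) ^ i * Ring.choose r i) • o (q + i) v (o (p + r - i) u w)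
      - ∑ᶠ i : ℕ, ((r.negOnePow : ℤ) * ((-1) ^ i * Ring.choose r i)) •
          o (p + i) u (o (q + r - i) v w))

/-- For homogeneous `u` and `v` the opposite Jacobi identity is, up to a sign, the sum over `a` and
`b` of the Jacobi identities of `M` for `L(1)^a u / a!` and `L(1)^b v / b!`: the products expand in
this way by definition, the iterates by the conjugation formula `virOneDiv_mode`. -/
theorem opposite_jacobi_homogeneous {k l : ℤ} {u v : V} (hu : u ∈ weightSpace V V (k : ℂ))
    (hv : v ∈ weightSpace V V (l : ℂ)) (w : M) (p q r : ℤ) :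
    oppositeDefect (oppositeMode V M) u v w p q r = 0 := by
  obtain ⟨I, hI⟩ := exists_virOneDiv_eq_zero u
  obtain ⟨J, hJ⟩ := exists_virOneDiv_eq_zero v
  obtain ⟨T₁, hT₁⟩ := exists_bound_range
    (fun a t => ∀ b < J, mode V (virOneDiv V a u) (r + t) (virOneDiv V b v) = 0)
    (fun a => by
      obtain ⟨N, hN⟩ := exists_bound_range
        (fun b t => mode V (virOneDiv V a u) (r + t) (virOneDiv V b v) = 0)
        (fun b => exists_nat_truncation _ _ _) J
      exact ⟨N, fun t ht b hb => hN b hb t ht⟩) I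
  obtain ⟨T₂, hT₂⟩ := exists_nat_truncation u v r
  set T := max T₁ T₂ with hTdef
  have hT : ∀ a b t : ℕ, T ≤ t →
      mode V (virOneDiv V a u) (r + t) (virOneDiv V b v) = 0 := by
    intro a b t ht
    by_cases ha : a < I
    · by_cases hb : b < J
      · exact hT₁ a ha t (le_trans (le_max_left _ _) ht) b hb
      · rw [hJ b (not_lt.mp hb), map_zero]
    · rw [hI a (not_lt.mp ha), mode_zero, LinearMap.zero_apply]
  -- the left-hand side, through the conjugation formula for `e^(L(1))`
  have hL : ∑ᶠ i : ℕ, Ring.choose p i • oppositeMode V M (p + q - i) (mode V u (r + i) v) w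
      = -(((k + l + r).negOnePow : ℤ) • ∑ a ∈ Finset.range I, ∑ b ∈ Finset.range J,
          ∑ t ∈ Finset.range T, Ring.choose (2 * k - a - 2 - p - r) t •
            mode M (mode V (virOneDiv V a u) (r + t) (virOneDiv V b v))
              ((2 * k - a - 2 - p - r) + (2 * l - b - 2 - q - r) - t) w) := by
    rw [finsum_eq_sum_range _ T fun i hi => by
      rw [hT₂ i (le_trans (le_max_right _ _) hi), map_zero, LinearMap.zero_apply, smul_zero]]
    have hs : ∀ s ∈ Finset.range T, Ring.choose p s •
        oppositeMode V M (p + q - s) (mode V u (r + s) v) w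
        = -(((k + l + r).negOnePow : ℤ) • ∑ a ∈ Finset.range I, ∑ b ∈ Finset.range J,
          ∑ j ∈ Finset.range T,
            ((-1) ^ s * Ring.choose p s * Ring.choose ((2 * k - a - r - 2) - s) j) •
            mode M (mode V (virOneDiv V a u) (r + (s + j : ℕ)) (virOneDiv V b v))
              ((2 * k - a - 2 - p - r) + (2 * l - b - 2 - q - r) - (s + j : ℕ)) w) := by
      intro s _
      have hw : mode V u (r + s) v ∈ weightSpace V V ((k + l - r - s - 1 : ℤ) : ℂ) := by
        have := mode_mem_weightSpace hu hv (r + s)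
        convert this using 2
        push_cast
        ring
      have hexp : ∀ m : ℕ, virOneDiv V m (mode V u (r + s) v)
          = ∑ x ∈ antidiagonal m, ∑ y ∈ antidiagonal x.1,
              Ring.choose (2 * k - y.1 - (r + s) - 2) y.2 •
                mode V (virOneDiv V y.1 u) (r + s + y.2) (virOneDiv V x.2 v) := by
        intro m
        rw [virOneDiv_mode hu]
        refine Finset.sum_congr rfl fun x _ => ?_
        rw [conjMode, LinearMap.sum_apply]
        rfl
      have hzero : ∀ a b j : ℕ, I ≤ a ∨ J ≤ b ∨ T ≤ j →
          mode V (virOneDiv V a u) (r + s + j) (virOneDiv V b v) = 0 := by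
        rintro a b j (h | h | h)
        · rw [hI a h, mode_zero, LinearMap.zero_apply]
        · rw [hJ b h, map_zero]
        · have := hT a b (s + j) (by omega)
          rw [← this]
          congr 2
          push_cast
          ring
      have hvan : ∀ c b : ℕ, I + T ≤ c → ∀ y ∈ antidiagonal c,
          mode V (virOneDiv V y.1 u) (r + s + y.2) (virOneDiv V b v) = 0 := by
        intro c b hc y hy
        rw [mem_antidiagonal] at hy
        refine hzero _ _ _ ?_
        by_cases h : I ≤ y.1
        · exact Or.inl h
        · exact Or.inr (Or.inr (by omega))
      rw [opposite_eq_sum hw (N := I + T + J) fun m hm => by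
        rw [hexp]
        refine Finset.sum_eq_zero fun x hx => Finset.sum_eq_zero fun y hy => ?_
        rw [mem_antidiagonal] at hx
        by_cases h : I + T ≤ x.1
        · rw [hvan x.1 x.2 h y hy, smul_zero]
        · rw [hzero _ _ _ (Or.inr (Or.inl (by omega))), smul_zero]]
      have hsum : ∑ m ∈ Finset.range (I + T + J), mode M (virOneDiv V m (mode V u (r + s) v))
            (2 * (k + l - r - s - 1) - (p + q - s) - m - 2) w
          = ∑ m ∈ Finset.range (I + T + J), ∑ x ∈ antidiagonal m, ∑ y ∈ antidiagonal x.1,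
              Ring.choose (2 * k - y.1 - (r + s) - 2) y.2 •
                mode M (mode V (virOneDiv V y.1 u) (r + s + y.2) (virOneDiv V x.2 v))
                (2 * (k + l - r - s - 1) - (p + q - s) - (x.1 + x.2 : ℕ) - 2) w := by
        refine Finset.sum_congr rfl fun m _ => ?_
        rw [hexp]
        simp only [mode, map_sum, Finset.sum_apply, LinearMap.sum_apply, map_zsmul, Pi.smul_apply,
          LinearMap.smul_apply]
        exact Finset.sum_congr rfl fun x hx => by rw [mem_antidiagonal.mp hx]
      rw [hsum, sum_range_sum_antidiagonal (fun c b => ∑ y ∈ antidiagonal c,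
          Ring.choose (2 * k - y.1 - (r + s) - 2) y.2 •
            mode M (mode V (virOneDiv V y.1 u) (r + s + y.2) (virOneDiv V b v))
              (2 * (k + l - r - s - 1) - (p + q - s) - (c + b : ℕ) - 2) w) (I := I + T) (J := J)
        (fun c b hc => Finset.sum_eq_zero fun y hy => by
          rw [hvan c b hc y hy, mode_zero, LinearMap.zero_apply, smul_zero])
        (fun c b hb => Finset.sum_eq_zero fun y hy => by
          rw [hzero _ _ _ (Or.inr (Or.inl hb)), mode_zero, LinearMap.zero_apply, smul_zero])
        le_rfl, Finset.sum_comm]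
      have hb : ∀ b ∈ Finset.range J, ∑ c ∈ Finset.range (I + T), ∑ y ∈ antidiagonal c,
          Ring.choose (2 * k - y.1 - (r + s) - 2) y.2 •
            mode M (mode V (virOneDiv V y.1 u) (r + s + y.2) (virOneDiv V b v))
              (2 * (k + l - r - s - 1) - (p + q - s) - (c + b : ℕ) - 2) w
          = ∑ a ∈ Finset.range I, ∑ j ∈ Finset.range T,
            Ring.choose (2 * k - a - (r + s) - 2) j •
            mode M (mode V (virOneDiv V a u) (r + s + j) (virOneDiv V b v))
              (2 * (k + l - r - s - 1) - (p + q - s) - (a + j + b : ℕ) - 2) w := by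
        intro b _
        rw [← sum_range_sum_antidiagonal (fun a j =>
            Ring.choose (2 * k - a - (r + s) - 2) j •
            mode M (mode V (virOneDiv V a u) (r + s + j) (virOneDiv V b v))
              (2 * (k + l - r - s - 1) - (p + q - s) - (a + j + b : ℕ) - 2) w) (I := I) (J := T)
          (fun a j ha => by
            rw [hzero _ _ _ (Or.inl ha), mode_zero, LinearMap.zero_apply, smul_zero])
          (fun a j hj => by
            rw [hzero _ _ _ (Or.inr (Or.inr hj)), mode_zero, LinearMap.zero_apply, smul_zero])
          le_rfl]
        exact Finset.sum_congr rfl fun c _ => Finset.sum_congr rfl fun y hy => by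
          rw [mem_antidiagonal.mp hy]
      rw [Finset.sum_congr rfl hb, Finset.sum_comm, ← smul_neg, ← Finset.sum_neg_distrib,
        smul_smul, Finset.smul_sum, Finset.smul_sum]
      refine Finset.sum_congr rfl fun a _ => ?_
      rw [← Finset.sum_neg_distrib, Finset.smul_sum, Finset.smul_sum]
      refine Finset.sum_congr rfl fun b _ => ?_
      rw [← Finset.sum_neg_distrib, Finset.smul_sum, Finset.smul_sum]
      refine Finset.sum_congr rfl fun j _ => ?_
      rw [smul_smul, ← neg_smul, smul_smul,
        show (2 * (k + l - r - s - 1) - (p + q - s) - (a + j + b : ℕ) - 2 : ℤ)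
          = (2 * k - a - 2 - p - r) + (2 * l - b - 2 - q - r) - (s + j : ℕ) by push_cast; ring,
        show r + (s : ℤ) + j = r + (s + j : ℕ) by push_cast; ring,
        show 2 * k - (a : ℤ) - (r + s) - 2 = 2 * k - a - r - 2 - s by ring]
      congr 1
      rw [show k + l - r - (s : ℤ) - 1 = k + l + r + (-2 * r - s - 1) by ring,
        Int.negOnePow_add, Int.negOnePow_sub, Int.negOnePow_sub,
        Int.negOnePow_even (-2 * r) ⟨-r, by ring⟩,
        Int.negOnePow_one, Int.negOnePow_def (s : ℤ)]
      push_cast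
      simp
      ring
    rw [Finset.sum_congr rfl hs, Finset.sum_neg_distrib, ← Finset.smul_sum, Finset.sum_comm]
    congr 2
    refine Finset.sum_congr rfl fun a _ => ?_
    rw [Finset.sum_comm]
    refine Finset.sum_congr rfl fun b _ => ?_
    rw [sum_range_sum_range_add (fun s j =>
        (-1) ^ s * Ring.choose p s * Ring.choose ((2 * k - a - r - 2) - s) j)
      (fun t => mode M (mode V (virOneDiv V a u) (r + t) (virOneDiv V b v))
        ((2 * k - a - 2 - p - r) + (2 * l - b - 2 - q - r) - t) w) T fun t ht => by
        rw [hT a b t ht, mode_zero, LinearMap.zero_apply]]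
    refine Finset.sum_congr rfl fun t _ => ?_
    rw [sum_antidiagonal_alternating_choose]
    congr 2
    ring
  -- the right-hand side, through the Jacobi identity for each pair `L(1)^a u`, `L(1)^b v`
  have hvu : ∀ m n : ℤ, oppositeMode V M m v (oppositeMode V M n u w)
      = ((k + l).negOnePow : ℤ) • ∑ a ∈ Finset.range I, ∑ b ∈ Finset.range J,
        mode M (virOneDiv V b v) (2 * l - m - b - 2)
          (mode M (virOneDiv V a u) (2 * k - n - a - 2) w) := by
    intro m n
    rw [opposite_eq_sum hu hI, opposite_eq_sum hv hJ, Finset.sum_comm, Int.negOnePow_add]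
    simp only [map_zsmul, map_sum, ← Finset.smul_sum, smul_smul]
    rw [mul_comm]
    rfl
  have huv : ∀ m n : ℤ, oppositeMode V M n u (oppositeMode V M m v w)
      = ((k + l).negOnePow : ℤ) • ∑ a ∈ Finset.range I, ∑ b ∈ Finset.range J,
        mode M (virOneDiv V a u) (2 * k - n - a - 2)
          (mode M (virOneDiv V b v) (2 * l - m - b - 2) w) := by
    intro m n
    rw [opposite_eq_sum hv hJ, opposite_eq_sum hu hI, Int.negOnePow_add]
    simp only [map_zsmul, map_sum, ← Finset.smul_sum, smul_smul]
    rfl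
  have hr : (r.negOnePow : ℤ) * (r.negOnePow : ℤ) = 1 := by
    rw [← Units.val_mul, Int.units_mul_self, Units.val_one]
  have hfin₁ : ∀ a b : ℕ, (Function.support fun i : ℕ =>
      ((r.negOnePow : ℤ) * ((-1) ^ i * Ring.choose r i)) •
        mode M (virOneDiv V b v) ((2 * l - b - 2 - q - r) + r - i)
          (mode M (virOneDiv V a u) ((2 * k - a - 2 - p - r) + i) w)).Finite := by
    intro a b
    obtain ⟨N, hN⟩ := exists_nat_truncation (virOneDiv V a u) w (2 * k - a - 2 - p - r)
    exact finite_support_of_eventually_zero _ N fun i hi => by rw [hN i hi, map_zero, smul_zero]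
  have hfin₂ : ∀ a b : ℕ, (Function.support fun i : ℕ =>
      ((-1) ^ i * Ring.choose r i) •
        mode M (virOneDiv V a u) ((2 * k - a - 2 - p - r) + r - i)
          (mode M (virOneDiv V b v) ((2 * l - b - 2 - q - r) + i) w)).Finite := by
    intro a b
    obtain ⟨N, hN⟩ := exists_nat_truncation (virOneDiv V b v) w (2 * l - b - 2 - q - r)
    exact finite_support_of_eventually_zero _ N fun i hi => by rw [hN i hi, map_zero, smul_zero]
  have hR₁ : ∑ᶠ i : ℕ, ((-1) ^ i * Ring.choose r i) •
        oppositeMode V M (q + i) v (oppositeMode V M (p + r - i) u w)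
      = ((k + l + r).negOnePow : ℤ) • ∑ a ∈ Finset.range I, ∑ b ∈ Finset.range J,
        ∑ᶠ i : ℕ, ((r.negOnePow : ℤ) * ((-1) ^ i * Ring.choose r i)) •
          mode M (virOneDiv V b v) ((2 * l - b - 2 - q - r) + r - i)
            (mode M (virOneDiv V a u) ((2 * k - a - 2 - p - r) + i) w) := by
    simp only [← finsum_sum_comm _ _ fun b _ => hfin₁ _ b]
    rw [← finsum_sum_comm _ _ fun a _ => finite_support_finset_sum _ _ fun b _ => hfin₁ a b,
      zsmul_finsum]
    refine finsum_congr fun i => ?_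
    rw [hvu, smul_comm]
    simp only [Finset.smul_sum, smul_smul]
    refine Finset.sum_congr rfl fun a _ => Finset.sum_congr rfl fun b _ => ?_
    rw [Int.negOnePow_add _ r, Units.val_mul]
    congr 1
    · linear_combination (-(((k + l).negOnePow : ℤ) * ((-1) ^ i * Ring.choose r i))) * hr
    · congr 2 <;> [skip; congr 1] <;> ring_nf
  have hR₂ : ∑ᶠ i : ℕ, ((r.negOnePow : ℤ) * ((-1) ^ i * Ring.choose r i)) •
        oppositeMode V M (p + i) u (oppositeMode V M (q + r - i) v w)
      = ((k + l + r).negOnePow : ℤ) • ∑ a ∈ Finset.range I, ∑ b ∈ Finset.range J,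
        ∑ᶠ i : ℕ, ((-1) ^ i * Ring.choose r i) •
          mode M (virOneDiv V a u) ((2 * k - a - 2 - p - r) + r - i)
            (mode M (virOneDiv V b v) ((2 * l - b - 2 - q - r) + i) w) := by
    simp only [← finsum_sum_comm _ _ fun b _ => hfin₂ _ b]
    rw [← finsum_sum_comm _ _ fun a _ => finite_support_finset_sum _ _ fun b _ => hfin₂ a b,
      zsmul_finsum]
    refine finsum_congr fun i => ?_
    rw [huv, smul_comm]
    simp only [Finset.smul_sum, smul_smul]
    refine Finset.sum_congr rfl fun a _ => Finset.sum_congr rfl fun b _ => ?_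
    rw [Int.negOnePow_add _ r, Units.val_mul]
    congr 1
    · ring
    · congr 2 <;> [skip; congr 1] <;> ring_nf
  rw [oppositeDefect, hL, hR₁, hR₂, ← smul_sub, ← neg_add', neg_eq_zero, ← smul_add,
    ← Finset.sum_sub_distrib, ← Finset.sum_add_distrib, Finset.sum_eq_zero, smul_zero]
  intro a _
  rw [← Finset.sum_sub_distrib, ← Finset.sum_add_distrib]
  refine Finset.sum_eq_zero fun b _ => ?_
  have hJac := mode_jacobi (virOneDiv V a u) (virOneDiv V b v) w (2 * k - a - 2 - p - r)
    (2 * l - b - 2 - q - r) r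
  rw [finsum_eq_sum_range _ T fun t ht => by
    rw [hT a b t ht, mode_zero, LinearMap.zero_apply, smul_zero]] at hJac
  rw [hJac]
  abel

end Opposite

section OppositeDefect

variable {V : Type*} [AddCommGroup V] [Module ℂ V] [VertexOperatorAlgebra V]
  {X : Type*} [AddCommGroup X] [Module ℂ X] {o : ℤ → V →ₗ[ℂ] Module.End ℂ X}

theorem oppositeDefect_finite (ho : ∀ v w, ∃ N : ℤ, ∀ n ≤ N, o n v w = 0) (u v : V) (w : X)
    (p q r : ℤ) :
    (Function.support fun i : ℕ =>
      Ring.choose p i • o (p + q - i) (mode V u (r + i) v) w).Finite ∧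
    (Function.support fun i : ℕ =>
      ((-1) ^ i * Ring.choose r i) • o (q + i) v (o (p + r - i) u w)).Finite ∧
    (Function.support fun i : ℕ => ((r.negOnePow : ℤ) * ((-1) ^ i * Ring.choose r i)) •
      o (p + i) u (o (q + r - i) v w)).Finite := by
  obtain ⟨N₁, h₁⟩ := exists_nat_truncation u v r
  obtain ⟨N₂, h₂⟩ := ho u w
  obtain ⟨N₃, h₃⟩ := ho v w
  exact ⟨finite_support_of_eventually_zero _ N₁ fun i hi => by simp [h₁ i hi],
    finite_support_of_eventually_zero _ (p + r - N₂).toNat fun i hi => by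
      rw [h₂ _ (by omega), map_zero, smul_zero],
    finite_support_of_eventually_zero _ (q + r - N₃).toNat fun i hi => by
      rw [h₃ _ (by omega), map_zero, smul_zero]⟩

theorem oppositeDefect_add_left (ho : ∀ v w, ∃ N : ℤ, ∀ n ≤ N, o n v w = 0) (u u' v : V) (w : X)
    (p q r : ℤ) : oppositeDefect o (u + u') v w p q r
      = oppositeDefect o u v w p q r + oppositeDefect o u' v w p q r := by
  have h := oppositeDefect_finite ho u v w p q r
  have h' := oppositeDefect_finite ho u' v w p q r
  unfold oppositeDefect
  simp only [mode_add, map_add, LinearMap.add_apply, smul_add]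
  rw [finsum_add_distrib h.1 h'.1, finsum_add_distrib h.2.1 h'.2.1,
    finsum_add_distrib h.2.2 h'.2.2]
  abel

theorem oppositeDefect_add_right (ho : ∀ v w, ∃ N : ℤ, ∀ n ≤ N, o n v w = 0) (u v v' : V) (w : X)
    (p q r : ℤ) : oppositeDefect o u (v + v') w p q r
      = oppositeDefect o u v w p q r + oppositeDefect o u v' w p q r := by
  have h := oppositeDefect_finite ho u v w p q r
  have h' := oppositeDefect_finite ho u v' w p q r
  unfold oppositeDefect
  simp only [map_add, LinearMap.add_apply, smul_add]
  rw [finsum_add_distrib h.1 h'.1, finsum_add_distrib h.2.1 h'.2.1,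
    finsum_add_distrib h.2.2 h'.2.2]
  abel

end OppositeDefect

/-- The Jacobi identity for the opposite vertex operators on a weak module; it expresses that the
contragredient action on the dual space satisfies the Jacobi identity. -/
theorem opposite_jacobi {V M : Type*} [AddCommGroup V] [Module ℂ V] [VertexOperatorAlgebra V]
    [AddCommGroup M] [Module ℂ M] [WeakModule V M] (u v : V) (w : M) (p q r : ℤ) :
    oppositeDefect (oppositeMode V M) u v w p q r = 0 := by
  induction u using homogeneous_induction with
  | h0 => simp [oppositeDefect, mode_zero]
  | ha u u' hu hu' => rw [oppositeDefect_add_left opposite_truncation, hu, hu', add_zero]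
  | hh k u hk =>
    induction v using homogeneous_induction with
    | h0 => simp [oppositeDefect]
    | ha v v' hv hv' => rw [oppositeDefect_add_right opposite_truncation, hv, hv', add_zero]
    | hh l v hl => exact opposite_jacobi_homogeneous hk hl w p q r

/-! ### Vacuum, translation and commutators of opposite vertex operators -/

section OppositeModes

variable {V : Type*} [AddCommGroup V] [Module ℂ V] [VertexOperatorAlgebra V]
  {M : Type*} [AddCommGroup M] [Module ℂ M] [WeakModule V M]

local notation "𝟏" => (VertexOperatorAlgebra.vac : V)

local notation "ω" => (VertexOperatorAlgebra.conf : V)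

theorem conf_mem : ω ∈ weightSpace V V ((2 : ℤ) : ℂ) := by
  have h := congrArg (fun f : Module.End ℂ V => f 𝟏)
    (VertexOperatorAlgebra.virasoro (V := V) 0 (-2))
  have h1 := (VertexOperatorAlgebra.creation ω).1
  have h2 := (VertexOperatorAlgebra.creation ω).2 1 (by norm_num)
  simp [h1, h2] at h
  rw [weightSpace, Module.End.mem_eigenspace_iff, vir, zero_add, h]
  norm_num

theorem vir_one_conf : vir V V 1 ω = 0 := by
  have h := congrArg (fun f : Module.End ℂ V => f 𝟏)
    (VertexOperatorAlgebra.virasoro (V := V) 1 (-2))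
  have h1 := (VertexOperatorAlgebra.creation ω).1
  have h2 := (VertexOperatorAlgebra.creation ω).2 0 (by norm_num)
  have h3 := (VertexOperatorAlgebra.creation ω).2 2 (by norm_num)
  simp [h1, h2, h3] at h
  exact h

theorem vir_one_vac : vir V V 1 𝟏 = 0 :=
  (VertexOperatorAlgebra.creation ω).2 2 (by norm_num)

theorem virOneDiv_eq_zero {v : V} (hv : vir V V 1 v = 0) (i : ℕ) (hi : 1 ≤ i) :
    virOneDiv V i v = 0 := by
  obtain ⟨i, rfl⟩ := Nat.exists_eq_add_of_le' hi
  rw [virOneDiv, LinearMap.smul_apply, pow_succ, Module.End.mul_apply, hv, map_zero, smul_zero]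

/-- On a vector `v` of weight `k` with `L(1) v = 0`, the opposite vertex operator is
`(-1)^k x^(-2k) Y(v, x⁻¹)`. -/
theorem opposite_of_vir_one_eq_zero {k : ℤ} {v : V} (hv : v ∈ weightSpace V V (k : ℂ))
    (h1 : vir V V 1 v = 0) (n : ℤ) (w : M) :
    oppositeMode V M n v w = (k.negOnePow : ℤ) • mode M v (2 * k - n - 2) w := by
  rw [opposite_eq_sum hv (virOneDiv_eq_zero h1)]
  simp [virOneDiv_zero]

theorem opposite_vac (n : ℤ) (w : M) : oppositeMode V M n 𝟏 w = if n = -1 then w else 0 := by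
  rw [opposite_of_vir_one_eq_zero vac_mem vir_one_vac, WeakModule.vacuum]
  by_cases h : n = -1
  · simp [h]
  · rw [if_neg h, if_neg (by omega), smul_zero]

theorem opposite_conf (n : ℤ) (w : M) : oppositeMode V M n ω w = mode M ω (2 - n) w := by
  rw [opposite_of_vir_one_eq_zero conf_mem vir_one_conf, Int.negOnePow_even 2 (by decide)]
  simp only [Units.val_one, one_smul]
  congr 2
  ring

theorem vir_neg_one_eq (v : V) : vir V V (-1) v = mode V v (-2) 𝟏 := by
  have h1 := (VertexOperatorAlgebra.creation (vir V V (-1) v)).1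
  have h2 := congrArg (fun f : Module.End ℂ V => f 𝟏) (VertexOperatorAlgebra.derivative v (-1))
  rw [← h1]
  simpa [vir] using h2

theorem alternating_choose_neg_two (i : ℕ) : (-1) ^ i * Ring.choose (-2 : ℤ) i = i + 1 := by
  rw [choose_upper_negation, ← mul_assoc, ← mul_pow,
    show (i : ℤ) - -2 - 1 = ((i + 1 : ℕ) : ℤ) by push_cast; ring, Ring.choose_natCast]
  simp

theorem finsum_choose_zero {X : Type*} [AddCommGroup X] (f : ℕ → X) :
    ∑ᶠ i : ℕ, Ring.choose (0 : ℤ) i • f i = f 0 := by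
  rw [finsum_eq_single _ 0 fun i hi => by
    simp [choose_zero_of_pos i (Nat.pos_of_ne_zero hi)]]
  simp

theorem finsum_eq_ite_of_int {X : Type*} [AddCommGroup X] (f : ℕ → X) (n : ℤ)
    (h : ∀ i : ℕ, (i : ℤ) ≠ n → f i = 0) :
    ∑ᶠ i : ℕ, f i = if 0 ≤ n then f n.toNat else 0 := by
  split_ifs with hn
  · exact finsum_eq_single _ _ fun i hi => h i (by omega)
  · exact finsum_eq_zero_of_forall_eq_zero fun i => h i (by omega)

/-- The derivative property `Y°(L(-1)v, x) = d/dx Y°(v, x)`. -/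
theorem opposite_derivative (v : V) (n : ℤ) (w : M) :
    oppositeMode V M n (vir V V (-1) v) w = (-n) • oppositeMode V M (n - 1) v w := by
  have h := opposite_jacobi v 𝟏 w 0 n (-2)
  rw [oppositeDefect, finsum_choose_zero] at h
  simp only [alternating_choose_neg_two, opposite_vac] at h
  rw [finsum_eq_ite_of_int _ (-1 - n) fun i hi => by rw [if_neg (by omega), smul_zero],
    finsum_eq_ite_of_int _ (n - 1) fun i hi => by rw [if_neg (by omega), map_zero, smul_zero]] at h
  rw [vir_neg_one_eq, ← sub_eq_zero, ← h]
  by_cases hn : 0 ≤ n - 1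
  · rw [if_neg (by omega), if_pos hn, if_pos (by omega), Int.negOnePow_even (-2) (by decide),
      Int.toNat_of_nonneg hn]
    simp
  · by_cases hn' : 0 ≤ -1 - n
    · rw [if_pos hn', if_neg hn, if_pos (by omega), Int.toNat_of_nonneg hn']
      simp
      rw [show -2 - (-1 - n) = n - 1 by ring]
      module
    · obtain rfl : n = 0 := by omega
      simp

/-- The commutator formula for opposite vertex operators. -/
theorem opposite_commutator (u v : V) (m n : ℤ) (w : M) :
    oppositeMode V M n v (oppositeMode V M m u w) - oppositeMode V M m u (oppositeMode V M n v w)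
      = ∑ᶠ i : ℕ, Ring.choose m i • oppositeMode V M (m + n - i) (mode V u i v) w := by
  have h := opposite_jacobi u v w m n 0
  have h1 := finsum_alternating_choose_zero 1
    fun i : ℕ => oppositeMode V M (n + i) v (oppositeMode V M (m + 0 - i) u w)
  have h2 := finsum_alternating_choose_zero ((0 : ℤ).negOnePow : ℤ)
    fun i : ℕ => oppositeMode V M (m + i) u (oppositeMode V M (n + 0 - i) v w)
  simp only [one_mul] at h1
  rw [oppositeDefect, h1, h2, sub_eq_zero] at h
  simpa using h.symm

theorem opposite_vir_one (v : V) (n : ℤ) (w : M) :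
    oppositeMode V M n v (vir V M 1 w)
      = vir V M 1 (oppositeMode V M n v w) - n • oppositeMode V M (n - 1) v w := by
  have h := opposite_commutator ω v 0 n w
  rw [finsum_choose_zero, opposite_conf, opposite_conf] at h
  simp only [Nat.cast_zero, zero_add, sub_zero] at h
  rw [conf_mode_zero, opposite_derivative] at h
  change oppositeMode V M n v (vir V M 1 w) - vir V M 1 (oppositeMode V M n v w) = _ at h
  rw [sub_eq_iff_eq_add.mp h]
  module

end OppositeModes

/-! ### Opposite vertex operators paired with the functions `x^p (1+x)^r` -/

section Test

variable (V M : Type*) [AddCommGroup V] [Module ℂ V] [VertexOperatorAlgebra V]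
  [AddCommGroup M] [Module ℂ M] [WeakModule V M]

/-- The residue of `x^p (1+x)^r Y°(v, x)`, where `(1+x)^r` is expanded at `x = ∞`. -/
def oppositeTest (p r : ℤ) : V →ₗ[ℂ] Module.End ℂ M :=
  LinearMap.mk₂ ℂ (fun v w => ∑ᶠ i : ℕ, Ring.choose r i • oppositeMode V M (p + r - i) v w)
    (fun u v w => by
      obtain ⟨N, hN⟩ := exists_nat_opposite_truncation u w (p + r)
      obtain ⟨N', hN'⟩ := exists_nat_opposite_truncation v w (p + r)
      rw [← finsum_add_distrib
        (finite_support_of_eventually_zero _ N fun i hi => by simp [hN i hi])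
        (finite_support_of_eventually_zero _ N' fun i hi => by simp [hN' i hi])]
      simp)
    (fun c v w => by simp [smul_finsum, smul_comm c])
    (fun v w w' => by
      obtain ⟨N, hN⟩ := exists_nat_opposite_truncation v w (p + r)
      obtain ⟨N', hN'⟩ := exists_nat_opposite_truncation v w' (p + r)
      rw [← finsum_add_distrib
        (finite_support_of_eventually_zero _ N fun i hi => by simp [hN i hi])
        (finite_support_of_eventually_zero _ N' fun i hi => by simp [hN' i hi])]
      simp)
    (fun c v w => by simp [smul_finsum, smul_comm c])

variable {V M}

theorem oppositeTest_apply (p r : ℤ) (v : V) (w : M) : oppositeTest V M p r v w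
    = ∑ᶠ i : ℕ, Ring.choose r i • oppositeMode V M (p + r - i) v w := rfl

theorem oppositeTest_zero (p : ℤ) : oppositeTest V M p 0 = oppositeMode V M p := by
  ext v w
  rw [oppositeTest_apply, finsum_choose_zero]
  simp

theorem oppositeTest_truncation (v : V) (w : M) :
    ∃ N : ℤ, ∀ p r : ℤ, p + r ≤ N → oppositeTest V M p r v w = 0 := by
  obtain ⟨N, hN⟩ := opposite_truncation v w
  refine ⟨N, fun p r h => ?_⟩
  rw [oppositeTest_apply]
  exact finsum_eq_zero_of_forall_eq_zero fun i => by rw [hN _ (by omega), smul_zero]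

/-- `x^p (1+x)^(r+1) = x^p (1+x)^r + x^(p+1) (1+x)^r`. -/
theorem oppositeTest_succ (p r : ℤ) :
    oppositeTest V M p (r + 1) = oppositeTest V M p r + oppositeTest V M (p + 1) r := by
  ext v w
  obtain ⟨N, hN⟩ := exists_nat_opposite_truncation v w (p + r + 1)
  have h1 : ∀ i : ℕ, N ≤ i → oppositeMode V M (p + r - i) v w = 0 := fun i hi => by
    have := hN (i + 1) (by omega)
    rw [← this]
    congr 2
    push_cast
    ring_nf
  simp only [LinearMap.add_apply, oppositeTest_apply]
  rw [finsum_eq_sum_range _ (N + 1) fun i hi => by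
      rw [show p + (r + 1) - (i : ℤ) = p + r + 1 - i by ring, hN i (by omega), smul_zero],
    finsum_eq_sum_range _ N fun i hi => by rw [h1 i hi, smul_zero],
    finsum_eq_sum_range _ (N + 1) fun i hi => by
      rw [show p + 1 + r - (i : ℤ) = p + r + 1 - i by ring, hN i (by omega), smul_zero],
    Finset.sum_range_succ', Finset.sum_range_succ' _ N, ← add_assoc (Finset.sum _ _),
    ← Finset.sum_add_distrib]
  congr 1
  · refine Finset.sum_congr rfl fun i _ => ?_
    rw [Ring.choose_succ_succ, add_smul,
      show p + (r + 1) - ((i + 1 : ℕ) : ℤ) = p + r - i by push_cast; ring,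
      show p + 1 + r - ((i + 1 : ℕ) : ℤ) = p + r - i by push_cast; ring]
  · rw [Ring.choose_zero_right, Ring.choose_zero_right,
      show p + (r + 1) - ((0 : ℕ) : ℤ) = p + 1 + r - ((0 : ℕ) : ℤ) by ring]

/-- The commutator formula for opposite vertex operators paired with functions `f = x^b (1+x)^m`
and `g = x^n (1+x)^a`: the sum is over the products of `g` and the divided derivatives of `f`. -/
theorem oppositeTest_commutator (u v : V) (b m n a : ℤ) (w : M) :
    oppositeTest V M n a v (oppositeTest V M b m u w)
        - oppositeTest V M b m u (oppositeTest V M n a v w)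
      = ∑ᶠ i : ℕ, ∑ x ∈ antidiagonal i, (Ring.choose b x.1 * Ring.choose m x.2) •
          oppositeTest V M (b + n - x.1) (m + a - x.2) (mode V u i v) w := by
  obtain ⟨I, hI⟩ := exists_nat_truncation u v 0
  simp only [zero_add] at hI
  obtain ⟨S, hS⟩ := exists_nat_opposite_truncation u w (b + m)
  obtain ⟨J, hJ⟩ := exists_nat_opposite_truncation v w (n + a)
  obtain ⟨S', hS'⟩ := exists_bound_range
    (fun j s => oppositeMode V M (b + m - s) u (oppositeMode V M (n + a - j) v w) = 0)
    (fun j => exists_nat_opposite_truncation _ _ _) J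
  obtain ⟨J', hJ'⟩ := exists_bound_range
    (fun s j => oppositeMode V M (n + a - j) v (oppositeMode V M (b + m - s) u w) = 0)
    (fun s => exists_nat_opposite_truncation _ _ _) S
  obtain ⟨R, hR⟩ := exists_bound_range
    (fun i t => oppositeMode V M (b + n + m + a - i - t) (mode V u i v) w = 0)
    (fun i => exists_nat_opposite_truncation _ _ _) I
  set T := S + J + S' + J' + R with hT
  -- both products are expanded in powers of `x`, with all sums over the same finite box
  have hvu : oppositeTest V M n a v (oppositeTest V M b m u w)
      = ∑ s ∈ Finset.range T, ∑ j ∈ Finset.range T, (Ring.choose m s * Ring.choose a j) •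
        oppositeMode V M (n + a - j) v (oppositeMode V M (b + m - s) u w) := by
    rw [oppositeTest_apply b m, finsum_eq_sum_range _ T fun s hs => by
      rw [hS s (by omega), smul_zero], map_sum]
    refine Finset.sum_congr rfl fun s _ => ?_
    rw [map_zsmul, oppositeTest_apply, finsum_eq_sum_range _ T fun j hj => ?_, Finset.smul_sum]
    · simp only [smul_smul]
    · by_cases h : s < S
      · rw [hJ' s h j (by omega), smul_zero]
      · rw [hS s (by omega), map_zero, smul_zero]
  have huv : oppositeTest V M b m u (oppositeTest V M n a v w)
      = ∑ s ∈ Finset.range T, ∑ j ∈ Finset.range T, (Ring.choose m s * Ring.choose a j) •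
        oppositeMode V M (b + m - s) u (oppositeMode V M (n + a - j) v w) := by
    rw [oppositeTest_apply n a, finsum_eq_sum_range _ T fun s hs => by
      rw [hJ s (by omega), smul_zero], map_sum, Finset.sum_comm]
    refine Finset.sum_congr rfl fun j _ => ?_
    rw [map_zsmul, oppositeTest_apply, finsum_eq_sum_range _ T fun s hs => ?_, Finset.smul_sum]
    · simp only [smul_smul, mul_comm]
    · by_cases h : j < J
      · rw [hS' j h s (by omega), smul_zero]
      · rw [hJ j (by omega), map_zero, smul_zero]
  have hzero : ∀ i t : ℕ, T ≤ t →
      oppositeMode V M (b + n + m + a - i - t) (mode V u i v) w = 0 := fun i t ht => by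
    by_cases h : i < I
    · exact hR i h t (by omega)
    · rw [hI i (not_lt.mp h), map_zero, LinearMap.zero_apply]
  have hcomm : ∀ s j : ℕ, oppositeMode V M (n + a - j) v (oppositeMode V M (b + m - s) u w)
      - oppositeMode V M (b + m - s) u (oppositeMode V M (n + a - j) v w)
      = ∑ i ∈ Finset.range I, Ring.choose (b + (m - s)) i •
          oppositeMode V M (b + n + m + a - i - (s + j : ℕ)) (mode V u i v) w := by
    intro s j
    rw [opposite_commutator, finsum_eq_sum_range _ I fun i hi => by
      rw [hI i hi, map_zero, LinearMap.zero_apply, smul_zero]]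
    refine Finset.sum_congr rfl fun i _ => ?_
    rw [show b + m - (s : ℤ) = b + (m - s) by ring,
      show b + (m - (s : ℤ)) + (n + a - j) - i = b + n + m + a - i - (s + j : ℕ) by
        push_cast; ring]
  rw [hvu, huv, ← Finset.sum_sub_distrib]
  simp only [← Finset.sum_sub_distrib, ← smul_sub, hcomm, Finset.smul_sum, smul_smul]
  rw [finsum_eq_sum_range _ I fun i hi => Finset.sum_eq_zero fun x _ => by
    rw [hI i hi, map_zero, LinearMap.zero_apply, smul_zero]]
  have hr : ∀ i : ℕ, ∀ x ∈ antidiagonal i, (Ring.choose b x.1 * Ring.choose m x.2) •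
          oppositeTest V M (b + n - x.1) (m + a - x.2) (mode V u i v) w
      = ∑ s ∈ Finset.range T, ∑ j ∈ Finset.range T,
        (Ring.choose b x.1 * Ring.choose m x.2 * (Ring.choose (m - x.2) s * Ring.choose a j)) •
          oppositeMode V M (b + n + m + a - i - (s + j : ℕ)) (mode V u i v) w := by
    intro i x hx
    have hx' : ((x.1 : ℤ) + x.2) = i := by exact_mod_cast mem_antidiagonal.mp hx
    have hidx : ∀ t : ℕ, b + n - (x.1 : ℤ) + (m + a - x.2) - t = b + n + m + a - i - t := by
      intro t
      linear_combination -hx'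
    rw [oppositeTest_apply, finsum_eq_sum_range _ T fun t ht => by
      rw [hidx, hzero i t ht, smul_zero]]
    simp only [hidx]
    have := sum_range_sum_range_add (fun s j => Ring.choose (m - x.2) s * Ring.choose a j)
      (fun t : ℕ => oppositeMode V M (b + n + m + a - i - t) (mode V u i v) w) T (hzero i)
    rw [show m + a - (x.2 : ℤ) = (m - x.2) + a by ring]
    simp only [Ring.add_choose_eq _ (Commute.all (m - (x.2 : ℤ)) a)]
    rw [← this]
    simp only [Finset.smul_sum, smul_smul]
  -- the `i`-th divided derivative of `x^b (1+x)^m`, computed before and after expanding `(1+x)^m`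
  have hc : ∀ s : ℕ, ∑ j ∈ Finset.range T, ∑ i ∈ Finset.range I,
        (Ring.choose m s * Ring.choose a j * Ring.choose (b + (m - s)) i) •
          oppositeMode V M (b + n + m + a - i - (s + j : ℕ)) (mode V u i v) w
      = ∑ i ∈ Finset.range I, ∑ j ∈ Finset.range T, ∑ x ∈ antidiagonal i,
        (Ring.choose b x.1 * Ring.choose m x.2 * (Ring.choose (m - x.2) s * Ring.choose a j)) •
          oppositeMode V M (b + n + m + a - i - (s + j : ℕ)) (mode V u i v) w := by
    intro s
    rw [Finset.sum_comm]
    refine Finset.sum_congr rfl fun i _ => Finset.sum_congr rfl fun j _ => ?_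
    rw [← Finset.sum_smul, mul_right_comm, choose_mul_choose_eq_sum, Finset.sum_mul]
    congr 1
    exact Finset.sum_congr rfl fun x _ => by ring
  rw [Finset.sum_congr rfl fun s _ => hc s, Finset.sum_comm]
  refine Finset.sum_congr rfl fun i _ => ?_
  rw [Finset.sum_congr rfl (hr i)]
  refine Eq.trans ?_ Finset.sum_comm
  exact Finset.sum_congr rfl fun s _ => Finset.sum_comm

end Test

/-! ### Multiplication of truncated series by powers of `x + ε` -/

section Shift

variable {X Y : Type*} [AddCommGroup X] [Module ℂ X] [AddCommGroup Y] [Module ℂ Y]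

variable (X) in
/-- Multiplication by `x + ε` on series `∑ n : ℤ, h n x^(-n-1)`. -/
def shiftAdd (ε : ℂ) : Module.End ℂ (ℤ → X) where
  toFun h n := h (n + 1) + ε • h n
  map_add' f g := by ext n; simp only [Pi.add_apply, smul_add]; abel
  map_smul' c f := by ext n; simp only [Pi.smul_apply, smul_add, RingHom.id_apply, smul_comm ε c]

theorem shiftAdd_apply (ε : ℂ) (h : ℤ → X) (n : ℤ) : shiftAdd X ε h n = h (n + 1) + ε • h n := rfl

theorem shiftAdd_pow_map (ε : ℂ) (f : X →ₗ[ℂ] Y) (h : ℤ → X) (a : ℕ) :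
    (shiftAdd Y ε ^ a) (fun n => f (h n)) = fun n => f ((shiftAdd X ε ^ a) h n) := by
  induction a generalizing h with
  | zero => rfl
  | succ a ih =>
    rw [pow_succ, pow_succ, Module.End.mul_apply, Module.End.mul_apply, ← ih]
    congr 1
    ext n
    simp [shiftAdd_apply]

/-- A series truncated from above which is annihilated by a power of `x + ε`, `ε ≠ 0`, vanishes. -/
theorem eq_zero_of_shiftAdd_pow {ε : ℂ} (hε : ε ≠ 0) (a : ℕ) {h : ℤ → X}
    (htr : ∃ N : ℤ, ∀ n, N ≤ n → h n = 0) {n₀ : ℤ}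
    (h0 : ∀ n, n₀ ≤ n → (shiftAdd X ε ^ a) h n = 0) : ∀ n, n₀ ≤ n → h n = 0 := by
  induction a generalizing h with
  | zero => exact h0
  | succ a ih =>
    obtain ⟨N, hN⟩ := htr
    have h1 : ∀ n, n₀ ≤ n → shiftAdd X ε h n = 0 := by
      refine ih ⟨N, fun n hn => ?_⟩ fun n hn => ?_
      · rw [shiftAdd_apply, hN n hn, hN (n + 1) (by omega), smul_zero, add_zero]
      · have := h0 n hn
        rwa [pow_succ, Module.End.mul_apply] at this
    have key : ∀ (d : ℕ) (n : ℤ), n₀ ≤ n → N - n ≤ d → h n = 0 := by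
      intro d
      induction d with
      | zero => exact fun n _ hn => hN n (by simpa using hn)
      | succ d ihd =>
        intro n hn hd
        have h2 := h1 n hn
        rw [shiftAdd_apply, ihd (n + 1) (by omega) (by push_cast at hd; omega), zero_add] at h2
        exact (smul_eq_zero.mp h2).resolve_left hε
    exact fun n hn => key (N - n).toNat n hn (by omega)

theorem eq_of_shiftAdd_pow {ε : ℂ} (hε : ε ≠ 0) (a : ℕ) {g h : ℤ → X}
    (hg : ∃ N : ℤ, ∀ n, N ≤ n → g n = 0) (hh : ∃ N : ℤ, ∀ n, N ≤ n → h n = 0)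
    (h0 : (shiftAdd X ε ^ a) g = (shiftAdd X ε ^ a) h) : g = h := by
  obtain ⟨N, hN⟩ := hg
  obtain ⟨N', hN'⟩ := hh
  have : ∀ n : ℤ, n ≤ n → (g - h) n = 0 := fun n => eq_zero_of_shiftAdd_pow hε a
    ⟨max N N', fun m hm => by
      rw [Pi.sub_apply, hN m (le_trans (le_max_left _ _) hm),
        hN' m (le_trans (le_max_right _ _) hm), sub_zero]⟩
    (fun m _ => by rw [map_sub, h0, sub_self, Pi.zero_apply]) n
  funext n
  exact sub_eq_zero.mp (this n le_rfl)

theorem shiftAdd_pow_eq_of_le {ε : ℂ} {a b : ℕ} (hab : a ≤ b) {g h : ℤ → X}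
    (h0 : (shiftAdd X ε ^ a) g = (shiftAdd X ε ^ a) h) :
    (shiftAdd X ε ^ b) g = (shiftAdd X ε ^ b) h := by
  rw [← Nat.sub_add_cancel hab, pow_add, Module.End.mul_apply, Module.End.mul_apply, h0]

variable (X) in
/-- Multiplication by `x₂ + ε` on series `∑ p q : ℤ, K p q x₁^(-p-1) x₂^(-q-1)`. -/
def shiftSnd (ε : ℂ) : Module.End ℂ (ℤ → ℤ → X) := (shiftAdd X ε).compLeft ℤ

theorem shiftSnd_apply (ε : ℂ) (K : ℤ → ℤ → X) (p q : ℤ) :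
    shiftSnd X ε K p q = K p (q + 1) + ε • K p q := rfl

theorem shiftFst_apply (ε : ℂ) (K : ℤ → ℤ → X) (p q : ℤ) :
    shiftAdd (ℤ → X) ε K p q = K (p + 1) q + ε • K p q := rfl

theorem shiftSnd_pow_apply (ε : ℂ) (a : ℕ) (K : ℤ → ℤ → X) (p : ℤ) :
    (shiftSnd X ε ^ a) K p = (shiftAdd X ε ^ a) (K p) := by
  induction a generalizing K with
  | zero => rfl
  | succ a ih =>
    rw [pow_succ, pow_succ, Module.End.mul_apply, Module.End.mul_apply, ih]
    rfl

theorem shiftFst_pow_apply (ε : ℂ) (a : ℕ) (K : ℤ → ℤ → X) (p q : ℤ) :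
    (shiftAdd (ℤ → X) ε ^ a) K p q = (shiftAdd X ε ^ a) (fun p => K p q) p :=
  (congrFun (shiftAdd_pow_map ε (LinearMap.proj q : (ℤ → X) →ₗ[ℂ] X) K a) p).symm

theorem shift_commute (ε δ : ℂ) : Commute (shiftAdd (ℤ → X) ε) (shiftSnd X δ) := by
  ext K p q
  simp only [Module.End.mul_apply, shiftFst_apply, shiftSnd_apply, smul_add, smul_comm ε δ]
  abel

/-- Two-variable form of `eq_zero_of_shiftAdd_pow`. -/
theorem eq_zero_of_shift_pow_pow {ε δ : ℂ} (hε : ε ≠ 0) (hδ : δ ≠ 0) (a b : ℕ) {K : ℤ → ℤ → X}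
    (h₁ : ∀ q, ∃ N : ℤ, ∀ p, N ≤ p → K p q = 0) (h₂ : ∀ p, ∃ N : ℤ, ∀ q, N ≤ q → K p q = 0)
    {p₀ q₀ : ℤ} (h0 : ∀ p q, p₀ ≤ p → q₀ ≤ q →
      (shiftAdd (ℤ → X) ε ^ a) ((shiftSnd X δ ^ b) K) p q = 0) :
    ∀ p q, p₀ ≤ p → q₀ ≤ q → K p q = 0 := by
  have h₁' : ∀ q, ∃ N : ℤ, ∀ p, N ≤ p → (shiftSnd X δ ^ b) K p q = 0 := by
    clear h₂ h0
    induction b generalizing K with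
    | zero => exact h₁
    | succ b ih =>
      rw [pow_succ, Module.End.mul_apply]
      refine ih fun q => ?_
      obtain ⟨N, hN⟩ := h₁ q
      obtain ⟨N', hN'⟩ := h₁ (q + 1)
      exact ⟨max N N', fun p hp => by
        rw [shiftSnd_apply, hN p (le_trans (le_max_left _ _) hp),
          hN' p (le_trans (le_max_right _ _) hp), smul_zero, add_zero]⟩
  have h3 : ∀ p q, p₀ ≤ p → q₀ ≤ q → (shiftSnd X δ ^ b) K p q = 0 := fun p q hp hq =>
    eq_zero_of_shiftAdd_pow hε a (h := fun p => (shiftSnd X δ ^ b) K p q) (h₁' q)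
      (fun p hp => by rw [← shiftFst_pow_apply]; exact h0 p q hp hq) p hp
  intro p q hp hq
  refine eq_zero_of_shiftAdd_pow hδ b (h₂ p) (fun q hq => ?_) q hq
  rw [← shiftSnd_pow_apply]
  exact h3 p q hp hq

theorem shift_pow_pow_eq_of_le {ε : ℂ} {a b : ℕ} (hab : a ≤ b) {g h : ℤ → ℤ → X}
    (h0 : (shiftAdd (ℤ → X) ε ^ a) ((shiftSnd X ε ^ a) g)
      = (shiftAdd (ℤ → X) ε ^ a) ((shiftSnd X ε ^ a) h)) :
    (shiftAdd (ℤ → X) ε ^ b) ((shiftSnd X ε ^ b) g)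
      = (shiftAdd (ℤ → X) ε ^ b) ((shiftSnd X ε ^ b) h) := by
  have key : ∀ f : ℤ → ℤ → X, (shiftAdd (ℤ → X) ε ^ b) ((shiftSnd X ε ^ b) f)
      = (shiftAdd (ℤ → X) ε ^ (b - a)) ((shiftSnd X ε ^ (b - a))
        ((shiftAdd (ℤ → X) ε ^ a) ((shiftSnd X ε ^ a) f))) := by
    intro f
    have hc := ((shift_commute (X := X) ε ε).pow_pow a (b - a)).eq
    have h1 : shiftAdd (ℤ → X) ε ^ b = shiftAdd (ℤ → X) ε ^ (b - a) * shiftAdd (ℤ → X) ε ^ a := by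
      rw [← pow_add, Nat.sub_add_cancel hab]
    have h2 : shiftSnd X ε ^ b = shiftSnd X ε ^ (b - a) * shiftSnd X ε ^ a := by
      rw [← pow_add, Nat.sub_add_cancel hab]
    rw [h1, h2]
    simp only [← Module.End.mul_apply]
    rw [mul_assoc, ← mul_assoc (shiftAdd (ℤ → X) ε ^ a), hc]
    simp only [mul_assoc]
  rw [key, key, h0]

/-- The sums along antidiagonals `p + q = const` which occur in the Jacobi identity. -/
def diagSum (c : ℕ → ℤ) (s a b : ℤ) (K : ℤ → ℤ → X) (p q : ℤ) : X :=
  ∑ᶠ i : ℕ, c i • K (p + a + s * i) (q + b - s * i)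

/-- Along each antidiagonal, the entries of `K` are eventually zero in the direction `s`. -/
def DiagFinite (s : ℤ) (K : ℤ → ℤ → X) : Prop :=
  ∀ p q : ℤ, ∃ N : ℕ, ∀ i : ℕ, N ≤ i → K (p + s * i) (q - s * i) = 0

theorem DiagFinite.shiftFst {s : ℤ} {K : ℤ → ℤ → X} (hK : DiagFinite s K) (ε : ℂ) :
    DiagFinite s (shiftAdd (ℤ → X) ε K) := fun p q => by
  obtain ⟨N, hN⟩ := hK p q
  obtain ⟨N', hN'⟩ := hK (p + 1) q
  refine ⟨max N N', fun i hi => ?_⟩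
  rw [shiftFst_apply, hN i (le_trans (le_max_left _ _) hi), add_right_comm,
    hN' i (le_trans (le_max_right _ _) hi), smul_zero, add_zero]

theorem DiagFinite.shiftSnd {s : ℤ} {K : ℤ → ℤ → X} (hK : DiagFinite s K) (ε : ℂ) :
    DiagFinite s (shiftSnd X ε K) := fun p q => by
  obtain ⟨N, hN⟩ := hK p q
  obtain ⟨N', hN'⟩ := hK p (q + 1)
  refine ⟨max N N', fun i hi => ?_⟩
  rw [shiftSnd_apply, hN i (le_trans (le_max_left _ _) hi),
    show q - s * i + 1 = q + 1 - s * i by ring,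
    hN' i (le_trans (le_max_right _ _) hi), smul_zero, add_zero]

theorem DiagFinite.sub {Z : Type*} [AddCommGroup Z] {s : ℤ} {K L : ℤ → ℤ → Z}
    (hK : DiagFinite s K) (hL : DiagFinite s L) :
    DiagFinite s (K - L) := fun p q => by
  obtain ⟨N, hN⟩ := hK p q
  obtain ⟨N', hN'⟩ := hL p q
  refine ⟨max N N', fun i hi => ?_⟩
  rw [Pi.sub_apply, Pi.sub_apply, hN i (le_trans (le_max_left _ _) hi),
    hN' i (le_trans (le_max_right _ _) hi), sub_zero]

theorem DiagFinite.finite {Z : Type*} [AddCommGroup Z] {s : ℤ} {K : ℤ → ℤ → Z}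
    (hK : DiagFinite s K) (c : ℕ → ℤ) (p q : ℤ) :
    (Function.support fun i : ℕ => c i • K (p + s * i) (q - s * i)).Finite := by
  obtain ⟨N, hN⟩ := hK p q
  exact finite_support_of_eventually_zero _ N fun i hi => by rw [hN i hi, smul_zero]

theorem diagSum_sub {Z : Type*} [AddCommGroup Z] {s : ℤ} {K L : ℤ → ℤ → Z}
    (hK : DiagFinite s K) (hL : DiagFinite s L)
    (c : ℕ → ℤ) (a b p q : ℤ) :
    diagSum c s a b (K - L) p q = diagSum c s a b K p q - diagSum c s a b L p q := by
  simp only [diagSum, Pi.sub_apply, smul_sub]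
  exact finsum_sub_distrib (hK.finite c _ _) (hL.finite c _ _)

theorem diagSum_shiftFst {s : ℤ} {K : ℤ → ℤ → X} (hK : DiagFinite s K) (ε : ℂ) (c : ℕ → ℤ)
    (a b : ℤ) :
    diagSum c s a b (shiftAdd (ℤ → X) ε K) = shiftAdd (ℤ → X) ε (diagSum c s a b K) := by
  funext p q
  rw [shiftFst_apply]
  simp only [diagSum, shiftFst_apply, smul_add, smul_finsum, smul_comm ε]
  have h1 := hK.finite c (p + 1 + a) (q + b)
  have h2 := hK.finite c (p + a) (q + b)
  rw [← finsum_add_distrib h1 (h2.subset fun i hi => by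
    intro hc
    apply hi
    simp only [smul_comm _ ε, hc, smul_zero])]
  refine finsum_congr fun i => ?_
  rw [show p + a + s * i + 1 = p + 1 + a + s * i by ring]

theorem diagSum_shiftSnd {s : ℤ} {K : ℤ → ℤ → X} (hK : DiagFinite s K) (ε : ℂ) (c : ℕ → ℤ)
    (a b : ℤ) :
    diagSum c s a b (shiftSnd X ε K) = shiftSnd X ε (diagSum c s a b K) := by
  funext p q
  rw [shiftSnd_apply]
  simp only [diagSum, shiftSnd_apply, smul_add, smul_finsum, smul_comm ε]
  have h1 := hK.finite c (p + a) (q + 1 + b)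
  have h2 := hK.finite c (p + a) (q + b)
  rw [← finsum_add_distrib h1 (h2.subset fun i hi => by
    intro hc
    apply hi
    simp only [smul_comm _ ε, hc, smul_zero])]
  refine finsum_congr fun i => ?_
  rw [show q + b - s * i + 1 = q + 1 + b - s * i by ring]

theorem diagSum_shift_pow_pow {s : ℤ} {K : ℤ → ℤ → X} (hK : DiagFinite s K) (ε : ℂ) (c : ℕ → ℤ)
    (a b : ℤ) (m n : ℕ) :
    diagSum c s a b ((shiftAdd (ℤ → X) ε ^ m) ((shiftSnd X ε ^ n) K))
      = (shiftAdd (ℤ → X) ε ^ m) ((shiftSnd X ε ^ n) (diagSum c s a b K)) := by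
  have h2 : DiagFinite s ((shiftSnd X ε ^ n) K) ∧ diagSum c s a b ((shiftSnd X ε ^ n) K)
      = (shiftSnd X ε ^ n) (diagSum c s a b K) := by
    induction n with
    | zero => exact ⟨hK, rfl⟩
    | succ n ih =>
      rw [pow_succ', Module.End.mul_apply, Module.End.mul_apply]
      exact ⟨ih.1.shiftSnd ε, by rw [diagSum_shiftSnd ih.1, ih.2]⟩
  rw [← h2.2]
  generalize (shiftSnd X ε ^ n) K = L at h2
  have h3 : DiagFinite s ((shiftAdd (ℤ → X) ε ^ m) L) ∧
      diagSum c s a b ((shiftAdd (ℤ → X) ε ^ m) L)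
        = (shiftAdd (ℤ → X) ε ^ m) (diagSum c s a b L) := by
    induction m with
    | zero => exact ⟨h2.1, rfl⟩
    | succ m ih =>
      rw [pow_succ', Module.End.mul_apply, Module.End.mul_apply]
      exact ⟨ih.1.shiftFst ε, by rw [diagSum_shiftFst ih.1, ih.2]⟩
  exact h3.2

end Shift

/-! ### Localization of the opposite action at a point -/

section Localization

variable {V : Type*} [AddCommGroup V] [Module ℂ V] [VertexOperatorAlgebra V]
  {D : Type*} [AddCommGroup D] [Module ℂ D]

theorem exists_int_bound_range (P : ℕ → ℤ → Prop) (hP : ∀ i, ∃ N, ∀ t, N ≤ t → P i t) (I : ℕ) :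
    ∃ N : ℤ, 0 ≤ N ∧ ∀ i < I, ∀ t, N ≤ t → P i t := by
  choose N hN using hP
  refine ⟨∑ i ∈ Finset.range I, |N i|, Finset.sum_nonneg fun i _ => abs_nonneg (N i),
    fun i hi t ht => hN i t (le_trans (le_trans (le_abs_self _) (Finset.single_le_sum
      (f := fun i => |N i|) (fun i _ => abs_nonneg (N i)) (Finset.mem_range.mpr hi))) ht)⟩

/-- The difference of the two sides of a component of the Jacobi identity, for modes
`m v n : D → D`. -/
def modeDefect (m : V →ₗ[ℂ] (ℤ → Module.End ℂ D)) (u v : V) (x : D) (p q r : ℤ) : D :=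
  ∑ᶠ i : ℕ, Ring.choose p i • m (mode V u (r + i) v) (p + q - i) x
    - (∑ᶠ i : ℕ, ((-1) ^ i * Ring.choose r i) • m u (p + r - i) (m v (q + i) x)
      - ∑ᶠ i : ℕ, ((r.negOnePow : ℤ) * ((-1) ^ i * Ring.choose r i)) •
          m v (q + r - i) (m u (p + i) x))

theorem jacobiDefect_eq_modeDefect (m : V →ₗ[ℂ] (ℤ → Module.End ℂ D)) (u v : V) (x : D)
    (p q r : ℤ) : jacobiDefect (fun v n => mode V v n) (fun v n => m v n) (fun v n => m v n)
      (fun v n => m v n) u v x p q r = modeDefect m u v x p q r := by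
  unfold jacobiDefect modeDefect
  simp only [Int.cast_id]
  congr 1
  · refine finsum_congr fun i => ?_
    rw [show q + (p - (i : ℤ)) = p + q - i by ring]
  · congr 1
    refine finsum_congr fun i => ?_
    rw [add_sub_assoc]

/-- The defect of the Jacobi identity is a truncated series in the first variable; with
`exists_modeDefect_snd_eq_zero` this is what makes `eq_zero_of_shift_pow_pow` applicable. -/
theorem exists_modeDefect_fst_eq_zero {m : V →ₗ[ℂ] (ℤ → Module.End ℂ D)}
    (hm : ∀ v x, ∃ N : ℤ, ∀ n, N ≤ n → m v n x = 0) (u v : V) (x : D) (q r : ℤ) :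
    ∃ N : ℤ, ∀ p, N ≤ p → modeDefect m u v x p q r = 0 := by
  obtain ⟨I, hI⟩ := exists_nat_truncation u v r
  obtain ⟨N₁, h₁0, h₁⟩ := exists_int_bound_range (fun i n => m (mode V u (r + i) v) n x = 0)
    (fun i => hm _ _) I
  obtain ⟨N₀, h₀⟩ := hm v x
  obtain ⟨N₂, h₂0, h₂⟩ := exists_int_bound_range (fun i n => m u n (m v (q + i) x) = 0)
    (fun i => hm _ _) (N₀ - q).toNat
  obtain ⟨N₃, h₃⟩ := hm u x
  refine ⟨max (N₁ - q + I) (max (N₂ - r + (N₀ - q).toNat) N₃), fun p hp => ?_⟩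
  rw [max_le_iff, max_le_iff] at hp
  unfold modeDefect
  rw [finsum_eq_zero_of_forall_eq_zero fun i => ?_, finsum_eq_zero_of_forall_eq_zero fun i => ?_,
    finsum_eq_zero_of_forall_eq_zero fun i => ?_]
  · simp
  · rw [h₃ (p + i) (by omega), map_zero, smul_zero]
  · by_cases hi : i < (N₀ - q).toNat
    · rw [h₂ i hi (p + r - i) (by omega), smul_zero]
    · rw [h₀ (q + i) (by omega), map_zero, smul_zero]
  · by_cases hi : i < I
    · rw [h₁ i hi (p + q - i) (by omega), smul_zero]
    · simp [hI i (not_lt.mp hi)]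

theorem exists_modeDefect_snd_eq_zero {m : V →ₗ[ℂ] (ℤ → Module.End ℂ D)}
    (hm : ∀ v x, ∃ N : ℤ, ∀ n, N ≤ n → m v n x = 0) (u v : V) (x : D) (p r : ℤ) :
    ∃ N : ℤ, ∀ q, N ≤ q → modeDefect m u v x p q r = 0 := by
  obtain ⟨I, hI⟩ := exists_nat_truncation u v r
  obtain ⟨N₁, h₁0, h₁⟩ := exists_int_bound_range (fun i n => m (mode V u (r + i) v) n x = 0)
    (fun i => hm _ _) I
  obtain ⟨N₀, h₀⟩ := hm u x
  obtain ⟨N₂, h₂0, h₂⟩ := exists_int_bound_range (fun i n => m v n (m u (p + i) x) = 0)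
    (fun i => hm _ _) (N₀ - p).toNat
  obtain ⟨N₃, h₃⟩ := hm v x
  refine ⟨max (N₁ - p + I) (max (N₂ - r + (N₀ - p).toNat) N₃), fun q hq => ?_⟩
  rw [max_le_iff, max_le_iff] at hq
  unfold modeDefect
  rw [finsum_eq_zero_of_forall_eq_zero fun i => ?_, finsum_eq_zero_of_forall_eq_zero fun i => ?_,
    finsum_eq_zero_of_forall_eq_zero fun i => ?_]
  · simp
  · by_cases hi : i < (N₀ - p).toNat
    · rw [h₂ i hi (q + r - i) (by omega), smul_zero]
    · rw [h₀ (p + i) (by omega), map_zero, smul_zero]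
  · rw [h₃ (q + i) (by omega), map_zero, smul_zero]
  · by_cases hi : i < I
    · rw [h₁ i hi (p + q - i) (by omega), smul_zero]
    · simp [hI i (not_lt.mp hi)]

/-- Let `o` be modes on `M` which satisfy the opposite Jacobi identity, and let `D` be a space of
functionals on `M` with modes `m v n` on `D`, truncated from above, which agree with the transposes
of the modes `o` after multiplication by large powers of `x + ε` with `ε ≠ 0`. Then the modes `m`
satisfy the Jacobi identity: it holds after multiplication by powers of `x₁ + ε` and `x₂ + ε`, and
these can be cancelled. -/
theorem modeDefect_eq_zero_of_localization {M : Type*} [AddCommGroup M] [Module ℂ M]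
    (j : D →ₗ[ℂ] Module.Dual ℂ M) (hj : Function.Injective j)
    {o : ℤ → V →ₗ[ℂ] Module.End ℂ M} (ho : ∀ v w, ∃ N : ℤ, ∀ n ≤ N, o n v w = 0)
    (hJ : ∀ u v w p q r, oppositeDefect o u v w p q r = 0)
    {m : V →ₗ[ℂ] (ℤ → Module.End ℂ D)} (hm : ∀ v x, ∃ N : ℤ, ∀ n, N ≤ n → m v n x = 0)
    {ε : ℂ} (hε : ε ≠ 0)
    (h₁ : ∀ v x, ∃ c : ℕ, ∀ w, (shiftAdd ℂ ε ^ c) (fun n => j (m v n x) w)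
      = (shiftAdd ℂ ε ^ c) (fun n => j x (o n v w)))
    (h₂ : ∀ u v x, ∃ c : ℕ, ∀ w,
      (shiftAdd (ℤ → ℂ) ε ^ c) ((shiftSnd ℂ ε ^ c) fun p q => j (m u p (m v q x)) w)
        = (shiftAdd (ℤ → ℂ) ε ^ c) ((shiftSnd ℂ ε ^ c) fun p q => j x (o q v (o p u w))))
    (h₃ : ∀ u v x, ∃ c : ℕ, ∀ w,
      (shiftAdd (ℤ → ℂ) ε ^ c) ((shiftSnd ℂ ε ^ c) fun p q => j (m v q (m u p x)) w)
        = (shiftAdd (ℤ → ℂ) ε ^ c) ((shiftSnd ℂ ε ^ c) fun p q => j x (o p u (o q v w))))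
    (u v : V) (x : D) (p q r : ℤ) : modeDefect m u v x p q r = 0 := by
  apply hj
  rw [map_zero]
  ext w
  obtain ⟨I, hI⟩ := exists_nat_truncation u v r
  obtain ⟨c₁, hc₁⟩ := exists_bound_range (fun i c => ∀ w,
      (shiftAdd ℂ ε ^ c) (fun n => j (m (mode V u (r + i) v) n x) w)
        = (shiftAdd ℂ ε ^ c) (fun n => j x (o n (mode V u (r + i) v) w)))
    (fun i => by
      obtain ⟨c, hc⟩ := h₁ (mode V u (r + i) v) x
      exact ⟨c, fun t ht w => shiftAdd_pow_eq_of_le ht (hc w)⟩) I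
  obtain ⟨c₂, hc₂⟩ := h₂ u v x
  obtain ⟨c₃, hc₃⟩ := h₃ u v x
  set c := max c₁ (max c₂ c₃) with hc
  have k₁ : ∀ i < I, (shiftAdd ℂ ε ^ c) (fun n => j (m (mode V u (r + i) v) n x) w
      - j x (o n (mode V u (r + i) v) w)) = 0 := fun i hi => by
    have := hc₁ i hi c (le_max_left _ _) w
    rw [← sub_eq_zero, ← map_sub] at this
    exact this
  have k₂ := shift_pow_pow_eq_of_le (le_trans (le_max_left c₂ c₃) (le_max_right c₁ _)) (hc₂ w)
  have k₃ := shift_pow_pow_eq_of_le (le_trans (le_max_right c₂ c₃) (le_max_right c₁ _)) (hc₃ w)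
  rw [← hc, ← sub_eq_zero, ← map_sub, ← map_sub] at k₂ k₃
  -- the three sums of the Jacobi identity, as functions of `p` and `q`
  set A : ℤ → ℤ → ℂ := fun p q => j (m u p (m v q x)) w with hA
  set A' : ℤ → ℤ → ℂ := fun p q => j x (o q v (o p u w)) with hA'
  set B : ℤ → ℤ → ℂ := fun p q => j (m v q (m u p x)) w with hB
  set B' : ℤ → ℤ → ℂ := fun p q => j x (o p u (o q v w)) with hB'
  set C : ℤ → ℤ → ℂ := fun p q => ∑ i ∈ Finset.range I, Ring.choose p i •
    (j (m (mode V u (r + i) v) (p + q - i) x) w - j x (o (p + q - i) (mode V u (r + i) v) w))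
    with hC
  obtain ⟨Nv, hNv⟩ := hm v x
  obtain ⟨Nu, hNu⟩ := hm u x
  obtain ⟨Lv, hLv⟩ := ho v w
  obtain ⟨Lu, hLu⟩ := ho u w
  have dA : DiagFinite (-1) A := fun p q => ⟨(Nv - q).toNat, fun i hi => by
    rw [hA]; dsimp only
    rw [hNv _ (by omega), map_zero, map_zero, LinearMap.zero_apply]⟩
  have dA' : DiagFinite (-1) A' := fun p q => ⟨(p - Lu).toNat, fun i hi => by
    rw [hA']; dsimp only
    rw [hLu _ (by omega), map_zero, map_zero]⟩
  have dB : DiagFinite 1 B := fun p q => ⟨(Nu - p).toNat, fun i hi => by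
    rw [hB]; dsimp only
    rw [hNu _ (by omega), map_zero, map_zero, LinearMap.zero_apply]⟩
  have dB' : DiagFinite 1 B' := fun p q => ⟨(q - Lv).toNat, fun i hi => by
    rw [hB']; dsimp only
    rw [hLv _ (by omega), map_zero, map_zero]⟩
  set c₁' : ℕ → ℤ := fun i => (-1) ^ i * Ring.choose r i
  set c₂' : ℕ → ℤ := fun i => (r.negOnePow : ℤ) * ((-1) ^ i * Ring.choose r i)
  have hdef : ∀ p q, j (modeDefect m u v x p q r) w
      = C p q - (diagSum c₁' (-1) r 0 (A - A') p q - diagSum c₂' 1 0 r (B - B') p q) := by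
    intro p q
    have e₁ : j (modeDefect m u v x p q r) w
        = ∑ i ∈ Finset.range I, Ring.choose p i • j (m (mode V u (r + i) v) (p + q - i) x) w
          - (diagSum c₁' (-1) r 0 A p q - diagSum c₂' 1 0 r B p q) := by
      let f : D →ₗ[ℂ] ℂ := (LinearMap.applyₗ w) ∘ₗ j
      change f (modeDefect m u v x p q r) = _
      rw [modeDefect, map_sub, map_sub, finsum_eq_sum_range _ I fun i hi => by simp [hI i hi],
        map_sum, map_finsum f (finite_support_of_eventually_zero _ (Nv - q).toNat fun i hi => by
          rw [hNv _ (by omega), map_zero, smul_zero]),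
        map_finsum f (finite_support_of_eventually_zero _ (Nu - p).toNat fun i hi => by
          rw [hNu _ (by omega), map_zero, smul_zero])]
      simp only [map_zsmul, diagSum]
      congr 2
      · refine finsum_congr fun i => ?_
        rw [show p + r + -1 * (i : ℤ) = p + r - i by ring,
          show q + 0 - -1 * (i : ℤ) = q + i by ring]
        rfl
      · refine finsum_congr fun i => ?_
        rw [show p + 0 + 1 * (i : ℤ) = p + i by ring,
          show q + r - 1 * (i : ℤ) = q + r - i by ring]
        rfl
    have e₂ : j x (oppositeDefect o u v w p q r)
        = ∑ i ∈ Finset.range I, Ring.choose p i • j x (o (p + q - i) (mode V u (r + i) v) w)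
          - (diagSum c₁' (-1) r 0 A' p q - diagSum c₂' 1 0 r B' p q) := by
      rw [oppositeDefect, map_sub, map_sub, finsum_eq_sum_range _ I fun i hi => by simp [hI i hi],
        map_sum, map_finsum (j x) (finite_support_of_eventually_zero _ (p + r - Lu).toNat
          fun i hi => by rw [hLu _ (by omega), map_zero, smul_zero]),
        map_finsum (j x) (finite_support_of_eventually_zero _ (q + r - Lv).toNat
          fun i hi => by rw [hLv _ (by omega), map_zero, smul_zero])]
      simp only [map_zsmul, diagSum]
      congr 2
      · refine finsum_congr fun i => ?_
        rw [show p + r + -1 * (i : ℤ) = p + r - i by ring,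
          show q + 0 - -1 * (i : ℤ) = q + i by ring]
      · refine finsum_congr fun i => ?_
        rw [show p + 0 + 1 * (i : ℤ) = p + i by ring,
          show q + r - 1 * (i : ℤ) = q + r - i by ring]
    rw [hJ, map_zero] at e₂
    rw [diagSum_sub dA dA', diagSum_sub dB dB', e₁, ← sub_zero (_ - _), e₂, hC]
    simp only [smul_sub, Finset.sum_sub_distrib]
    ring
  -- the first sum only involves `p + q`, so powers of `x₂ + ε` suffice to annihilate it
  have hCzero : (shiftSnd ℂ ε ^ c) C = 0 := by
    funext p
    rw [shiftSnd_pow_apply]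
    have : C p = ∑ i ∈ Finset.range I, Ring.choose p i • fun q =>
        (fun n => j (m (mode V u (r + i) v) n x) w - j x (o n (mode V u (r + i) v) w))
          (p + q - i) := by
      funext q
      simp [hC]
    rw [this, map_sum]
    refine Finset.sum_eq_zero fun i hi => ?_
    have hsh : ∀ (h : ℤ → ℂ) (d : ℤ), (shiftAdd ℂ ε ^ c) (fun q => h (p + q - d))
        = fun q => (shiftAdd ℂ ε ^ c) h (p + q - d) := by
      intro h d
      generalize c = c
      induction c generalizing h with
      | zero => rfl
      | succ c ih =>
        rw [pow_succ, Module.End.mul_apply, Module.End.mul_apply, ← ih]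
        congr 1
        funext q
        rw [shiftAdd_apply, shiftAdd_apply, show p + (q + 1) - d = p + q - d + 1 by ring]
    rw [map_zsmul]
    refine (congrArg _ (hsh (fun n => j (m (mode V u (r + i) v) n x) w
      - j x (o n (mode V u (r + i) v) w)) i)).trans ?_
    rw [k₁ i (Finset.mem_range.mp hi)]
    funext q
    simp
  have hzero : (shiftAdd (ℤ → ℂ) ε ^ c) ((shiftSnd ℂ ε ^ c)
      fun p q => j (modeDefect m u v x p q r) w) = 0 := by
    have : (fun p q => j (modeDefect m u v x p q r) w)
        = C - (diagSum c₁' (-1) r 0 (A - A') - diagSum c₂' 1 0 r (B - B')) := by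
      funext p q
      exact hdef p q
    rw [this, map_sub, map_sub, map_sub, map_sub, hCzero,
      ← diagSum_shift_pow_pow (dA.sub dA'), ← diagSum_shift_pow_pow (dB.sub dB'), k₂, k₃]
    have hz : ∀ (c : ℕ → ℤ) (s a b : ℤ), diagSum c s a b (0 : ℤ → ℤ → ℂ) = 0 := by
      intro c s a b
      funext p q
      simp [diagSum]
    rw [hz, hz]
    simp
  refine eq_zero_of_shift_pow_pow hε hε c c (fun q => ?_) (fun p => ?_)
    (fun p q _ _ => congrFun (congrFun hzero p) q) p q (le_refl p) (le_refl q)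
  · obtain ⟨N, hN⟩ := exists_modeDefect_fst_eq_zero hm u v x q r
    exact ⟨N, fun p hp => by rw [hN p hp, map_zero, LinearMap.zero_apply]⟩
  · obtain ⟨N, hN⟩ := exists_modeDefect_snd_eq_zero hm u v x p r
    exact ⟨N, fun q hq => by rw [hN q hq, map_zero, LinearMap.zero_apply]⟩

end Localization

/-! ### Conjugation of opposite vertex operators by `e^(-L(1))` -/

section Translation

variable {V W : Type*} [AddCommGroup V] [Module ℂ V] [VertexOperatorAlgebra V]
  [AddCommGroup W] [Module ℂ W] [WeakModule V W]

/-- There are no weights outside of `h + ℕ`: eigenspaces are independent. -/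
theorem weightSpace_eq_bot {h c : ℂ}
    (hW : DirectSum.IsInternal (fun n : ℕ => weightSpace V W (h + n)))
    (hc : ∀ n : ℕ, c ≠ h + n) : weightSpace V W c = ⊥ := by
  have h1 := Module.End.eigenspaces_iSupIndep (vir V W 0) c
  have h2 : (⊤ : Submodule ℂ W) ≤ ⨆ j, ⨆ (_ : j ≠ c), Module.End.eigenspace (vir V W 0) j := by
    rw [← hW.submodule_iSup_eq_top]
    exact iSup_le fun n => le_iSup₂_of_le (h + n) (fun h => hc n h.symm) le_rfl
  rw [top_le_iff.mp h2] at h1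
  exact disjoint_top.mp h1

theorem vir_one_mem_weightSpace {c : ℂ} {w : W} (hw : w ∈ weightSpace V W c) :
    vir V W 1 w ∈ weightSpace V W (c - 1) := by
  have := mode_mem_weightSpace (conf_mem (V := V)) hw 2
  have h2 : c + ((2 : ℤ) : ℂ) - ((2 : ℤ) : ℂ) - 1 = c - 1 := by ring
  rw [h2] at this
  exact this

/-- `L(1)` lowers weights, which are bounded below, so `e^(-L(1))` makes sense on `W`. -/
theorem IsLowestWeight.exists_vir_one_pow_eq_zero (hW : IsLowestWeight V W) (w : W) :
    ∃ N : ℕ, ∀ i : ℕ, N ≤ i → (vir V W 1 ^ i) w = 0 := by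
  obtain ⟨h, hint, -⟩ := hW
  have hw : w ∈ ⨆ n : ℕ, weightSpace V W (h + n) := by
    rw [hint.submodule_iSup_eq_top]
    trivial
  induction hw using Submodule.iSup_induction' with
  | mem n w hw =>
    have hpow : ∀ i : ℕ, (vir V W 1 ^ i) w ∈ weightSpace V W (h + n - i) := by
      intro i
      induction i with
      | zero => simpa using hw
      | succ i ih =>
        rw [pow_succ', show h + n - ((i + 1 : ℕ) : ℂ) = h + n - i - 1 by push_cast; ring]
        exact vir_one_mem_weightSpace ih
    refine ⟨n + 1, fun i hi => ?_⟩
    have h1 := hpow i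
    rw [weightSpace_eq_bot hint fun m hm => ?_] at h1
    · simpa using h1
    · have : ((n : ℤ) : ℂ) - (i : ℤ) = (m : ℤ) := by
        push_cast
        linear_combination hm
      have h2 : (n : ℤ) - i = m := by exact_mod_cast this
      omega
  | zero => exact ⟨0, by simp⟩
  | add x y _ _ hx hy =>
    obtain ⟨N, hN⟩ := hx
    obtain ⟨N', hN'⟩ := hy
    exact ⟨max N N', fun i hi => by
      rw [map_add, hN i (le_trans (le_max_left _ _) hi), hN' i (le_trans (le_max_right _ _) hi),
        add_zero]⟩

variable (V W) in
/-- The divided power `L(1)^j / j!` on a weak module. -/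
def virOnePow (j : ℕ) : Module.End ℂ W := ((j.factorial : ℂ)⁻¹) • vir V W 1 ^ j

theorem vir_one_virOnePow (i : ℕ) (w : W) :
    vir V W 1 (virOnePow V W i w) = ((i + 1 : ℕ) : ℤ) • virOnePow V W (i + 1) w := by
  simp only [virOnePow, LinearMap.smul_apply, map_smul, ← Int.cast_smul_eq_zsmul ℂ, smul_smul,
    pow_succ' _ i, Module.End.mul_apply, Nat.factorial_succ]
  congr 1
  have : ((i : ℂ) + 1) ≠ 0 := by exact_mod_cast Nat.succ_ne_zero i
  push_cast
  field_simp

theorem virOnePow_vir_one (i : ℕ) (w : W) :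
    virOnePow V W i (vir V W 1 w) = ((i + 1 : ℕ) : ℤ) • virOnePow V W (i + 1) w := by
  rw [← vir_one_virOnePow, virOnePow, LinearMap.smul_apply, LinearMap.smul_apply, map_smul,
    ← Module.End.mul_apply, ← Module.End.mul_apply, ← pow_succ, ← pow_succ']

/-- The homogeneous components of `Y°(v, x) e^(L(1)) = e^(L(1)) Y°(v, x + 1)`, by iterating
`opposite_vir_one`. -/
theorem opposite_virOnePow (v : V) (q : ℤ) (j : ℕ) (w : W) :
    oppositeMode V W q v (virOnePow V W j w) = ∑ x ∈ antidiagonal j,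
      ((-1) ^ x.1 * Ring.choose q x.1) • virOnePow V W x.2 (oppositeMode V W (q - x.1) v w) := by
  induction j generalizing w with
  | zero => simp [virOnePow]
  | succ j ih =>
    have hN : (((j + 1 : ℕ) : ℤ) : ℂ) ≠ 0 := by exact_mod_cast Nat.succ_ne_zero j
    refine (smul_right_injective W hN) ?_
    simp only [Int.cast_smul_eq_zsmul]
    rw [← map_zsmul, ← virOnePow_vir_one, ih]
    set f : ℕ → ℕ → W := fun a b => ((-1) ^ a * Ring.choose q a) •
      virOnePow V W b (oppositeMode V W (q - a) v w) with hf
    have h1 : ((j + 1 : ℕ) : ℤ) • ∑ x ∈ antidiagonal (j + 1), f x.1 x.2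
        = ∑ x ∈ antidiagonal (j + 1), (x.1 : ℤ) • f x.1 x.2
          + ∑ x ∈ antidiagonal (j + 1), (x.2 : ℤ) • f x.1 x.2 := by
      rw [← Finset.sum_add_distrib, Finset.smul_sum]
      refine Finset.sum_congr rfl fun x hx => ?_
      rw [← add_smul, ← mem_antidiagonal.mp hx]
      push_cast
      rfl
    rw [h1, sum_antidiagonal_fst_smul, sum_antidiagonal_snd_smul, ← Finset.sum_add_distrib]
    refine Finset.sum_congr rfl fun x _ => ?_
    rw [opposite_vir_one, map_sub, virOnePow_vir_one, map_zsmul, smul_sub, hf]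
    dsimp only
    rw [smul_smul, smul_smul, smul_smul, smul_smul, sub_eq_add_neg, add_comm, ← neg_smul]
    have h2 := sub_mul_choose q x.1
    congr 1
    · rw [show q - ((x.1 + 1 : ℕ) : ℤ) = q - x.1 - 1 by push_cast; ring]
      congr 1
      push_cast
      rw [pow_succ]
      linear_combination (-(-1) ^ x.1) * h2
    · rw [mul_comm]

variable (V W) in
/-- The operator `e^(-L(1))` (for `L(1)` locally nilpotent). -/
def expNegVirOne (w : W) : W := ∑ᶠ j : ℕ, (-1 : ℤ) ^ j • virOnePow V W j w

theorem exists_virOnePow_eq_zero (hW : IsLowestWeight V W) (w : W) :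
    ∃ N : ℕ, ∀ i : ℕ, N ≤ i → virOnePow V W i w = 0 := by
  obtain ⟨N, hN⟩ := hW.exists_vir_one_pow_eq_zero w
  exact ⟨N, fun i hi => by rw [virOnePow, LinearMap.smul_apply, hN i hi, smul_zero]⟩

/-- `e^(-L(1))` is injective: for `w ≠ 0` apply `L(1)^n`, where `n` is the largest exponent with
`L(1)^n w ≠ 0`; only the term `L(1)^n w` survives. -/
theorem expNegVirOne_eq_zero (hW : IsLowestWeight V W) {w : W} (hw : expNegVirOne V W w = 0) :
    w = 0 := by
  by_contra h0
  obtain ⟨N, hN⟩ := hW.exists_vir_one_pow_eq_zero w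
  classical
  have hex : ∃ n, (vir V W 1 ^ n) w = 0 := ⟨N, hN N le_rfl⟩
  have hpos : Nat.find hex ≠ 0 := fun h => h0 (by simpa [h] using Nat.find_spec hex)
  obtain ⟨n, hn⟩ := Nat.exists_eq_succ_of_ne_zero hpos
  have hne : (vir V W 1 ^ n) w ≠ 0 := Nat.find_min hex (by omega)
  have hz : ∀ i, n + 1 ≤ i → (vir V W 1 ^ i) w = 0 := fun i hi => by
    have hs := Nat.find_spec hex
    rw [hn] at hs
    rw [← Nat.sub_add_cancel hi, pow_add, Module.End.mul_apply, hs, map_zero]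
  apply hne
  have h1 := congrArg (vir V W 1 ^ n) hw
  rw [map_zero, expNegVirOne, finsum_eq_sum_range _ (n + 1) fun i hi => by
    rw [virOnePow, LinearMap.smul_apply, hz i hi, smul_zero, smul_zero], map_sum,
    Finset.sum_eq_single_of_mem 0 (by simp) fun i _ hi => ?_] at h1
  · simpa [virOnePow] using h1
  · rw [map_zsmul, virOnePow, LinearMap.smul_apply, map_smul, ← Module.End.mul_apply, ← pow_add,
      hz _ (by omega), smul_zero, smul_zero]

theorem expNegVirOne_map (hW : IsLowestWeight V W) :
    ∃ e : Module.End ℂ W, ∀ w, e w = expNegVirOne V W w := by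
  refine ⟨⟨⟨expNegVirOne V W, fun x y => ?_⟩, fun c x => ?_⟩, fun _ => rfl⟩
  · obtain ⟨N, hN⟩ := exists_virOnePow_eq_zero hW x
    obtain ⟨N', hN'⟩ := exists_virOnePow_eq_zero hW y
    simp only [expNegVirOne, map_add, smul_add]
    exact finsum_add_distrib
      (finite_support_of_eventually_zero _ N fun i hi => by rw [hN i hi, smul_zero])
      (finite_support_of_eventually_zero _ N' fun i hi => by rw [hN' i hi, smul_zero])
  · simp only [expNegVirOne, map_smul, RingHom.id_apply, smul_finsum, smul_comm c]

/-- `Y°(v, x) e^(-L(1)) = e^(-L(1)) Y°(v, x - 1)`, in terms of test functions: `x^q` is replaced by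
`(1 + x)^q`. -/
theorem opposite_expNegVirOne (hW : IsLowestWeight V W) (v : V) (q : ℤ) (w : W) :
    oppositeMode V W q v (expNegVirOne V W w) = expNegVirOne V W (oppositeTest V W 0 q v w) := by
  obtain ⟨e, he⟩ := expNegVirOne_map hW
  obtain ⟨I, hI⟩ := exists_nat_opposite_truncation v w q
  obtain ⟨J, hJ⟩ := exists_bound_range
    (fun i j => virOnePow V W j (oppositeMode V W (q - i) v w) = 0)
    (fun i => exists_virOnePow_eq_zero hW _) I
  obtain ⟨N, hN⟩ := exists_virOnePow_eq_zero hW w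
  have hI' : ∀ i j, I ≤ i → (-1 : ℤ) ^ j • Ring.choose q i •
      virOnePow V W j (oppositeMode V W (q - i) v w) = 0 := fun i j hi => by
    rw [hI i hi, map_zero, smul_zero, smul_zero]
  have hJ' : ∀ i j, J ≤ j → (-1 : ℤ) ^ j • Ring.choose q i •
      virOnePow V W j (oppositeMode V W (q - i) v w) = 0 := fun i j hj => by
    by_cases h : i < I
    · rw [hJ i h j hj, smul_zero, smul_zero]
    · exact hI' i j (not_lt.mp h)
  rw [← he (oppositeTest V W 0 q v w), oppositeTest_apply,
    finsum_eq_sum_range _ I fun i hi => by rw [zero_add, hI i hi, smul_zero], map_sum,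
    expNegVirOne, finsum_eq_sum_range _ (I + J + N) fun i hi => by
      rw [hN i (by omega), smul_zero], map_sum]
  have h2 : ∀ i ∈ Finset.range I, e (Ring.choose q i • oppositeMode V W (0 + q - i) v w)
      = ∑ j ∈ Finset.range J, (-1 : ℤ) ^ j • Ring.choose q i •
          virOnePow V W j (oppositeMode V W (q - i) v w) := fun i hi => by
    rw [map_zsmul, he, expNegVirOne, zero_add, finsum_eq_sum_range _ J fun j hj => by
      rw [hJ i (Finset.mem_range.mp hi) j hj, smul_zero], Finset.smul_sum]
    exact Finset.sum_congr rfl fun j _ => smul_comm _ _ _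
  rw [Finset.sum_congr rfl h2, ← sum_range_sum_antidiagonal _ hI' hJ' (Nat.le_add_right _ N)]
  refine Finset.sum_congr rfl fun m _ => ?_
  rw [map_zsmul, opposite_virOnePow, Finset.smul_sum]
  refine Finset.sum_congr rfl fun x hx => ?_
  rw [smul_smul, smul_smul, ← mem_antidiagonal.mp hx, pow_add, ← mul_assoc]
  congr 1
  have : (-1 : ℤ) ^ x.1 * (-1) ^ x.1 = 1 := by rw [← mul_pow]; simp
  linear_combination ((-1) ^ x.2 * Ring.choose q x.1) * this

/-- The modes `Res (1+x)^q Y°(v, x)` of `Y°(v, x - 1)` also satisfy the opposite Jacobi identity: by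
`opposite_expNegVirOne` they are conjugate to the modes of `Y°(v, x)` under the injective
`e^(-L(1))`. -/
theorem oppositeTest_jacobi (hW : IsLowestWeight V W) (u v : V) (w : W) (p q r : ℤ) :
    oppositeDefect (oppositeTest V W 0) u v w p q r = 0 := by
  obtain ⟨e, he⟩ := expNegVirOne_map hW
  apply expNegVirOne_eq_zero hW
  have ho : ∀ (v : V) (w : W), ∃ N : ℤ, ∀ n ≤ N, oppositeTest V W 0 n v w = 0 := fun v w => by
    obtain ⟨N, hN⟩ := oppositeTest_truncation v w
    exact ⟨N, fun n hn => hN 0 n (by omega)⟩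
  obtain ⟨f₁, f₂, f₃⟩ := oppositeDefect_finite ho u v w p q r
  have he' : ∀ (q : ℤ) (v : V) (w : W),
      e (oppositeTest V W 0 q v w) = oppositeMode V W q v (e w) := fun q v w => by
    rw [he, he, opposite_expNegVirOne hW]
  rw [← opposite_jacobi u v (e w) p q r, ← he, oppositeDefect, map_sub, map_sub,
    map_finsum e f₁, map_finsum e f₂, map_finsum e f₃]
  simp only [map_zsmul, he']
  rfl

end Translation

/-! ### Series, rational functions and expansions -/

section Series

open Polynomial

variable {F : Type*} [Field F]

theorem polyMul_X_pow (l : ℕ) (s : ℤ → F) (n : ℤ) : polyMul (X ^ l) s n = s (n - l) := by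
  induction l generalizing n with
  | zero => simp [polyMul]
  | succ l ih =>
    rw [pow_succ', polyMul_mul]
    have : polyMul (X : F[X]) (polyMul (X ^ l) s) n = polyMul (X ^ l) s (n - 1) := by
      simp [polyMul, seriesMulX]
    rw [this, ih]
    congr 1
    push_cast
    ring

theorem polyMul_sub_C (z : F) (s : ℤ → F) (n : ℤ) :
    polyMul (X - C z) s n = s (n - 1) - z * s n := by
  simp [polyMul, seriesMulX, Module.algebraMap_end_apply]

theorem polyMul_sub_C_pow (z : ℂ) (k : ℕ) (s : ℤ → ℂ) (n : ℤ) :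
    polyMul ((X - C z) ^ k) s (-n - 1) = (shiftAdd ℂ (-z) ^ k) (fun n => s (-n - 1)) n := by
  induction k generalizing s n with
  | zero => simp [polyMul]
  | succ k ih =>
    rw [pow_succ, polyMul_mul, ih, pow_succ, Module.End.mul_apply]
    refine congrFun (congrArg _ (funext fun n => ?_)) n
    rw [polyMul_sub_C, shiftAdd_apply, smul_eq_mul, show -n - 1 - 1 = -(n + 1) - 1 by ring]
    ring

theorem polyMul_iotaZeroCoeff (P : F[X]) (f : RatFunc F) :
    polyMul P (iotaZeroCoeff f) = iotaZeroCoeff (algebraMap F[X] (RatFunc F) P * f) := by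
  induction P using Polynomial.induction_on' with
  | add p q hp hq =>
    funext n
    rw [map_add, add_mul, iotaZeroCoeff_add, ← hp, ← hq]
    simp [polyMul]
  | monomial n a =>
    induction n with
    | zero =>
      funext n
      rw [Polynomial.monomial_zero_left, iotaZeroCoeff_C_mul]
      simp [polyMul, Module.algebraMap_end_apply]
    | succ n ih =>
      rw [← Polynomial.monomial_mul_X, mul_comm (monomial n a) X, map_mul, mul_assoc, polyMul_mul,
        ih]
      funext m
      generalize algebraMap F[X] (RatFunc F) (monomial n a) * f = g
      have h1 : polyMul X (iotaZeroCoeff g) m = iotaZeroCoeff g (m - 1) := by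
        simp [polyMul, seriesMulX]
      rw [h1, RatFunc.algebraMap_X, iotaZeroCoeff, iotaZeroCoeff, map_mul, RatFunc.coe_X]
      rw [HahnSeries.coeff_single_mul, one_mul]

theorem iotaZeroCoeff_algebraMap (g : F[X]) :
    iotaZeroCoeff (algebraMap F[X] (RatFunc F) g) = polySeries g := by
  have h1 : iotaZeroCoeff (1 : RatFunc F) = polySeries 1 := by
    funext n
    rw [iotaZeroCoeff, map_one, polySeries, HahnSeries.coeff_one]
    split_ifs with h0 h1 h1
    · subst h0; simp
    · omega
    · rw [coeff_one, if_neg (by omega)]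
    · rfl
  rw [← mul_one (algebraMap F[X] (RatFunc F) g), ← polyMul_iotaZeroCoeff, h1, ← polySeries_mul,
    mul_one]

theorem exists_iotaZeroCoeff_eq_zero (f : RatFunc F) :
    ∃ N : ℤ, ∀ n < N, iotaZeroCoeff f n = 0 := by
  refine ⟨(f : LaurentSeries F).order, fun n hn => ?_⟩
  exact HahnSeries.coeff_eq_zero_of_lt_order hn

theorem coeff_comp_X_sub_one (g : F[X]) (j : ℕ) :
    (g.comp (X - C 1)).coeff j
      = ∑ i ∈ g.support, g.coeff i * ((-1) ^ (i - j) * (i.choose j : F)) := by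
  have : g.comp (X - C 1) = taylor (-1) g := by
    rw [taylor_apply, map_neg, sub_eq_add_neg]
  rw [this, taylor_coeff, hasseDeriv_apply, sum_def, eval_finsetSum]
  refine Finset.sum_congr rfl fun i _ => ?_
  rw [eval_monomial]
  ring

end Series

/-! ### The regular functionals and their two actions -/

section Regular

open Polynomial

variable {V M : Type*} [AddCommGroup V] [Module ℂ V] [VertexOperatorAlgebra V]
  [AddCommGroup M] [Module ℂ M] [WeakModule V M]

/-- Multiplying the series of modes by `x + 1` multiplies the test functions by `1 + x`. -/
theorem shiftAdd_one_pow_oppositeTest (a : ℕ) (r : ℤ) (v : V) :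
    (shiftAdd (Module.End ℂ M) 1 ^ a) (fun n => oppositeTest V M n r v)
      = fun n => oppositeTest V M n (r + a) v := by
  induction a with
  | zero => simp
  | succ a ih =>
    rw [pow_succ', Module.End.mul_apply, ih]
    funext n
    rw [shiftAdd_apply, one_smul, add_comm, ← LinearMap.add_apply, ← oppositeTest_succ]
    push_cast
    rw [add_assoc]

/-- In the variable `y = x + 1` of the expansion at `-1`, multiplying by `y - 1` multiplies the test
functions by `x`. -/
theorem shiftAdd_neg_one_pow_oppositeTest (b : ℕ) (p : ℤ) (v : V) :
    (shiftAdd (Module.End ℂ M) (-1) ^ b) (fun n => oppositeTest V M p n v)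
      = fun n => oppositeTest V M (p + b) n v := by
  induction b with
  | zero => simp
  | succ b ih =>
    rw [pow_succ', Module.End.mul_apply, ih]
    funext n
    rw [shiftAdd_apply, oppositeTest_succ, LinearMap.add_apply, neg_one_smul]
    push_cast
    rw [← add_assoc, add_neg_cancel_comm]

/-- `x^p (1+x)^(s+r)` expanded in the functions `x^n (1+x)^r`. -/
theorem oppositeTest_add (p s r : ℤ) (v : V) (w : M) :
    oppositeTest V M p (s + r) v w
      = ∑ᶠ t : ℕ, Ring.choose s t • oppositeTest V M (p + s - t) r v w := by
  obtain ⟨T, hT⟩ := exists_nat_opposite_truncation v w (p + (s + r))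
  rw [oppositeTest_apply, finsum_eq_sum_range _ T fun i hi => by rw [hT i hi, smul_zero]]
  simp only [Ring.add_choose_eq _ (Commute.all s r)]
  rw [← sum_range_sum_range_add (fun a b => Ring.choose s a * Ring.choose r b)
    (fun t : ℕ => oppositeMode V M (p + (s + r) - t) v w) T hT,
    finsum_eq_sum_range _ T fun t ht => ?_]
  · refine Finset.sum_congr rfl fun t _ => ?_
    rw [oppositeTest_apply, finsum_eq_sum_range _ T fun i hi => ?_, Finset.smul_sum]
    · refine Finset.sum_congr rfl fun i _ => ?_
      rw [smul_smul, show p + (s + r) - ((t + i : ℕ) : ℤ) = p + s - t + r - i by push_cast; ring]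
    · rw [show p + s - (t : ℤ) + r - i = p + (s + r) - ((t + i : ℕ) : ℤ) by push_cast; ring,
        hT _ (by omega), smul_zero]
  · rw [oppositeTest_apply, finsum_eq_zero_of_forall_eq_zero fun i => ?_, smul_zero]
    rw [show p + s - (t : ℤ) + r - i = p + (s + r) - ((t + i : ℕ) : ℤ) by push_cast; ring,
        hT _ (by omega), smul_zero]

variable (M) in
/-- The functionals `α` for which `x^l (1+x)^k ⟨α, Y°(v, x)w⟩` is a polynomial for all `w`. -/
def killSpace (v : V) (k l : ℤ) : Submodule ℂ (Module.Dual ℂ M) where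
  carrier := {α | ∀ p r : ℤ, l ≤ p → k ≤ r → ∀ w, α (oppositeTest V M p r v w) = 0}
  zero_mem' := by simp
  add_mem' ha hb p r hp hr w := by
    rw [LinearMap.add_apply, ha p r hp hr w, hb p r hp hr w, add_zero]
  smul_mem' c a ha p r hp hr w := by rw [LinearMap.smul_apply, ha p r hp hr w, smul_zero]

theorem killSpace_mono {v : V} {k l k' l' : ℤ} (hk : k ≤ k') (hl : l ≤ l') :
    killSpace M v k l ≤ killSpace M v k' l' :=
  fun _ hα p r hp hr w => hα p r (hl.trans hp) (hk.trans hr) w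

/-- The coefficients of `x^l (1+x)^k ⟨α, Y°(v, x)w⟩`. -/
theorem polyMul_oppositeSeries (α : Module.Dual ℂ M) (v : V) (w : M) (k l : ℕ) (n : ℤ) :
    polyMul (X ^ l * (X - C (-1)) ^ k) (oppositeSeries V α v w) (-n - 1)
      = α (oppositeTest V M (n + l) k v w) := by
  rw [polyMul_mul, polyMul_X_pow, show -n - 1 - (l : ℤ) = -(n + l) - 1 by ring, polyMul_sub_C_pow,
    neg_neg]
  let f : Module.End ℂ M →ₗ[ℂ] ℂ := α ∘ₗ LinearMap.applyₗ w
  have h1 : (fun n : ℤ => oppositeSeries V α v w (-n - 1))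
      = fun n => f (oppositeTest V M n 0 v) := by
    funext n
    rw [oppositeTest_zero]
    simp [oppositeSeries, f]
  rw [h1, shiftAdd_pow_map, shiftAdd_one_pow_oppositeTest, zero_add]
  rfl

theorem exists_polySeries {t : ℤ → ℂ} (h0 : ∀ n < 0, t n = 0) (h1 : ∃ N, ∀ n, N ≤ n → t n = 0) :
    ∃ g : ℂ[X], t = polySeries g := by
  obtain ⟨N, hN⟩ := h1
  refine ⟨∑ i ∈ Finset.range N.toNat, monomial i (t i), ?_⟩
  funext n
  rw [polySeries]
  split_ifs with hn
  · lift n to ℕ using hn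
    rw [finsetSum_coeff, Int.toNat_natCast]
    simp only [coeff_monomial]
    rw [Finset.sum_ite_eq']
    split_ifs with h
    · rfl
    · exact hN n (by simp at h; omega)
  · exact h0 n (by omega)

theorem polySeries_of_mem_killSpace {α : Module.Dual ℂ M} {v : V} {k l : ℕ}
    (h : α ∈ killSpace M v k l) (w : M) : ∃ g : ℂ[X],
      polyMul (X ^ l * (X - C (-1)) ^ k) (oppositeSeries V α v w) = polySeries g := by
  refine exists_polySeries (fun n hn => ?_) ?_
  · have := polyMul_oppositeSeries α v w k l (-n - 1)
    rw [neg_sub, sub_neg_eq_add, add_sub_cancel_left] at this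
    rw [this, h _ _ (by omega) le_rfl]
  · obtain ⟨N, hN⟩ := oppositeTest_truncation v w
    refine ⟨l + k - N, fun n hn => ?_⟩
    have := polyMul_oppositeSeries α v w k l (-n - 1)
    rw [neg_sub, sub_neg_eq_add, add_sub_cancel_left] at this
    rw [this, hN _ _ (by omega), map_zero]

/-- `x^l (1+x)^k ⟨α, Y°(v, x)w⟩` is always bounded above in `x`, so it is a polynomial as soon as it
has no negative powers of `x`. -/
theorem mem_regularDual_iff {α : Module.Dual ℂ M} :
    α ∈ regularDual V M (-1) ↔ ∀ v : V, ∃ k l : ℕ, α ∈ killSpace M v k l := by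
  refine forall_congr' fun v => exists_congr fun k => exists_congr fun l =>
    ⟨fun h p r hp hr w => ?_, fun h w => polySeries_of_mem_killSpace h w⟩
  have hbase : ∀ p : ℤ, l ≤ p → ∀ w, α (oppositeTest V M p k v w) = 0 := by
    intro p hp w
    obtain ⟨g, hg⟩ := h w
    have := polyMul_oppositeSeries α v w k l (p - l)
    rw [sub_add_cancel, hg, polySeries, if_neg (by omega)] at this
    exact this.symm
  obtain ⟨d, rfl⟩ : ∃ d : ℕ, r = k + d := ⟨(r - k).toNat, by omega⟩
  induction d generalizing p with
  | zero => simpa using hbase p hp w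
  | succ d ih =>
    rw [show (k : ℤ) + ((d + 1 : ℕ) : ℤ) = k + d + 1 by push_cast; ring, oppositeTest_succ,
      LinearMap.add_apply, LinearMap.add_apply, map_add, ih p hp (by omega),
      ih (p + 1) (by omega) (by omega), add_zero]

/-- `Y^R(v, x)α` is characterized by: it is truncated, and its product with `(1+x)^k` is
`(1+x)^k ⟨α, Y°(v, x)w⟩`, which for large `k` has a pole at `0` only. -/
theorem rightRegular_spec {α : Module.Dual ℂ M} {v : V} {k l : ℕ} (h : α ∈ killSpace M v k l)
    (w : M) : (∀ n : ℤ, l ≤ n → rightRegular V α v n w = 0) ∧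
      (shiftAdd ℂ 1 ^ k) (fun n => rightRegular V α v n w)
        = fun n => α (oppositeTest V M n k v w) := by
  obtain ⟨g, hg⟩ := polySeries_of_mem_killSpace h w
  have hP : (X ^ l * (X - C (-1)) ^ k : ℂ[X]) ≠ 0 :=
    mul_ne_zero (pow_ne_zero _ X_ne_zero) (pow_ne_zero _ (X_sub_C_ne_zero _))
  have hinv := iotaInftyInv_eq hP hg
  have h2 : (shiftAdd ℂ 1 ^ k) (fun n => rightRegular V α v n w)
        = fun n => α (oppositeTest V M n k v w) := by
    funext n
    have h1 := congrFun (polyMul_iotaZeroCoeff (X ^ l * (X - C (-1)) ^ k)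
      (iotaInftyInv (oppositeSeries V α v w))) (-(n - l) - 1)
    rw [hinv, mul_div_cancel₀ _ ((map_ne_zero_iff _ (RatFunc.algebraMap_injective ℂ)).mpr hP),
      iotaZeroCoeff_algebraMap, ← hg, ← hinv,
      polyMul_oppositeSeries, sub_add_cancel, polyMul_mul, polyMul_X_pow,
      show -(n - (l : ℤ)) - 1 - l = -n - 1 by ring, polyMul_sub_C_pow, neg_neg] at h1
    exact h1
  refine ⟨?_, h2⟩
  refine eq_zero_of_shiftAdd_pow one_ne_zero k ?_ fun n hn => ?_
  · obtain ⟨N, hN⟩ := exists_iotaZeroCoeff_eq_zero (iotaInftyInv (oppositeSeries V α v w))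
    exact ⟨-N, fun n hn => hN _ (by omega)⟩
  · rw [h2]
    exact h n k hn le_rfl w

/-- `Y^L(v, y)α`, with `y = x + 1`, is characterized by: it is truncated, and its product with
`(y-1)^l = x^l` is `x^l ⟨α, Y°(v, x)w⟩`, which for large `l` has a pole at `x = -1` only. -/
theorem leftRegular_spec {α : Module.Dual ℂ M} {v : V} {k l : ℕ} (h : α ∈ killSpace M v k l)
    (w : M) : (∀ n : ℤ, k ≤ n → leftRegular V (-1) α v n w = 0) ∧
      (shiftAdd ℂ (-1) ^ l) (fun n => leftRegular V (-1) α v n w)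
        = fun n => α (oppositeTest V M l n v w) := by
  obtain ⟨g, hg⟩ := polySeries_of_mem_killSpace h w
  have hP : (X ^ l * (X - C (-1)) ^ k : ℂ[X]) ≠ 0 :=
    mul_ne_zero (pow_ne_zero _ X_ne_zero) (pow_ne_zero _ (X_sub_C_ne_zero _))
  have hQ : (X ^ k * (X - C 1) ^ l : ℂ[X]) ≠ 0 :=
    mul_ne_zero (pow_ne_zero _ X_ne_zero) (pow_ne_zero _ (X_sub_C_ne_zero _))
  have htr : ∀ f : ℂ[X], ratTranslate (-1) (algebraMap ℂ[X] (RatFunc ℂ) f)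
      = algebraMap ℂ[X] (RatFunc ℂ) (f.comp (X - C 1)) := by
    intro f
    have h1 := RatFunc.map_apply_div (algEquivAevalXAddC (-1 : ℂ)).toAlgHom
      (nonZeroDivisors_le_comap_nonZeroDivisors_of_injective _
        (algEquivAevalXAddC (-1 : ℂ)).injective) f 1
    have h3 : (algEquivAevalXAddC (-1 : ℂ)).toAlgHom f = f.comp (X - C 1) := by
      rw [sub_eq_add_neg, ← C_neg]
      rfl
    rw [map_one, div_one, map_one, map_one, div_one, h3] at h1
    exact h1
  have hinv : ratTranslate (-1) (iotaInftyInv (oppositeSeries V α v w))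
      = algebraMap ℂ[X] (RatFunc ℂ) (g.comp (X - C 1)) /
        algebraMap ℂ[X] (RatFunc ℂ) (X ^ k * (X - C 1) ^ l) := by
    rw [iotaInftyInv_eq hP hg, map_div₀, htr, htr]
    congr 2
    simp [mul_comm]
  have hgc : ∀ i : ℕ, g.coeff i = α (oppositeTest V M (l - 1 - i) k v w) := fun i => by
    have := polyMul_oppositeSeries α v w k l (-1 - i)
    rw [hg, polySeries, if_pos (by omega), show (-(-1 - (i : ℤ)) - 1).toNat = i by omega] at this
    rw [this]
    congr 4
    ring
  have hcoeff : ∀ j : ℕ, (g.comp (X - C 1)).coeff j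
      = α (oppositeTest V M l (k - 1 - j) v w) := by
    intro j
    obtain ⟨N, hN⟩ := oppositeTest_truncation v w
    set T : ℕ := (l - 1 + k - N).toNat
    have hT : ∀ t : ℕ, T ≤ t → oppositeTest V M (l - 1 - t) k v w = 0 := fun t ht =>
      hN _ _ (by omega)
    rw [coeff_comp_X_sub_one, show (k : ℤ) - 1 - j = (-1 - j) + k by ring, oppositeTest_add,
      finsum_eq_sum_range _ T fun t ht => by
        rw [show (l : ℤ) + (-1 - j) - t = l - 1 - (j + t : ℕ) by push_cast; ring,
          hT _ (by omega), smul_zero], map_sum,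
      Finset.sum_subset (s₂ := Finset.range (j + T)) (fun i hi => ?_) (fun i _ hi => ?_),
      Finset.sum_range_add, Finset.sum_eq_zero fun i hi => ?_, zero_add]
    · refine Finset.sum_congr rfl fun t _ => ?_
      rw [choose_upper_negation, show (t : ℤ) - (-1 - j) - 1 = ((j + t : ℕ) : ℤ) by push_cast; ring,
        Ring.choose_natCast, hgc, map_zsmul, Nat.add_sub_cancel_left, zsmul_eq_mul,
        Nat.choose_symm_add, show (l : ℤ) + (-1 - j) - t = l - 1 - (j + t : ℕ) by push_cast; ring]
      push_cast
      ring
    · rw [Nat.choose_eq_zero_of_lt (Finset.mem_range.mp hi)]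
      simp
    · rw [mem_support_iff, hgc] at hi
      rw [Finset.mem_range]
      by_contra hc
      exact hi (by rw [hT i (by omega), map_zero])
    · rw [notMem_support_iff.mp hi, zero_mul]
  have h2 : (shiftAdd ℂ (-1) ^ l) (fun n => leftRegular V (-1) α v n w)
        = fun n => α (oppositeTest V M l n v w) := by
    funext n
    have h1 := congrFun (polyMul_iotaZeroCoeff (X ^ k * (X - C 1) ^ l)
      (ratTranslate (-1) (iotaInftyInv (oppositeSeries V α v w)))) (-(n - k) - 1)
    rw [hinv, mul_div_cancel₀ _ ((map_ne_zero_iff _ (RatFunc.algebraMap_injective ℂ)).mpr hQ),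
      iotaZeroCoeff_algebraMap, ← hinv,
      polyMul_mul, polyMul_X_pow, show -(n - (k : ℤ)) - 1 - k = -n - 1 by ring,
      polyMul_sub_C_pow] at h1
    refine h1.trans ?_
    rw [polySeries]
    split_ifs with hn
    · rw [hcoeff]
      congr 4
      omega
    · exact (h _ _ le_rfl (by omega) w).symm
  refine ⟨?_, h2⟩
  refine eq_zero_of_shiftAdd_pow (neg_ne_zero.mpr one_ne_zero) l ?_ fun n hn => ?_
  · obtain ⟨N, hN⟩ := exists_iotaZeroCoeff_eq_zero
      (ratTranslate (-1) (iotaInftyInv (oppositeSeries V α v w)))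
    exact ⟨-N, fun n hn => hN _ (by omega)⟩
  · rw [h2]
    exact h l n le_rfl hn w

end Regular

/-! ### Actions on functionals obtained by localization -/

section LocalAction

variable {V M : Type*} [AddCommGroup V] [Module ℂ V] [AddCommGroup M] [Module ℂ M]

theorem shiftAdd_pow_dual (ε : ℂ) (c : ℕ) (R : ℤ → Module.Dual ℂ M) (w : M) :
    (shiftAdd ℂ ε ^ c) (fun n => R n w) = fun n => (shiftAdd (Module.Dual ℂ M) ε ^ c) R n w :=
  shiftAdd_pow_map ε (LinearMap.applyₗ w : Module.Dual ℂ M →ₗ[ℂ] ℂ) R c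

theorem shiftAdd_pow_comp (ε : ℂ) (c : ℕ) (α : Module.Dual ℂ M) (f : ℤ → Module.End ℂ M) :
    (shiftAdd (Module.Dual ℂ M) ε ^ c) (fun n => α ∘ₗ f n)
      = fun n => α ∘ₗ (shiftAdd (Module.End ℂ M) ε ^ c) f n :=
  shiftAdd_pow_map ε (LinearMap.compRight ℂ α : Module.End ℂ M →ₗ[ℂ] Module.Dual ℂ M) f c

/-- A truncated series lies in a subspace as soon as its product with a power of `x + ε` does. -/
theorem mem_of_shiftAdd_pow {X : Type*} [AddCommGroup X] [Module ℂ X] (S : Submodule ℂ X) {ε : ℂ}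
    (hε : ε ≠ 0) {c : ℕ} {R : ℤ → X} (hR : ∃ N : ℤ, ∀ n, N ≤ n → R n = 0) {n₀ : ℤ}
    (h : ∀ n, n₀ ≤ n → (shiftAdd X ε ^ c) R n ∈ S) : ∀ n, n₀ ≤ n → R n ∈ S := by
  intro n hn
  rw [← Submodule.Quotient.mk_eq_zero]
  refine eq_zero_of_shiftAdd_pow (h := fun n => S.mkQ (R n)) hε c ?_ (fun n hn => ?_) n hn
  · obtain ⟨N, hN⟩ := hR
    exact ⟨N, fun n hn => by rw [hN n hn, map_zero]⟩
  · rw [shiftAdd_pow_map]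
    exact (Submodule.Quotient.mk_eq_zero S).mpr (h n hn)

/-- `∑ R n x^(-n-1)` is truncated and agrees with `∑ ⟨α, o n v ·⟩ x^(-n-1)` up to a power of
`x + ε`. -/
def IsLocalized (o : ℤ → V →ₗ[ℂ] Module.End ℂ M) (ε : ℂ) (α : Module.Dual ℂ M) (v : V)
    (R : ℤ → Module.Dual ℂ M) : Prop :=
  (∃ N : ℤ, ∀ n, N ≤ n → R n = 0) ∧ ∃ c : ℕ, (shiftAdd (Module.Dual ℂ M) ε ^ c) R
    = (shiftAdd (Module.Dual ℂ M) ε ^ c) (fun n => α ∘ₗ o n v)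

variable {o : ℤ → V →ₗ[ℂ] Module.End ℂ M} {ε : ℂ}

theorem IsLocalized.unique (hε : ε ≠ 0) {α : Module.Dual ℂ M} {v : V} {R S : ℤ → Module.Dual ℂ M}
    (hR : IsLocalized o ε α v R) (hS : IsLocalized o ε α v S) : R = S := by
  obtain ⟨h1, c, hc⟩ := hR
  obtain ⟨h2, d, hd⟩ := hS
  refine eq_of_shiftAdd_pow hε (max c d) h1 h2 ?_
  rw [shiftAdd_pow_eq_of_le (le_max_left c d) hc, shiftAdd_pow_eq_of_le (le_max_right c d) hd]

theorem IsLocalized.linear {α β : Module.Dual ℂ M} {v u : V} {R S : ℤ → Module.Dual ℂ M}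
    (hR : IsLocalized o ε α v R) (hS : IsLocalized o ε β u S) (a b : ℂ) {γ : Module.Dual ℂ M}
    {t : V} (h : ∀ n, γ ∘ₗ o n t = a • (α ∘ₗ o n v) + b • (β ∘ₗ o n u)) :
    IsLocalized o ε γ t (a • R + b • S) := by
  obtain ⟨⟨N, hN⟩, c, hc⟩ := hR
  obtain ⟨⟨N', hN'⟩, d, hd⟩ := hS
  refine ⟨⟨max N N', fun n hn => ?_⟩, max c d, ?_⟩
  · rw [Pi.add_apply, Pi.smul_apply, Pi.smul_apply, hN n (le_trans (le_max_left _ _) hn),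
      hN' n (le_trans (le_max_right _ _) hn), smul_zero, smul_zero, add_zero]
  · have : (fun n => γ ∘ₗ o n t) = a • (fun n => α ∘ₗ o n v) + b • (fun n => β ∘ₗ o n u) :=
      funext h
    rw [this, map_add, map_add, map_smul, map_smul, map_smul, map_smul,
      shiftAdd_pow_eq_of_le (le_max_left c d) hc, shiftAdd_pow_eq_of_le (le_max_right c d) hd]

/-- A family of functions on `M` which is a localization of `α` at each vector of `M` is linear: the
localization at a vector is unique. -/
theorem isLocalized_of_pointwise (hε : ε ≠ 0)
    {α : Module.Dual ℂ M} {v : V} {f : ℤ → M → ℂ} {N : ℤ} (hN : ∀ n w, N ≤ n → f n w = 0) {c : ℕ}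
    (hc : ∀ w, (shiftAdd ℂ ε ^ c) (fun n => f n w)
      = (shiftAdd ℂ ε ^ c) (fun n => α (o n v w))) :
    ∃ R, IsLocalized o ε α v R ∧ ∀ n w, R n w = f n w := by
  have hadd : ∀ n x y, f n (x + y) = f n x + f n y := by
    intro n x y
    refine congrFun (eq_of_shiftAdd_pow hε c (g := fun n => f n (x + y))
      (h := (fun n => f n x) + fun n => f n y) ⟨N, fun n hn => hN n _ hn⟩
      ⟨N, fun n hn => by simp [hN n _ hn]⟩ ?_) n
    rw [map_add, hc, hc, hc, ← map_add]
    congr 1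
    funext n
    simp
  have hsmul : ∀ n (a : ℂ) x, f n (a • x) = a • f n x := by
    intro n a x
    refine congrFun (eq_of_shiftAdd_pow hε c (g := fun n => f n (a • x))
      (h := a • fun n => f n x) ⟨N, fun n hn => hN n _ hn⟩
      ⟨N, fun n hn => by simp [hN n _ hn]⟩ ?_) n
    rw [map_smul, hc, hc, ← map_smul]
    congr 1
    funext n
    simp
  refine ⟨fun n => ⟨⟨f n, hadd n⟩, hsmul n⟩, ⟨⟨N, fun n hn => LinearMap.ext fun w => hN n w hn⟩,
    c, ?_⟩, fun _ _ => rfl⟩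
  funext n
  ext w
  refine (congrFun (shiftAdd_pow_dual ε c _ w) n).symm.trans ((congrFun (hc w) n).trans ?_)
  exact congrFun (shiftAdd_pow_dual ε c (fun n => α ∘ₗ o n v) w) n

variable [VertexOperatorAlgebra V]

/-- Modes `m v n` on a vector space satisfying the axioms of a weak `V`-module other than the
derivative property, which follows from them. -/
structure ModeAction {X : Type*} [AddCommGroup X] [Module ℂ X]
    (m : V →ₗ[ℂ] (ℤ → Module.End ℂ X)) : Prop where
  truncation : ∀ v x, ∃ N : ℤ, ∀ n, N ≤ n → m v n x = 0
  vacuum : ∀ (n : ℤ) x, m (VertexOperatorAlgebra.vac : V) n x = if n = -1 then x else 0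
  jacobi : ∀ u v x p q r, modeDefect m u v x p q r = 0

/-- The conditions under which the functionals in `D` carry an action of `V` obtained from the
opposite modes `o` by localization at `-ε`. -/
structure LocalData (o : ℤ → V →ₗ[ℂ] Module.End ℂ M) (ε : ℂ) (D : Submodule ℂ (Module.Dual ℂ M)) :
    Prop where
  ne_zero : ε ≠ 0
  truncation : ∀ v w, ∃ N : ℤ, ∀ n ≤ N, o n v w = 0
  vacuum : ∀ (n : ℤ) w, o n (VertexOperatorAlgebra.vac : V) w = if n = -1 then w else 0
  jacobi : ∀ u v w p q r, oppositeDefect o u v w p q r = 0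
  exists_localized : ∀ α ∈ D, ∀ v, ∃ R, IsLocalized o ε α v R
  comp_mem : ∀ α ∈ D, ∀ n v, α ∘ₗ o n v ∈ D
  uniform : ∀ α ∈ D, ∀ u v R, IsLocalized o ε α v R → ∃ c : ℕ, ∀ q S, IsLocalized o ε (R q) u S →
    (shiftAdd (Module.Dual ℂ M) ε ^ c) S
      = (shiftAdd (Module.Dual ℂ M) ε ^ c) (fun n => R q ∘ₗ o n u)

variable {D : Submodule ℂ (Module.Dual ℂ M)}

theorem IsLocalized.mem (h : LocalData o ε D) {α : Module.Dual ℂ M} (hα : α ∈ D) {v : V}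
    {R : ℤ → Module.Dual ℂ M} (hR : IsLocalized o ε α v R) (n : ℤ) : R n ∈ D := by
  obtain ⟨h1, c, hc⟩ := hR
  refine mem_of_shiftAdd_pow D h.ne_zero h1 (c := c) (n₀ := n) (fun m _ => ?_) n le_rfl
  rw [hc]
  clear hc
  have : ∀ m, (shiftAdd (Module.Dual ℂ M) ε ^ c) (fun n => α ∘ₗ o n v) m ∈ D := by
    induction c with
    | zero => exact fun m => h.comp_mem α hα m v
    | succ c ih =>
      intro m
      rw [pow_succ', Module.End.mul_apply, shiftAdd_apply]
      exact D.add_mem (ih _) (D.smul_mem _ (ih _))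
  exact this m

/-- The action of `V` on `D` obtained by localization. -/
def localMode (h : LocalData o ε D) : V →ₗ[ℂ] (ℤ → Module.End ℂ D) where
  toFun v n :=
    { toFun := fun α => ⟨(h.exists_localized α.1 α.2 v).choose n,
        (h.exists_localized α.1 α.2 v).choose_spec.mem h α.2 n⟩
      map_add' := fun α β => Subtype.ext <| by
        have := ((h.exists_localized α.1 α.2 v).choose_spec.linear
          (h.exists_localized β.1 β.2 v).choose_spec 1 1 (γ := α.1 + β.1) (t := v)
          fun n => by simp [LinearMap.add_comp]).unique h.ne_zero
          (h.exists_localized _ (α + β).2 v).choose_spec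
        have := congrFun this n
        simp only [one_smul, Pi.add_apply] at this
        exact this.symm
      map_smul' := fun c α => Subtype.ext <| by
        have := ((h.exists_localized α.1 α.2 v).choose_spec.linear
          (h.exists_localized α.1 α.2 v).choose_spec c 0 (γ := c • α.1) (t := v)
          fun n => by simp [LinearMap.smul_comp]).unique h.ne_zero
          (h.exists_localized _ (c • α).2 v).choose_spec
        have := congrFun this n
        simp only [zero_smul, add_zero, Pi.smul_apply] at this
        exact this.symm }
  map_add' u v := by
    funext n
    ext1 α
    apply Subtype.ext
    have := ((h.exists_localized α.1 α.2 u).choose_spec.linear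
      (h.exists_localized α.1 α.2 v).choose_spec 1 1 (γ := α.1) (t := u + v)
      fun n => by simp [LinearMap.comp_add]).unique h.ne_zero
      (h.exists_localized _ α.2 (u + v)).choose_spec
    have := congrFun this n
    simp only [one_smul, Pi.add_apply] at this
    exact this.symm
  map_smul' c v := by
    funext n
    ext1 α
    apply Subtype.ext
    have := ((h.exists_localized α.1 α.2 v).choose_spec.linear
      (h.exists_localized α.1 α.2 v).choose_spec c 0 (γ := α.1) (t := c • v)
      fun n => by simp [LinearMap.comp_smul]).unique h.ne_zero
      (h.exists_localized _ α.2 (c • v)).choose_spec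
    have := congrFun this n
    simp only [zero_smul, add_zero, Pi.smul_apply] at this
    exact this.symm

theorem localMode_spec (h : LocalData o ε D) (v : V) (α : D) :
    IsLocalized o ε α.1 v (fun n => (localMode h v n α).1) :=
  (h.exists_localized α.1 α.2 v).choose_spec

/-- The localized modes satisfy the Jacobi identity by `modeDefect_eq_zero_of_localization`; the
condition `LocalData.uniform` provides the powers of `x₁ + ε` and `x₂ + ε` needed for products. -/
theorem localMode_modeAction (h : LocalData o ε D) : ModeAction (localMode h) := by
  have htr : ∀ v x, ∃ N : ℤ, ∀ n, N ≤ n → localMode h v n x = 0 := fun v x => by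
    obtain ⟨N, hN⟩ := (localMode_spec h v x).1
    exact ⟨N, fun n hn => Subtype.ext (hN n hn)⟩
  have hunif : ∀ u v (x : D), ∃ c : ℕ, ∀ q w,
      (shiftAdd ℂ ε ^ c) (fun p => (localMode h u p (localMode h v q x)).1 w)
        = (shiftAdd ℂ ε ^ c) (fun p => (localMode h v q x).1 (o p u w)) := fun u v x => by
    obtain ⟨c, hc⟩ := h.uniform x.1 x.2 u v _ (localMode_spec h v x)
    refine ⟨c, fun q w => ?_⟩
    have h1 := hc q _ (localMode_spec h u (localMode h v q x))
    rw [shiftAdd_pow_dual ε c (fun p => (localMode h u p (localMode h v q x)).1), h1,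
      ← shiftAdd_pow_dual]
    rfl
  have hloc : ∀ v (x : D), ∃ c : ℕ, ∀ w, (shiftAdd ℂ ε ^ c) (fun n => (localMode h v n x).1 w)
      = (shiftAdd ℂ ε ^ c) (fun n => x.1 (o n v w)) := fun v x => by
    obtain ⟨-, c, hc⟩ := localMode_spec h v x
    refine ⟨c, fun w => ?_⟩
    rw [shiftAdd_pow_dual ε c (fun n => (localMode h v n x).1), hc, ← shiftAdd_pow_dual]
    rfl
  refine ⟨htr, fun n x => Subtype.ext ?_, fun u v x p q r => ?_⟩
  · have h1 : IsLocalized o ε x.1 (VertexOperatorAlgebra.vac : V)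
        (fun n => if n = -1 then x.1 else 0) := by
      refine ⟨⟨0, fun n hn => if_neg (by omega)⟩, 0, ?_⟩
      congr 1
      funext n
      ext w
      rw [LinearMap.comp_apply, h.vacuum]
      split_ifs <;> simp
    have := congrFun ((localMode_spec h _ x).unique h.ne_zero h1) n
    rw [this]
    split_ifs <;> rfl
  · refine modeDefect_eq_zero_of_localization D.subtype D.injective_subtype h.truncation h.jacobi
      htr h.ne_zero hloc ?_ ?_ u v x p q r
    · intro u v x
      obtain ⟨c, hc⟩ := hunif u v x
      obtain ⟨d, hd⟩ := hloc v x
      refine ⟨max c d, fun w => ?_⟩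
      simp only [Submodule.subtype_apply]
      have hcomm := ((shift_commute (X := ℂ) ε ε).pow_pow (max c d) (max c d)).eq
      simp only [← Module.End.mul_apply, hcomm]
      simp only [Module.End.mul_apply]
      have e1 : (shiftAdd (ℤ → ℂ) ε ^ max c d)
          (fun p q => (localMode h u p (localMode h v q x)).1 w)
          = (shiftAdd (ℤ → ℂ) ε ^ max c d) (fun p q => (localMode h v q x).1 (o p u w)) := by
        funext p q
        rw [shiftFst_pow_apply, shiftFst_pow_apply,
          shiftAdd_pow_eq_of_le (le_max_left c d) (hc q w)]
      rw [e1]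
      simp only [← Module.End.mul_apply, ← hcomm]
      simp only [Module.End.mul_apply]
      congr 1
      funext p
      rw [shiftSnd_pow_apply, shiftSnd_pow_apply,
        shiftAdd_pow_eq_of_le (le_max_right c d) (hd (o p u w))]
    · intro u v x
      obtain ⟨c, hc⟩ := hunif v u x
      obtain ⟨d, hd⟩ := hloc u x
      refine ⟨max c d, fun w => ?_⟩
      simp only [Submodule.subtype_apply]
      have hcomm := ((shift_commute (X := ℂ) ε ε).pow_pow (max c d) (max c d)).eq
      have e1 : (shiftSnd ℂ ε ^ max c d)
          (fun p q => (localMode h v q (localMode h u p x)).1 w)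
          = (shiftSnd ℂ ε ^ max c d) (fun p q => (localMode h u p x).1 (o q v w)) := by
        funext p
        rw [shiftSnd_pow_apply, shiftSnd_pow_apply,
          shiftAdd_pow_eq_of_le (le_max_left c d) (hc p w)]
      rw [e1]
      simp only [← Module.End.mul_apply, hcomm]
      simp only [Module.End.mul_apply]
      congr 1
      funext p q
      rw [shiftFst_pow_apply, shiftFst_pow_apply,
        shiftAdd_pow_eq_of_le (le_max_right c d) (hd (o q v w))]

end LocalAction

/-! ### The two actions on the regular functionals -/

section TwoActions

variable {V M : Type*} [AddCommGroup V] [Module ℂ V] [VertexOperatorAlgebra V]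
  [AddCommGroup M] [Module ℂ M] [WeakModule V M]

/-- Against a regular functional, `Res f Y°(u, x)` and `Res g Y°(v, x)` commute if the product `f g`
has zeros of high order at `0` and `-1`: by the commutator formula the difference is a finite sum of
residues of `Y°(u_i v, x)` against products of `g` and derivatives of `f`. -/
theorem exists_comp_oppositeTest_commute {α : Module.Dual ℂ M} (hα : α ∈ regularDual V M (-1))
    (u v : V) : ∃ K L : ℤ, ∀ n a p r w, K ≤ r + a → L ≤ p + n →
      α (oppositeTest V M n a v (oppositeTest V M p r u w))
        = α (oppositeTest V M p r u (oppositeTest V M n a v w)) := by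
  rw [mem_regularDual_iff] at hα
  obtain ⟨I, hI⟩ := exists_nat_truncation u v 0
  simp only [zero_add] at hI
  obtain ⟨t, ht⟩ := exists_bound_range (fun i t => α ∈ killSpace M (mode V u i v) t t) (fun i => by
    obtain ⟨k, l, h⟩ := hα (mode V u i v)
    exact ⟨max k l, fun t ht => killSpace_mono
      (by exact_mod_cast (le_max_left k l).trans ht)
      (by exact_mod_cast (le_max_right k l).trans ht) h⟩) I
  refine ⟨t + I, t + I, fun n a p r w hK hL => ?_⟩
  rw [← sub_eq_zero, ← map_sub, oppositeTest_commutator, finsum_eq_sum_range _ I fun i hi =>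
    Finset.sum_eq_zero fun x _ => by rw [hI i hi, map_zero, LinearMap.zero_apply, smul_zero],
    map_sum]
  refine Finset.sum_eq_zero fun i hi => ?_
  rw [map_sum]
  refine Finset.sum_eq_zero fun x hx => ?_
  have h1 := mem_antidiagonal.mp hx
  have h2 := Finset.mem_range.mp hi
  rw [map_zsmul, ht i h2 t le_rfl _ _ (by omega) (by omega), smul_zero]

theorem comp_oppositeTest_mem_killSpace {α : Module.Dual ℂ M} {u v : V} {K L : ℤ}
    (hKL : ∀ n a p r w, K ≤ r + a → L ≤ p + n →
      α (oppositeTest V M n a v (oppositeTest V M p r u w))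
        = α (oppositeTest V M p r u (oppositeTest V M n a v w))) {k l n a : ℤ}
    (h : α ∈ killSpace M u k l) (hk : K ≤ k + a) (hl : L ≤ l + n) :
    α ∘ₗ oppositeTest V M n a v ∈ killSpace M u k l := by
  intro p r hp hr w
  rw [LinearMap.comp_apply, hKL n a p r w (by omega) (by omega), h p r hp hr]

/-- Regular functionals are stable under the transposes of the opposite modes. -/
theorem comp_oppositeTest_mem {α : Module.Dual ℂ M} (hα : α ∈ regularDual V M (-1)) (n a : ℤ)
    (v : V) : α ∘ₗ oppositeTest V M n a v ∈ regularDual V M (-1) := by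
  rw [mem_regularDual_iff]
  intro u
  obtain ⟨K, L, hKL⟩ := exists_comp_oppositeTest_commute hα u v
  obtain ⟨k, l, h⟩ := mem_regularDual_iff.mp hα u
  refine ⟨max k (K - a).toNat, max l (L - n).toNat,
    comp_oppositeTest_mem_killSpace hKL (killSpace_mono ?_ ?_ h) ?_ ?_⟩
  all_goals push_cast; omega

theorem rightLocalized_pow {α : Module.Dual ℂ M} {v : V} {R : ℤ → Module.Dual ℂ M} {c : ℕ}
    (hc : (shiftAdd (Module.Dual ℂ M) 1 ^ c) R
      = (shiftAdd (Module.Dual ℂ M) 1 ^ c) (fun n => α ∘ₗ oppositeTest V M n 0 v)) {a : ℕ}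
    (ha : c ≤ a) : (shiftAdd (Module.Dual ℂ M) 1 ^ a) R = fun n => α ∘ₗ oppositeTest V M n a v := by
  rw [shiftAdd_pow_eq_of_le ha hc, shiftAdd_pow_comp, shiftAdd_one_pow_oppositeTest, zero_add]

theorem leftLocalized_pow {α : Module.Dual ℂ M} {v : V} {R : ℤ → Module.Dual ℂ M} {c : ℕ}
    (hc : (shiftAdd (Module.Dual ℂ M) (-1) ^ c) R
      = (shiftAdd (Module.Dual ℂ M) (-1) ^ c) (fun n => α ∘ₗ oppositeTest V M 0 n v)) {b : ℕ}
    (hb : c ≤ b) :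
    (shiftAdd (Module.Dual ℂ M) (-1) ^ b) R = fun n => α ∘ₗ oppositeTest V M b n v := by
  rw [shiftAdd_pow_eq_of_le hb hc, shiftAdd_pow_comp, shiftAdd_neg_one_pow_oppositeTest, zero_add]

/-- The exponent of `1 + x` witnessing that `R` is localized may be lowered to any `k` for which
`(1+x)^k ⟨α, Y°(v, x)·⟩` is truncated, and hence chosen uniformly in families of functionals. -/
theorem rightLocalized_eq {α : Module.Dual ℂ M} {v : V} {R : ℤ → Module.Dual ℂ M}
    (hR : IsLocalized (fun n => oppositeTest V M n 0) 1 α v R) {k : ℕ} {l : ℤ}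
    (h : α ∈ killSpace M v k l) :
    (shiftAdd (Module.Dual ℂ M) 1 ^ k) R = fun n => α ∘ₗ oppositeTest V M n k v := by
  obtain ⟨⟨N, hN⟩, c, hc⟩ := hR
  refine eq_of_shiftAdd_pow one_ne_zero c ?_ ⟨l, fun n hn => LinearMap.ext fun w =>
    h n k hn le_rfl w⟩ ?_
  · clear hc h
    refine ⟨N, ?_⟩
    induction k with
    | zero => exact hN
    | succ k ih =>
      intro n hn
      rw [pow_succ', Module.End.mul_apply, shiftAdd_apply, ih n hn, ih (n + 1) (by omega),
        smul_zero, add_zero]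
  · rw [← Module.End.mul_apply, ← pow_add, rightLocalized_pow hc (Nat.le_add_right c k),
      shiftAdd_pow_comp, shiftAdd_one_pow_oppositeTest]
    push_cast
    simp only [add_comm]

/-- The analogue of `rightLocalized_eq` at `x = -1`. -/
theorem leftLocalized_eq {α : Module.Dual ℂ M} {v : V} {R : ℤ → Module.Dual ℂ M}
    (hR : IsLocalized (fun n => oppositeTest V M 0 n) (-1) α v R) {k : ℤ} {l : ℕ}
    (h : α ∈ killSpace M v k l) :
    (shiftAdd (Module.Dual ℂ M) (-1) ^ l) R = fun n => α ∘ₗ oppositeTest V M l n v := by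
  obtain ⟨⟨N, hN⟩, c, hc⟩ := hR
  refine eq_of_shiftAdd_pow (neg_ne_zero.mpr one_ne_zero) c ?_ ⟨k, fun n hn =>
    LinearMap.ext fun w => h l n le_rfl hn w⟩ ?_
  · clear hc h
    refine ⟨N, ?_⟩
    induction l with
    | zero => exact hN
    | succ k ih =>
      intro n hn
      rw [pow_succ', Module.End.mul_apply, shiftAdd_apply, ih n hn, ih (n + 1) (by omega),
        smul_zero, add_zero]
  · rw [← Module.End.mul_apply, ← pow_add, leftLocalized_pow hc (Nat.le_add_right c l),
      shiftAdd_pow_comp, shiftAdd_neg_one_pow_oppositeTest]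
    push_cast
    simp only [add_comm]

/-- The coefficients of `Y^R(v, x)α` satisfy the regularity condition for `u` with the same power of
`1 + x` as `α`, and with a common power of `x` when their indices are bounded below. -/
theorem rightLocalized_mem_killSpace {α : Module.Dual ℂ M} (hα : α ∈ regularDual V M (-1))
    {u v : V} {R : ℤ → Module.Dual ℂ M}
    (hR : IsLocalized (fun n => oppositeTest V M n 0) 1 α v R) {k l : ℤ}
    (h : α ∈ killSpace M u k l) (n₀ : ℤ) :
    ∃ l' : ℤ, l ≤ l' ∧ ∀ n, n₀ ≤ n → R n ∈ killSpace M u k l' := by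
  obtain ⟨K, L, hKL⟩ := exists_comp_oppositeTest_commute hα u v
  obtain ⟨h1, c, hc⟩ := hR
  refine ⟨max l (L - n₀), le_max_left _ _, mem_of_shiftAdd_pow _ one_ne_zero h1
    (c := max c (K - k).toNat) fun n hn => ?_⟩
  rw [rightLocalized_pow hc (le_max_left _ _)]
  exact comp_oppositeTest_mem_killSpace hKL (killSpace_mono le_rfl (le_max_left _ _) h)
    (by push_cast; omega) (by omega)

/-- The analogue of `rightLocalized_mem_killSpace` at `x = -1`: the power of `x` is the same as
for `α`. -/
theorem leftLocalized_mem_killSpace {α : Module.Dual ℂ M} (hα : α ∈ regularDual V M (-1))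
    {u v : V} {R : ℤ → Module.Dual ℂ M}
    (hR : IsLocalized (fun n => oppositeTest V M 0 n) (-1) α v R) {k l : ℤ}
    (h : α ∈ killSpace M u k l) (n₀ : ℤ) :
    ∃ k' : ℤ, k ≤ k' ∧ ∀ n, n₀ ≤ n → R n ∈ killSpace M u k' l := by
  obtain ⟨K, L, hKL⟩ := exists_comp_oppositeTest_commute hα u v
  obtain ⟨h1, c, hc⟩ := hR
  refine ⟨max k (K - n₀), le_max_left _ _, mem_of_shiftAdd_pow _ (neg_ne_zero.mpr one_ne_zero) h1
    (c := max c (L - l).toNat) fun n hn => ?_⟩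
  rw [leftLocalized_pow hc (le_max_left _ _)]
  exact comp_oppositeTest_mem_killSpace hKL (killSpace_mono (le_max_left _ _) le_rfl h)
    (by omega) (by push_cast; omega)

theorem exists_rightLocalized {α : Module.Dual ℂ M} (hα : α ∈ regularDual V M (-1)) (v : V) :
    ∃ R, IsLocalized (fun n => oppositeTest V M n 0) 1 α v R ∧
      ∀ n w, R n w = rightRegular V α v n w := by
  obtain ⟨k, l, h⟩ := mem_regularDual_iff.mp hα v
  refine isLocalized_of_pointwise one_ne_zero
    (fun n w hn => (rightRegular_spec h w).1 n hn) (c := k) fun w => ?_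
  rw [(rightRegular_spec h w).2]
  let f : Module.End ℂ M →ₗ[ℂ] ℂ := α ∘ₗ LinearMap.applyₗ w
  have := shiftAdd_pow_map 1 f (fun n => oppositeTest V M n 0 v) k
  rw [shiftAdd_one_pow_oppositeTest, zero_add] at this
  exact this.symm

theorem exists_leftLocalized {α : Module.Dual ℂ M} (hα : α ∈ regularDual V M (-1)) (v : V) :
    ∃ R, IsLocalized (fun n => oppositeTest V M 0 n) (-1) α v R ∧
      ∀ n w, R n w = leftRegular V (-1) α v n w := by
  obtain ⟨k, l, h⟩ := mem_regularDual_iff.mp hα v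
  refine isLocalized_of_pointwise (neg_ne_zero.mpr one_ne_zero)
    (fun n w hn => (leftRegular_spec h w).1 n hn) (c := l) fun w => ?_
  rw [(leftRegular_spec h w).2]
  let f : Module.End ℂ M →ₗ[ℂ] ℂ := α ∘ₗ LinearMap.applyₗ w
  have := shiftAdd_pow_map (-1) f (fun n => oppositeTest V M 0 n v) l
  rw [shiftAdd_neg_one_pow_oppositeTest, zero_add] at this
  exact this.symm

variable (V M) in
/-- Localization at `x = 0` of the modes `Res x^n Y°(v, x)`. -/
theorem rightLocalData :
    LocalData (fun n => oppositeTest V M n 0) 1 (regularDual V M (-1)) where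
  ne_zero := one_ne_zero
  truncation v w := by
    obtain ⟨N, hN⟩ := oppositeTest_truncation v w
    exact ⟨N, fun n hn => hN n 0 (by omega)⟩
  vacuum n w := by rw [oppositeTest_zero, opposite_vac]
  jacobi u v w p q r := by
    simp only [oppositeTest_zero]
    exact opposite_jacobi u v w p q r
  exists_localized α hα v := by
    obtain ⟨R, hR, -⟩ := exists_rightLocalized hα v
    exact ⟨R, hR⟩
  comp_mem α hα n v := comp_oppositeTest_mem hα n 0 v
  uniform α hα u v R hR := by
    obtain ⟨k, l, h⟩ := mem_regularDual_iff.mp hα u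
    refine ⟨k, fun q S hS => ?_⟩
    obtain ⟨l', -, hl'⟩ := rightLocalized_mem_killSpace hα hR h q
    rw [rightLocalized_eq hS (hl' q le_rfl), shiftAdd_pow_comp, shiftAdd_one_pow_oppositeTest,
      zero_add]

/-- Localization at `x = -1` of the modes `Res (1+x)^n Y°(v, x)`. -/
theorem leftLocalData (hM : IsLowestWeight V M) :
    LocalData (fun n => oppositeTest V M 0 n) (-1) (regularDual V M (-1)) where
  ne_zero := neg_ne_zero.mpr one_ne_zero
  truncation v w := by
    obtain ⟨N, hN⟩ := oppositeTest_truncation v w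
    exact ⟨N, fun n hn => hN 0 n (by omega)⟩
  vacuum n w := by
    rw [oppositeTest_apply, finsum_eq_ite_of_int _ (n + 1) fun i hi => by
      rw [opposite_vac, if_neg (by omega), smul_zero]]
    split_ifs with h1 h2 h2
    · subst h2
      simp [opposite_vac]
    · rw [choose_eq_zero_of_lt (by omega) (by omega), zero_smul]
    · omega
    · rfl
  jacobi := oppositeTest_jacobi hM
  exists_localized α hα v := by
    obtain ⟨R, hR, -⟩ := exists_leftLocalized hα v
    exact ⟨R, hR⟩
  comp_mem α hα n v := comp_oppositeTest_mem hα 0 n v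
  uniform α hα u v R hR := by
    obtain ⟨k, l, h⟩ := mem_regularDual_iff.mp hα u
    refine ⟨l, fun q S hS => ?_⟩
    obtain ⟨k', -, hk'⟩ := leftLocalized_mem_killSpace hα hR h q
    rw [leftLocalized_eq hS (hk' q le_rfl), shiftAdd_pow_comp, shiftAdd_neg_one_pow_oppositeTest,
      zero_add]

variable (V M) in
/-- The action `Y^R` of `V` on the regular functionals. -/
def rightMode : V →ₗ[ℂ] (ℤ → Module.End ℂ (regularDual V M (-1))) := localMode (rightLocalData V M)

/-- The action `Y^L` of `V` on the regular functionals. -/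
def leftMode (hM : IsLowestWeight V M) : V →ₗ[ℂ] (ℤ → Module.End ℂ (regularDual V M (-1))) :=
  localMode (leftLocalData hM)

theorem rightMode_apply (v : V) (n : ℤ) (α : regularDual V M (-1)) (w : M) :
    (rightMode V M v n α).1 w = rightRegular V α.1 v n w := by
  obtain ⟨R, hR, h⟩ := exists_rightLocalized α.2 v
  rw [← h, ← (localMode_spec (rightLocalData V M) v α).unique one_ne_zero hR]
  rfl

theorem leftMode_apply (hM : IsLowestWeight V M) (v : V) (n : ℤ) (α : regularDual V M (-1))
    (w : M) : (leftMode hM v n α).1 w = leftRegular V (-1) α.1 v n w := by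
  obtain ⟨R, hR, h⟩ := exists_leftLocalized α.2 v
  rw [← h, ← (localMode_spec (leftLocalData hM) v α).unique (neg_ne_zero.mpr one_ne_zero) hR]
  rfl

end TwoActions

/-! ### The two actions commute -/

section Commute

variable {V M : Type*} [AddCommGroup V] [Module ℂ V] [VertexOperatorAlgebra V]
  [AddCommGroup M] [Module ℂ M] [WeakModule V M]

theorem shiftAdd_pow_congr {X : Type*} [AddCommGroup X] [Module ℂ X] (ε : ℂ) (c : ℕ) {g h : ℤ → X}
    {n₀ : ℤ} (hgh : ∀ n, n₀ ≤ n → g n = h n) :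
    ∀ n, n₀ ≤ n → (shiftAdd X ε ^ c) g n = (shiftAdd X ε ^ c) h n := by
  induction c with
  | zero => exact hgh
  | succ c ih =>
    intro n hn
    rw [pow_succ', Module.End.mul_apply, Module.End.mul_apply, shiftAdd_apply, shiftAdd_apply,
      ih n hn, ih (n + 1) (by omega)]

/-- Multiplied by large powers of `x₁ - 1` and `x₂ + 1`, both products are matrix coefficients of
products of opposite vertex operators against functions `f`, `g` as in
`exists_comp_oppositeTest_commute`; the powers can be cancelled. -/
theorem leftMode_rightMode_commute (hM : IsLowestWeight V M) (u v : V) (p q : ℤ)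
    (x : regularDual V M (-1)) :
    leftMode hM u p (rightMode V M v q x) = rightMode V M v q (leftMode hM u p x) := by
  apply Subtype.ext
  ext w
  have hL := localMode_modeAction (leftLocalData hM)
  have hR := localMode_modeAction (rightLocalData V M)
  have sL := localMode_spec (leftLocalData hM)
  have sR := localMode_spec (rightLocalData V M)
  obtain ⟨K, L, hKL⟩ := exists_comp_oppositeTest_commute x.2 u v
  obtain ⟨ku, lu, hu⟩ := mem_regularDual_iff.mp x.2 u
  obtain ⟨kv, lv, hv⟩ := mem_regularDual_iff.mp x.2 v
  -- bounds which are uniform in the region `p ≤ i`, `q ≤ j`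
  obtain ⟨l', hl', hβ⟩ := rightLocalized_mem_killSpace x.2 (sR v x) hu q
  obtain ⟨k', hk', hγ⟩ := leftLocalized_mem_killSpace x.2 (sL u x) hv p
  set b : ℕ := max l'.toNat (L - q).toNat with hb
  set a : ℕ := max k'.toNat (K - p).toNat with ha
  set K₁ : ℤ → ℤ → ℂ := fun i j => (leftMode hM u i (rightMode V M v j x)).1 w with hK₁
  set K₂ : ℤ → ℤ → ℂ := fun i j => (rightMode V M v j (leftMode hM u i x)).1 w with hK₂
  have h₁ : ∀ i j, p ≤ i → q ≤ j →
      (shiftAdd (ℤ → ℂ) (-1) ^ b) ((shiftSnd ℂ 1 ^ a) K₁) i j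
        = x.1 (oppositeTest V M j a v (oppositeTest V M b i u w)) := by
    intro i j hi hj
    have hcomm := ((shift_commute (X := ℂ) (-1) 1).pow_pow b a).eq
    rw [← Module.End.mul_apply, hcomm, Module.End.mul_apply, shiftSnd_pow_apply]
    have e : ∀ j, q ≤ j → (shiftAdd (ℤ → ℂ) (-1) ^ b) K₁ i j
        = (rightMode V M v j x).1 (oppositeTest V M b i u w) := fun j hj => by
      have h2 := leftLocalized_eq (sL u (rightMode V M v j x)) (l := b)
        (killSpace_mono le_rfl (by omega) (hβ j hj))
      rw [shiftFst_pow_apply]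
      refine (congrFun (shiftAdd_pow_dual (-1) b _ w) i).trans ?_
      exact congrArg (fun f : ℤ → Module.Dual ℂ M => f i w) h2
    rw [shiftAdd_pow_congr 1 a e j hj]
    have h3 := rightLocalized_eq (sR v x) (k := a) (killSpace_mono (by omega) le_rfl hv)
    refine (congrFun (shiftAdd_pow_dual 1 a _ _) j).trans ?_
    exact congrArg (fun f : ℤ → Module.Dual ℂ M => f j (oppositeTest V M b i u w)) h3
  have h₂ : ∀ i j, p ≤ i → q ≤ j →
      (shiftAdd (ℤ → ℂ) (-1) ^ b) ((shiftSnd ℂ 1 ^ a) K₂) i j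
        = x.1 (oppositeTest V M b i u (oppositeTest V M j a v w)) := by
    intro i j hi hj
    rw [shiftFst_pow_apply]
    have e : ∀ i, p ≤ i → (shiftSnd ℂ 1 ^ a) K₂ i j
        = (leftMode hM u i x).1 (oppositeTest V M j a v w) := fun i hi => by
      have h2 := rightLocalized_eq (sR v (leftMode hM u i x)) (k := a)
        (killSpace_mono (by omega) le_rfl (hγ i hi))
      rw [shiftSnd_pow_apply]
      refine (congrFun (shiftAdd_pow_dual 1 a _ w) j).trans ?_
      exact congrArg (fun f : ℤ → Module.Dual ℂ M => f j w) h2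
    rw [shiftAdd_pow_congr (-1) b e i hi]
    have h3 := leftLocalized_eq (sL u x) (l := b) (killSpace_mono le_rfl (by omega) hu)
    refine (congrFun (shiftAdd_pow_dual (-1) b _ _) i).trans ?_
    exact congrArg (fun f : ℤ → Module.Dual ℂ M => f i (oppositeTest V M j a v w)) h3
  rw [← sub_eq_zero]
  refine eq_zero_of_shift_pow_pow (K := K₁ - K₂) (neg_ne_zero.mpr one_ne_zero) one_ne_zero b a
    (fun j => ?_) (fun i => ?_) (p₀ := p) (q₀ := q) (fun i j hi hj => ?_) p q le_rfl le_rfl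
  · obtain ⟨N, hN⟩ := hL.truncation u (rightMode V M v j x)
    obtain ⟨N', hN'⟩ := hL.truncation u x
    refine ⟨max N N', fun i hi => ?_⟩
    have e1 : leftMode hM u i (rightMode V M v j x) = 0 := hN i (le_trans (le_max_left _ _) hi)
    have e2 : leftMode hM u i x = 0 := hN' i (le_trans (le_max_right _ _) hi)
    simp [hK₁, hK₂, e1, e2]
  · obtain ⟨N, hN⟩ := hR.truncation v (leftMode hM u i x)
    obtain ⟨N', hN'⟩ := hR.truncation v x
    refine ⟨max N N', fun j hj => ?_⟩
    have e1 : rightMode V M v j (leftMode hM u i x) = 0 := hN j (le_trans (le_max_left _ _) hj)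
    have e2 : rightMode V M v j x = 0 := hN' j (le_trans (le_max_right _ _) hj)
    simp [hK₁, hK₂, e1, e2]
  · rw [map_sub, map_sub, Pi.sub_apply, Pi.sub_apply, h₁ i j hi hj, h₂ i j hi hj,
      hKL j a b i w (by omega) (by omega), sub_self]

end Commute

/-! ### The universal property of `F(U)` -/

section UniversalProperty

open LaurentPolynomial

variable {V : Type*} [AddCommGroup V] [Module ℂ V] [VertexOperatorAlgebra V]
  {X : Type*} [AddCommGroup X] [Module ℂ X] {m : V →ₗ[ℂ] (ℤ → Module.End ℂ X)}

theorem ModeAction.commutator (h : ModeAction m) (u v : V) (p q : ℤ) (x : X) :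
    m u p (m v q x) - m v q (m u p x)
      = ∑ᶠ i : ℕ, Ring.choose p i • m (mode V u i v) (p + q - i) x := by
  have h0 := h.jacobi u v x p q 0
  rw [modeDefect, sub_eq_zero] at h0
  have h1 := finsum_alternating_choose_zero 1 fun i : ℕ => m u (p + 0 - i) (m v (q + i) x)
  have h2 := finsum_alternating_choose_zero ((0 : ℤ).negOnePow : ℤ)
    fun i : ℕ => m v (q + 0 - i) (m u (p + i) x)
  simp only [one_mul] at h1
  rw [h1, h2] at h0
  simpa using h0.symm

/-- The Jacobi identity with `p = 0` and `r = -2`, for `v` and the vacuum. -/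
theorem ModeAction.derivative (h : ModeAction m) (v : V) (n : ℤ) (x : X) :
    m (vir V V (-1) v) n x = (-n) • m v (n - 1) x := by
  have h0 := h.jacobi v VertexOperatorAlgebra.vac x 0 n (-2)
  rw [modeDefect, finsum_choose_zero] at h0
  simp only [alternating_choose_neg_two, h.vacuum] at h0
  rw [finsum_eq_ite_of_int _ (-1 - n) fun i hi => by
      rw [if_neg (by omega), map_zero, smul_zero],
    finsum_eq_ite_of_int _ (n - 1) fun i hi => by rw [if_neg (by omega), smul_zero]] at h0
  rw [vir_neg_one_eq, ← sub_eq_zero, ← h0]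
  simp only [Nat.cast_zero, add_zero, zero_add, sub_zero]
  congr 1
  by_cases h1 : 0 ≤ -1 - n
  · rw [if_pos h1, if_neg (by omega : ¬ 0 ≤ n - 1), sub_zero,
      if_pos (by omega : n + ((-1 - n).toNat : ℤ) = -1),
      show ((-1 - n).toNat : ℤ) = -1 - n by omega, show -2 - (-1 - n) = n - 1 by ring,
      show -1 - n + 1 = -n by ring]
  · by_cases h2 : 0 ≤ n - 1
    · rw [if_neg h1, if_pos h2, if_pos (by omega : n + -2 - ((n - 1).toNat : ℤ) = -1),
        show ((n - 1).toNat : ℤ) = n - 1 by omega,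
        zero_sub, ← neg_smul, Int.negOnePow_even (-2) (by decide)]
      congr 1
      simp
    · have : n = 0 := by omega
      subst this
      simp

/-- An action of `V` by modes extends to the enveloping algebra of `g(V)`. -/
theorem exists_env_algHom (h : ModeAction m) :
    ∃ A : EnvAlg V →ₐ[ℂ] Module.End ℂ X, ∀ v n, A (envGen V v n) = m v n := by
  let g : V ⊗[ℂ] ℂ[T;T⁻¹] →ₗ[ℂ] Module.End ℂ X :=
    TensorProduct.lift (LinearMap.lcomp ℂ (Module.End ℂ X)
      (AddMonoidAlgebra.coeffLinearEquiv ℂ).toLinearMap ∘ₗ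
      (Finsupp.llift (Module.End ℂ X) ℂ ℂ ℤ).toLinearMap ∘ₗ m)
  have hg : ∀ v n, TensorAlgebra.lift ℂ g (loopGen V v n) = m v n := by
    intro v n
    change TensorAlgebra.lift ℂ g (TensorAlgebra.ι ℂ (v ⊗ₜ T n)) = _
    rw [TensorAlgebra.lift_ι_apply]
    change g (v ⊗ₜ AddMonoidAlgebra.single n 1) = _
    simp [g, Finsupp.lift_apply, -LaurentPolynomial.single_eq_C_mul_T]
  have hrel : ∀ ⦃x y⦄, EnvRel V x y → TensorAlgebra.lift ℂ g x = TensorAlgebra.lift ℂ g y := by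
    intro x y hxy
    cases hxy with
    | translation v n =>
      rw [map_add, map_smul, hg, hg, map_zero]
      ext x
      rw [LinearMap.add_apply, h.derivative, LinearMap.smul_apply, ← Int.cast_smul_eq_zsmul ℂ]
      simp
    | bracket u v p q =>
      obtain ⟨N, hN⟩ := exists_nat_truncation u v 0
      simp only [zero_add] at hN
      rw [map_sub, map_mul, map_mul, hg, hg, finsum_eq_sum_range _ N fun i hi => by
        rw [hN i hi, map_zero, Pi.zero_apply, smul_zero], map_sum]
      ext x
      rw [LinearMap.sub_apply, Module.End.mul_apply, Module.End.mul_apply, h.commutator,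
        finsum_eq_sum_range _ N fun i hi => by
          rw [hN i hi, map_zero, Pi.zero_apply, LinearMap.zero_apply, smul_zero],
        LinearMap.sum_apply]
      refine Finset.sum_congr rfl fun i _ => ?_
      rw [map_zsmul, hg, LinearMap.smul_apply]
  refine ⟨RingQuot.liftAlgHom ℂ ⟨TensorAlgebra.lift ℂ g, hrel⟩, fun v n => ?_⟩
  rw [← hg]
  exact RingQuot.liftAlgHom_mkAlgHom_apply ℂ (TensorAlgebra.lift ℂ g) hrel (loopGen V v n)

variable {U : Type*} [AddCommGroup U] [Module ℂ U] [ZhuModule V U]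

/-- A linear map from `U` to a space with an action of `V` extends to `F(U)` if it maps `U` to
lowest weight vectors compatibly with the action of `A(V)`. -/
theorem exists_universal_lift (h : ModeAction m) (j : U →ₗ[ℂ] X)
    (h₁ : ∀ (k n : ℤ) (v : V), v ∈ weightSpace V V (k : ℂ) → k - n - 1 < 0 → ∀ u, m v n (j u) = 0)
    (h₂ : ∀ (k : ℤ) (v : V), v ∈ weightSpace V V (k : ℂ) →
      ∀ u, m v (k - 1) (j u) = j (zhuAct V U v u)) :
    ∃ Φ : UniversalModule V U →ₗ[ℂ] X,
      (∀ v n b, Φ (mode (UniversalModule V U) v n b) = m v n (Φ b)) ∧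
      ∀ u, Φ (universalMap V U u) = j u := by
  obtain ⟨A, hA⟩ := exists_env_algHom h
  let : Module (EnvAlg V) X := Module.compHom X A.toRingHom
  have hsmul : ∀ (a : EnvAlg V) (x : X), a • x = A a x := fun _ _ => rfl
  have : IsScalarTower ℂ (EnvAlg V) X := ⟨fun c a x => by
    rw [hsmul, hsmul, map_smul, LinearMap.smul_apply]⟩
  have : SMulCommClass ℂ (EnvAlg V) X := ⟨fun c a x => by rw [hsmul, hsmul, map_smul]⟩
  have : SMulCommClass (EnvAlg V) ℂ X := SMulCommClass.symm _ _ _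
  let Φ₁ : EnvAlg V ⊗[ℂ] U →ₗ[EnvAlg V] X :=
    TensorProduct.AlgebraTensorModule.lift (LinearMap.toSpanSingleton (EnvAlg V) (U →ₗ[ℂ] X) j)
  have hΦ₁ : ∀ a u, Φ₁ (a ⊗ₜ u) = A a (j u) := fun a u => by
    simp [Φ₁, hsmul]
  let Φ₂ : InducedModule V U →ₗ[EnvAlg V] X := (inducedRel V U).liftQ Φ₁ (by
    rw [inducedRel, Submodule.span_le]
    rintro x (⟨k, n, v, u, hv, hk, rfl⟩ | ⟨k, v, u, hv, rfl⟩)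
    · rw [SetLike.mem_coe, LinearMap.mem_ker, hΦ₁, hA, h₁ k n v hv hk]
    · rw [SetLike.mem_coe, LinearMap.mem_ker, map_sub, hΦ₁, hΦ₁, hA, h₂ k v hv, map_one,
        Module.End.one_apply, sub_self])
  let Φ₃ : UniversalModule V U →ₗ[EnvAlg V] X := (jacobiRel V U).liftQ Φ₂ (by
    rw [jacobiRel, Submodule.span_le]
    rintro x ⟨u, v, w, p, q, r, rfl⟩
    rw [SetLike.mem_coe, LinearMap.mem_ker, ← h.jacobi u v (Φ₂ w) p q r,
      ← jacobiDefect_eq_modeDefect]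
    obtain ⟨N₁, t₁⟩ := exists_nat_truncation u v r
    obtain ⟨N₂, t₂⟩ := induced_truncation v w
    obtain ⟨N₃, t₃⟩ := induced_truncation u w
    unfold jacobiDefect
    rw [map_sub, map_sub,
      map_finsum _ (finite_support_of_eventually_zero _ N₁ fun i hi => by simp [t₁ i hi]),
      map_finsum _ (finite_support_of_eventually_zero _ (N₂ - q).toNat fun i hi => by
        have : envGen V v (q + i) • w = 0 := t₂ _ (by omega)
        simp [this]),
      map_finsum _ (finite_support_of_eventually_zero _ (N₃ - p).toNat fun i hi => by
        have : envGen V u (p + i) • w = 0 := t₃ _ (by omega)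
        simp [this])]
    simp only [map_zsmul, map_smul, hsmul, hA])
  refine ⟨Φ₃.restrictScalars ℂ, fun v n b => ?_, fun u => ?_⟩
  · rw [mode_universal, LinearMap.restrictScalars_apply, map_smul, hsmul, hA]
    rfl
  · change Φ₁ ((1 : EnvAlg V) ⊗ₜ u) = j u
    rw [hΦ₁, map_one, Module.End.one_apply]

/-- `F(U)` is generated by the image of `U`. -/
theorem universal_eq_top (S : Submodule ℂ (UniversalModule V U))
    (h₁ : ∀ u, universalMap V U u ∈ S)
    (h₂ : ∀ (v : V) (n : ℤ), ∀ b ∈ S, mode (UniversalModule V U) v n b ∈ S) : S = ⊤ := by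
  have key : ∀ (x : EnvAlg V), ∀ b ∈ S, x • b ∈ S := by
    intro x
    induction x using env_induction with
    | hs c =>
      intro b hb
      rw [algebraMap_smul]
      exact S.smul_mem c hb
    | hg v n => exact fun b hb => h₂ v n b hb
    | hm x y hx hy =>
      intro b hb
      rw [mul_smul]
      exact hx _ (hy b hb)
    | ha x y hx hy =>
      intro b hb
      rw [add_smul]
      exact S.add_mem (hx b hb) (hy b hb)
  rw [eq_top_iff]
  rintro b -
  obtain ⟨b, rfl⟩ := universalMk_surjective b
  induction b using induced_induction with
  | h0 => rw [map_zero]; exact S.zero_mem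
  | ha x y hx hy => rw [map_add]; exact S.add_mem hx hy
  | h1 x u =>
    rw [map_smul]
    exact key x _ (h₁ u)

/-- Modes of negative degree annihilate the image of `U` in `F(U)`. -/
theorem universalMap_lowest {k n : ℤ} {v : V} (hv : v ∈ weightSpace V V (k : ℂ))
    (hn : k - n - 1 < 0) (u : U) : mode (UniversalModule V U) v n (universalMap V U u) = 0 := by
  have h1 : (inducedRel V U).mkQ (envGen V v n ⊗ₜ[ℂ] u) = 0 :=
    (Submodule.Quotient.mk_eq_zero _).mpr
      (Submodule.subset_span (Or.inl ⟨k, n, v, u, hv, hn, rfl⟩))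
  have h2 : mode (UniversalModule V U) v n (universalMap V U u)
      = universalMk V U (envGen V v n • (inducedRel V U).mkQ ((1 : EnvAlg V) ⊗ₜ[ℂ] u)) := by
    rw [map_smul]
    rfl
  rw [h2, ← map_smul, TensorProduct.smul_tmul', smul_eq_mul, mul_one, h1, map_zero]

/-- Modes of degree zero act on the image of `U` in `F(U)` through `A(V)`. -/
theorem universalMap_zhuAct {k : ℤ} {v : V} (hv : v ∈ weightSpace V V (k : ℂ)) (u : U) :
    mode (UniversalModule V U) v (k - 1) (universalMap V U u)
      = universalMap V U (zhuAct V U v u) := by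
  have h1 : (inducedRel V U).mkQ (envGen V v (k - 1) ⊗ₜ[ℂ] u - (1 : EnvAlg V) ⊗ₜ[ℂ] zhuAct V U v u)
      = 0 := (Submodule.Quotient.mk_eq_zero _).mpr
      (Submodule.subset_span (Or.inr ⟨k, v, u, hv, rfl⟩))
  have h2 : mode (UniversalModule V U) v (k - 1) (universalMap V U u)
      = universalMk V U (envGen V v (k - 1) • (inducedRel V U).mkQ ((1 : EnvAlg V) ⊗ₜ[ℂ] u)) := by
    rw [map_smul]
    rfl
  rw [map_sub, sub_eq_zero] at h1
  rw [h2, ← map_smul, TensorProduct.smul_tmul', smul_eq_mul, mul_one, h1]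
  rfl

end UniversalProperty

/-! ### Residues and the subspace `O(M)` -/

section Residues

variable {V M : Type*} [AddCommGroup V] [Module ℂ V] [VertexOperatorAlgebra V]
  [AddCommGroup M] [Module ℂ M] [WeakModule V M]

/-- `Res_y y^s (1+y)^e Y(v, y)w`. -/
def resMode (s e : ℤ) (v : V) (w : M) : M := ∑ᶠ i : ℕ, Ring.choose e i • mode M v (s + i) w

theorem residueProduct_apply {k : ℤ} {v : V} (hv : v ∈ weightSpace V V (k : ℂ)) (a b : ℤ) (w : M) :
    residueProduct V M a b v w = resMode (-a) (k + b) v w := by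
  rw [residueProduct, extendHomogeneous_apply _ k v hv]
  rfl

theorem resMode_succ (s e : ℤ) (v : V) (w : M) :
    resMode s (e + 1) v w = resMode s e v w + resMode (s + 1) e v w := by
  obtain ⟨N, hN⟩ := exists_nat_truncation v w s
  have h1 : ∀ i : ℕ, N ≤ i → mode M v (s + 1 + i) w = 0 := fun i hi => by
    have := hN (i + 1) (by omega)
    rwa [show s + ((i + 1 : ℕ) : ℤ) = s + 1 + i by push_cast; ring] at this
  simp only [resMode]
  rw [finsum_eq_sum_range _ (N + 1) fun i hi => by rw [hN i (by omega), smul_zero],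
    finsum_eq_sum_range _ (N + 1) fun i hi => by rw [hN i (by omega), smul_zero],
    finsum_eq_sum_range _ N fun i hi => by rw [h1 i hi, smul_zero],
    Finset.sum_range_succ', Finset.sum_range_succ' _ N, add_right_comm, ← Finset.sum_add_distrib]
  congr 1
  · refine Finset.sum_congr rfl fun i _ => ?_
    rw [Ring.choose_succ_succ, add_smul,
      show s + ((i + 1 : ℕ) : ℤ) = s + 1 + i by push_cast; ring, add_comm]
  · rw [Ring.choose_zero_right, Ring.choose_zero_right]

/-- Integration by parts: `Res_y f(y) Y(L(-1)v, y)w = - Res_y f'(y) Y(v, y)w`. -/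
theorem resMode_vir_neg_one (s e : ℤ) (v : V) (w : M) :
    resMode s e (vir V V (-1) v) w = (-s) • resMode (s - 1) e v w - e • resMode s (e - 1) v w := by
  obtain ⟨N, hN⟩ := exists_nat_truncation v w (s - 1)
  have h1 : ∀ i : ℕ, N ≤ i → mode M v (s + i) w = 0 := fun i hi => by
    have := hN (i + 1) (by omega)
    rwa [show s - 1 + ((i + 1 : ℕ) : ℤ) = s + i by push_cast; ring] at this
  have hD : ∀ n : ℤ, mode M (vir V V (-1) v) n w = (-n) • mode M v (n - 1) w := fun n => by
    have := congrArg (fun f : Module.End ℂ M => f w) (WeakModule.derivative (M := M) v n)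
    rw [← conf_mode_zero]
    refine this.trans ?_
    rw [LinearMap.smul_apply, ← Int.cast_smul_eq_zsmul ℂ]
    push_cast
    rfl
  simp only [resMode, hD]
  rw [finsum_eq_sum_range _ (N + 1) fun i hi => by
      rw [show s + (i : ℤ) - 1 = s - 1 + i by ring, hN i (by omega), smul_zero, smul_zero],
    finsum_eq_sum_range _ (N + 1) fun i hi => by rw [hN i (by omega), smul_zero],
    finsum_eq_sum_range _ N fun i hi => by rw [h1 i hi, smul_zero], Finset.smul_sum,
    Finset.smul_sum, Finset.sum_range_succ', Finset.sum_range_succ' _ N,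
    add_sub_right_comm (Finset.sum _ _),
    ← Finset.sum_sub_distrib]
  congr 1
  · refine Finset.sum_congr rfl fun i _ => ?_
    have h2 := Ring.choose_smul_choose e (Nat.le_add_left 1 i)
    rw [Nat.choose_one_right, Nat.add_sub_cancel, Ring.choose_one_right, nsmul_eq_mul] at h2
    rw [show s + ((i + 1 : ℕ) : ℤ) - 1 = s + i by push_cast; ring,
      show s - 1 + ((i + 1 : ℕ) : ℤ) = s + i by push_cast; ring, smul_smul, smul_smul, smul_smul,
      ← sub_smul]
    congr 1
    push_cast at h2 ⊢
    linear_combination -h2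
  · rw [Ring.choose_zero_right, one_smul, one_smul, Nat.cast_zero, add_zero, add_zero]

theorem vir_neg_one_mem {k : ℤ} {v : V} (hv : v ∈ weightSpace V V (k : ℂ)) :
    vir V V (-1) v ∈ weightSpace V V ((k + 1 : ℤ) : ℂ) := by
  have := mode_mem_weightSpace (conf_mem (V := V)) hv 0
  rw [show ((k : ℂ) + ((2 : ℤ) : ℂ) - ((0 : ℤ) : ℂ) - 1) = ((k + 1 : ℤ) : ℂ) by push_cast; ring]
    at this
  exact this

/-- `O(M)` contains `Res_y y^(-2-m) (1+y)^(wt v + n) Y(v, y)w` for `0 ≤ n ≤ m`: increasing `m` is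
integration by parts with `L(-1)v`, and `(1+y)^n` is expanded in powers of `y`. -/
theorem resMode_mem_zhuO (m n : ℕ) (hmn : n ≤ m) {k : ℤ} {v : V}
    (hv : v ∈ weightSpace V V (k : ℂ)) (w : M) :
    resMode (-2 - m) (k + n) v w ∈ zhuO V M := by
  have hbase : ∀ (m : ℕ) (k : ℤ) (v : V), v ∈ weightSpace V V (k : ℂ) →
      resMode (-2 - m) k v w ∈ zhuO V M := by
    intro m
    induction m with
    | zero =>
      intro k v hv
      refine Submodule.subset_span ⟨v, w, ?_⟩
      rw [residueProduct_apply hv, add_zero]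
      simp
    | succ m ih =>
      intro k v hv
      have h1 := ih (k + 1) _ (vir_neg_one_mem hv)
      rw [resMode_vir_neg_one, show k + 1 - 1 = k by ring, show (-2 - (m : ℤ)) - 1 = -3 - m by ring]
        at h1
      have h2 := Submodule.add_mem _ h1 ((zhuO V M).smul_mem ((k + 1 : ℤ) : ℂ) (ih k v hv))
      rw [Int.cast_smul_eq_zsmul, sub_add_cancel, ← Int.cast_smul_eq_zsmul ℂ] at h2
      have hne : ((-(-2 - (m : ℤ)) : ℤ) : ℂ) ≠ 0 := by
        rw [Int.cast_ne_zero]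
        omega
      have h3 := (Submodule.smul_mem_iff _ hne).mp h2
      rw [resMode_succ, show -3 - (m : ℤ) + 1 = -2 - m by ring] at h3
      have h4 := Submodule.sub_mem _ h3 (ih k v hv)
      rw [add_sub_cancel_right] at h4
      rwa [show -2 - ((m + 1 : ℕ) : ℤ) = -3 - m by push_cast; ring]
  induction n generalizing m with
  | zero => simpa using hbase m k v hv
  | succ n ih =>
    obtain ⟨m, rfl⟩ : ∃ m', m = m' + 1 := ⟨m - 1, by omega⟩
    rw [show k + ((n + 1 : ℕ) : ℤ) = k + n + 1 by push_cast; ring, resMode_succ]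
    refine Submodule.add_mem _ (ih (m + 1) (by omega)) ?_
    rw [show -2 - ((m + 1 : ℕ) : ℤ) + 1 = -2 - m by push_cast; ring]
    exact ih m (by omega)

theorem resMode_sub_mem_zhuO (i : ℕ) {k : ℤ} {v : V} (hv : v ∈ weightSpace V V (k : ℂ)) (w : M) :
    resMode (-1 - i) (k + i) v w - resMode (-1) k v w ∈ zhuO V M := by
  induction i with
  | zero => simp
  | succ i ih =>
    rw [show k + ((i + 1 : ℕ) : ℤ) = k + i + 1 by push_cast; ring, resMode_succ,
      show -1 - ((i + 1 : ℕ) : ℤ) + 1 = -1 - i by push_cast; ring, add_sub_assoc]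
    refine Submodule.add_mem _ ?_ ih
    rw [show -1 - ((i + 1 : ℕ) : ℤ) = -2 - i by push_cast; ring]
    exact resMode_mem_zhuO i i le_rfl hv w

/-- The substitution `y = x⁻¹` in the residue of `x^p (1+x)^r Y°(v, x)w`. -/
theorem oppositeTest_eq_sum {k : ℤ} {v : V} (hv : v ∈ weightSpace V V (k : ℂ)) {N : ℕ}
    (hN : ∀ i, N ≤ i → virOneDiv V i v = 0) (p r : ℤ) (w : M) :
    oppositeTest V M p r v w = (k.negOnePow : ℤ) • ∑ i ∈ Finset.range N,
      resMode (2 * k - i - p - r - 2) r (virOneDiv V i v) w := by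
  have hfin : ∀ i ∈ Finset.range N, (Function.support fun j : ℕ => Ring.choose r j •
      mode M (virOneDiv V i v) (2 * k - i - p - r - 2 + j) w).Finite := fun i _ => by
    obtain ⟨T, hT⟩ := exists_nat_truncation (virOneDiv V i v) w (2 * k - i - p - r - 2)
    exact finite_support_of_eventually_zero _ T fun j hj => by rw [hT j hj, smul_zero]
  rw [oppositeTest_apply]
  simp only [resMode]
  rw [← finsum_sum_comm _ _ hfin, zsmul_finsum]
  refine finsum_congr fun j => ?_
  rw [opposite_eq_sum hv hN, smul_comm, Finset.smul_sum]
  congr 1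
  refine Finset.sum_congr rfl fun i _ => ?_
  rw [show 2 * k - (p + r - (j : ℤ)) - i - 2 = 2 * k - i - p - r - 2 + j by ring]

/-- After the substitution `y = x⁻¹`, the component `L(1)^i v / i!` of `Y°(v, x)` contributes
`y^(2k-i-p-r-2) (1+y)^r`, where `k - i` is its weight. -/
theorem oppositeTest_mem_zhuO {k : ℤ} {v : V} (hv : v ∈ weightSpace V V (k : ℂ)) {p r : ℤ}
    (hp : k ≤ p) (hr : k ≤ r) (w : M) : oppositeTest V M p r v w ∈ zhuO V M := by
  obtain ⟨N, hN⟩ := exists_virOneDiv_eq_zero v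
  rw [oppositeTest_eq_sum hv hN, ← Int.cast_smul_eq_zsmul ℂ]
  refine Submodule.smul_mem _ _ (Submodule.sum_mem _ fun i _ => ?_)
  have := resMode_mem_zhuO (p + r + i - 2 * k).toNat (r - k + i).toNat (by omega)
    (virOneDiv_mem hv i) w
  rwa [show -2 - ((p + r + i - 2 * k).toNat : ℤ) = 2 * k - i - p - r - 2 by omega,
    show k - (i : ℤ) + ((r - k + i).toNat : ℤ) = r by omega] at this

theorem zhuTheta_eq_sum {k : ℤ} {v : V} (hv : v ∈ weightSpace V V (k : ℂ)) {N : ℕ}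
    (hN : ∀ i, N ≤ i → virOneDiv V i v = 0) :
    zhuTheta v = (k.negOnePow : ℤ) • ∑ i ∈ Finset.range N, virOneDiv V i v := by
  rw [zhuTheta, extendHomogeneous_apply _ k v hv]
  simp only [LinearMap.smul_apply, LinearMap.comp_apply, Submodule.subtype_apply]
  rw [Int.cast_smul_eq_zsmul]
  congr 1
  change ∑ᶠ i : ℕ, ((i.factorial : ℂ)⁻¹) • (vir V V 1 ^ i) v = _
  exact finsum_eq_sum_range _ N hN

/-- Modulo `O(M)`, the residue of `x^(wt v - 1) (1+x)^(wt v) Y°(v, x)` is the left action of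
`θ(v)`. -/
theorem oppositeTest_sub_zhuLeft_mem {k : ℤ} {v : V} (hv : v ∈ weightSpace V V (k : ℂ)) (w : M) :
    oppositeTest V M (k - 1) k v w - zhuLeft (zhuTheta v) w ∈ zhuO V M := by
  obtain ⟨N, hN⟩ := exists_virOneDiv_eq_zero v
  rw [oppositeTest_eq_sum hv hN, zhuTheta_eq_sum hv hN, zhuLeft, map_zsmul, map_sum,
    LinearMap.smul_apply, LinearMap.sum_apply, ← smul_sub, ← Finset.sum_sub_distrib,
    ← Int.cast_smul_eq_zsmul ℂ]
  refine Submodule.smul_mem _ _ (Submodule.sum_mem _ fun i _ => ?_)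
  have := resMode_sub_mem_zhuO i (virOneDiv_mem hv i) w
  rw [sub_add_cancel] at this
  rwa [residueProduct_apply (virOneDiv_mem hv i), add_zero,
    show 2 * k - (i : ℤ) - (k - 1) - k - 2 = -1 - i by ring]

/-- Modulo `O(M)`, the residue of `x^(wt v) (1+x)^(wt v - 1) Y°(v, x)` is, up to sign, the right
action of `v`: the components `L(1)^i v / i!` with `i > 0` contribute elements of `O(M)`. -/
theorem oppositeTest_sub_zhuRight_mem {k : ℤ} {v : V} (hv : v ∈ weightSpace V V (k : ℂ)) (w : M) :
    (k.negOnePow : ℤ) • oppositeTest V M k (k - 1) v w - zhuRight w v ∈ zhuO V M := by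
  obtain ⟨N, hN⟩ := exists_virOneDiv_eq_zero v
  have hN' : ∀ i, N + 1 ≤ i → virOneDiv V i v = 0 := fun i hi => hN i (by omega)
  rw [oppositeTest_eq_sum hv hN', smul_smul, zhuRight, residueProduct_apply hv]
  have hsq : (k.negOnePow : ℤ) * (k.negOnePow : ℤ) = 1 := by
    rw [← Units.val_mul, Int.units_mul_self, Units.val_one]
  rw [hsq, one_smul, Finset.sum_range_succ', virOneDiv_zero, Module.End.one_apply,
    show 2 * k - ((0 : ℕ) : ℤ) - k - (k - 1) - 2 = -1 by push_cast; ring, ← sub_eq_add_neg,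
    add_sub_cancel_right]
  refine Submodule.sum_mem _ fun i _ => ?_
  have := resMode_mem_zhuO i i le_rfl (virOneDiv_mem hv (i + 1)) w
  rwa [show k - ((i + 1 : ℕ) : ℤ) + i = k - 1 by push_cast; ring,
    show -2 - (i : ℤ) = 2 * k - ((i + 1 : ℕ) : ℤ) - k - (k - 1) - 2 by push_cast; ring] at this

theorem zhuTheta_vac : zhuTheta (VertexOperatorAlgebra.vac : V) = VertexOperatorAlgebra.vac := by
  rw [zhuTheta_eq_sum vac_mem (virOneDiv_eq_zero vir_one_vac)]
  simp [virOneDiv_zero]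

theorem zhuLeft_vac (w : M) : zhuLeft (VertexOperatorAlgebra.vac : V) w = w := by
  rw [zhuLeft, residueProduct_apply vac_mem, add_zero, resMode, finsum_choose_zero,
    WeakModule.vacuum]
  simp

theorem zhuRight_vac (w : M) : zhuRight w (VertexOperatorAlgebra.vac : V) = w := by
  rw [zhuRight, residueProduct_apply vac_mem, resMode, finsum_eq_single _ 0 fun i hi => by
    rw [WeakModule.vacuum, if_neg (by omega), smul_zero], WeakModule.vacuum]
  simp

theorem virOneDiv_virOneDiv_eq_zero {v : V} {N : ℕ} (hN : ∀ i, N ≤ i → virOneDiv V i v = 0)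
    (i j : ℕ) (h : N ≤ i + j) : virOneDiv V i (virOneDiv V j v) = 0 := by
  have h1 : (vir V V 1 ^ (i + j)) v = 0 := by
    have := hN _ h
    rw [virOneDiv, LinearMap.smul_apply] at this
    exact (smul_eq_zero.mp this).resolve_left
      (inv_ne_zero (by exact_mod_cast Nat.factorial_ne_zero _))
  rw [virOneDiv, virOneDiv, LinearMap.smul_apply, LinearMap.smul_apply, map_smul,
    ← Module.End.mul_apply, ← pow_add, h1, smul_zero, smul_zero]

/-- A functional annihilating the residues of `x^p (1+x)^r Y°(v, x)w` with `p, r ≥ wt v`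
annihilates `O(M)`. -/
theorem eq_zero_of_mem_zhuO {α : Module.Dual ℂ M}
    (hα : ∀ (k : ℤ) (v : V), v ∈ weightSpace V V (k : ℂ) → α ∈ killSpace M v k k) {x : M}
    (hx : x ∈ zhuO V M) : α x = 0 := by
  -- by induction on the order of nilpotency of `L(1)` at `v`
  have key : ∀ (N : ℕ) (k : ℤ) (v : V), v ∈ weightSpace V V (k : ℂ) →
      (∀ i, N ≤ i → virOneDiv V i v = 0) → ∀ m n : ℕ, n ≤ m → ∀ w,
        α (resMode (-2 - m) (k + n) v w) = 0 := by
    intro N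
    induction N with
    | zero =>
      intro k v hv hN m n _ w
      have h0 := hN 0 le_rfl
      rw [virOneDiv_zero, Module.End.one_apply] at h0
      simp [h0, resMode, mode_zero]
    | succ N ih =>
      intro k v hv hN m n hmn w
      have h1 := hα k v hv (k + m - n) (k + n) (by omega) (by omega) w
      rw [oppositeTest_eq_sum hv hN, map_zsmul, map_sum, Finset.sum_range_succ',
        Finset.sum_eq_zero fun i _ => ?_, zero_add, virOneDiv_zero, Module.End.one_apply,
        show 2 * k - ((0 : ℕ) : ℤ) - (k + m - n) - (k + n) - 2 = -2 - m by push_cast; ring] at h1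
      · rcases Int.units_eq_one_or k.negOnePow with h | h
        · simpa [h] using h1
        · simpa [h] using h1
      · have h2 := ih _ _ (virOneDiv_mem hv (i + 1))
          (fun j hj => virOneDiv_virOneDiv_eq_zero hN j (i + 1) (by omega)) (m + (i + 1))
          (n + (i + 1)) (by omega) w
        rw [← h2]
        congr 2 <;> push_cast <;> ring
  refine Submodule.span_induction (p := fun x _ => α x = 0) ?_ (map_zero α)
    (fun x y _ _ hx hy => by rw [map_add, hx, hy, add_zero])
    (fun c x _ hx => by rw [map_smul, hx, smul_zero]) hx
  rintro x ⟨v, w, rfl⟩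
  induction v using homogeneous_induction with
  | h0 => simp
  | ha u v hu hv => rw [map_add, LinearMap.add_apply, map_add, hu, hv, add_zero]
  | hh k v hv =>
    obtain ⟨N, hN⟩ := exists_virOneDiv_eq_zero v
    have := key N k v hv hN 0 0 le_rfl w
    rw [residueProduct_apply hv]
    simpa using this

theorem mem_killSpace_of_zhuO {α : Module.Dual ℂ M} (hα : ∀ x ∈ zhuO V M, α x = 0) {k : ℤ} {v : V}
    (hv : v ∈ weightSpace V V (k : ℂ)) : α ∈ killSpace M v k k :=
  fun _ _ hp hr w => hα _ (oppositeTest_mem_zhuO hv hp hr w)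

theorem mem_regularDual_of_zhuO {α : Module.Dual ℂ M} (hα : ∀ x ∈ zhuO V M, α x = 0) :
    α ∈ regularDual V M (-1) := by
  rw [mem_regularDual_iff]
  intro v
  induction v using homogeneous_induction with
  | h0 => exact ⟨0, 0, fun p r _ _ w => by simp⟩
  | ha u v hu hv =>
    obtain ⟨k, l, h⟩ := hu
    obtain ⟨k', l', h'⟩ := hv
    refine ⟨max k k', max l l', fun p r hp hr w => ?_⟩
    push_cast at hp hr
    rw [map_add, LinearMap.add_apply, map_add, h p r (by omega) (by omega),
      h' p r (by omega) (by omega), add_zero]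
  | hh k v hv =>
    exact ⟨k.toNat, k.toNat, killSpace_mono (by omega) (by omega) (mem_killSpace_of_zhuO hα hv)⟩

end Residues

/-! ### Lowest weight functionals -/

section LowestWeight

variable {V M : Type*} [AddCommGroup V] [Module ℂ V] [VertexOperatorAlgebra V]
  [AddCommGroup M] [Module ℂ M] [WeakModule V M]

theorem shiftAdd_pow_apply_of_eq_zero {X : Type*} [AddCommGroup X] [Module ℂ X] (ε : ℂ) (c : ℕ)
    {R : ℤ → X} {n₀ : ℤ} (h : ∀ n, n₀ < n → R n = 0) :
    (shiftAdd X ε ^ c) R n₀ = ε ^ c • R n₀ ∧ ∀ n, n₀ < n → (shiftAdd X ε ^ c) R n = 0 := by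
  induction c with
  | zero => exact ⟨by simp, h⟩
  | succ c ih =>
    rw [pow_succ', Module.End.mul_apply]
    refine ⟨?_, fun n hn => ?_⟩
    · rw [shiftAdd_apply, ih.1, ih.2 _ (by omega), zero_add, pow_succ', mul_smul]
    · rw [shiftAdd_apply, ih.2 n hn, ih.2 _ (by omega), smul_zero, add_zero]

/-- If `α` is annihilated by the test functions `x^p (1+x)^r` with `p, r ≥ wt v`, the modes of `v`
of negative degree annihilate `α`. -/
theorem rightMode_eq_zero {x : regularDual V M (-1)} {k : ℤ} {v : V}
    (h : x.1 ∈ killSpace M v k k) {n : ℤ} (hn : k ≤ n) : rightMode V M v n x = 0 := by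
  apply Subtype.ext
  have hs := localMode_spec (rightLocalData V M) v x
  have h1 := rightLocalized_eq hs (k := k.toNat) (killSpace_mono (by omega) le_rfl h)
  refine eq_zero_of_shiftAdd_pow one_ne_zero k.toNat hs.1 (n₀ := k) (fun n hn => ?_) n hn
  rw [h1]
  exact LinearMap.ext fun w => h n _ hn (by omega) w

/-- The pole of `Y^R(v, x)α` at `x = 0` has order at most `k`, so the coefficient of `x^(-k)` is not
changed by multiplication with a power of `1 + x`. -/
theorem rightMode_lowest {x : regularDual V M (-1)} {k : ℤ} {v : V}
    (h : x.1 ∈ killSpace M v k k) (w : M) :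
    (rightMode V M v (k - 1) x).1 w = x.1 (oppositeTest V M (k - 1) k v w) := by
  have hs := localMode_spec (rightLocalData V M) v x
  have h1 := rightLocalized_eq hs (k := k.toNat) (killSpace_mono (by omega) le_rfl h)
  have h2 := (shiftAdd_pow_apply_of_eq_zero 1 k.toNat (n₀ := k - 1)
    (R := fun n => (rightMode V M v n x).1) fun n hn => by
      rw [rightMode_eq_zero h (by omega)]; rfl).1
  have h3 := congrFun h1 (k - 1)
  have h4 : (rightMode V M v (k - 1) x).1 w
      = x.1 (oppositeTest V M (k - 1) k.toNat v w) := by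
    rw [one_pow, one_smul] at h2
    rw [← h2]
    exact congrArg (fun f : Module.Dual ℂ M => f w) h3
  rw [h4]
  -- `x^(k-1) (1+x)^r` may be replaced by `x^(k-1) (1+x)^k`
  have h5 : ∀ d : ℕ, x.1 (oppositeTest V M (k - 1) (k + d) v w)
      = x.1 (oppositeTest V M (k - 1) k v w) := by
    intro d
    induction d with
    | zero => simp
    | succ d ih =>
      rw [show k + ((d + 1 : ℕ) : ℤ) = k + d + 1 by push_cast; ring, oppositeTest_succ,
        LinearMap.add_apply, LinearMap.add_apply, map_add, ih,
        h (k - 1 + 1) (k + d) (by omega) (by omega), add_zero]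
  have h6 := h5 (k.toNat - k).toNat
  rwa [show k + (((k.toNat : ℤ) - k).toNat : ℤ) = k.toNat by omega] at h6

theorem leftMode_eq_zero (hM : IsLowestWeight V M) {x : regularDual V M (-1)} {k : ℤ} {v : V}
    (h : x.1 ∈ killSpace M v k k) {n : ℤ} (hn : k ≤ n) : leftMode hM v n x = 0 := by
  apply Subtype.ext
  have hs := localMode_spec (leftLocalData hM) v x
  have h1 := leftLocalized_eq hs (l := k.toNat) (killSpace_mono le_rfl (by omega) h)
  refine eq_zero_of_shiftAdd_pow (neg_ne_zero.mpr one_ne_zero) k.toNat hs.1 (n₀ := k)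
    (fun n hn => ?_) n hn
  rw [h1]
  exact LinearMap.ext fun w => h _ n (by omega) hn w

/-- The pole of `Y^L(v, y)α` at `y = x + 1 = 0` has order at most `k`, so multiplication with a
power of `x = y - 1` changes the coefficient of `y^(-k)` only by a sign. -/
theorem leftMode_lowest (hM : IsLowestWeight V M) {x : regularDual V M (-1)} {k : ℤ} {v : V}
    (h : x.1 ∈ killSpace M v k k) (w : M) :
    (leftMode hM v (k - 1) x).1 w
      = x.1 ((k.negOnePow : ℤ) • oppositeTest V M k (k - 1) v w) := by
  have hs := localMode_spec (leftLocalData hM) v x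
  have h1 := leftLocalized_eq hs (l := k.toNat) (killSpace_mono le_rfl (by omega) h)
  have h2 := (shiftAdd_pow_apply_of_eq_zero (-1) k.toNat (n₀ := k - 1)
    (R := fun n => (leftMode hM v n x).1) fun n hn => by
      rw [leftMode_eq_zero hM h (by omega)]; rfl).1
  have h3 := congrFun h1 (k - 1)
  have h4 : (-1) ^ k.toNat * (leftMode hM v (k - 1) x).1 w
      = x.1 (oppositeTest V M k.toNat (k - 1) v w) :=
    (congrArg (fun f : Module.Dual ℂ M => f w) h2).symm.trans
      (congrArg (fun f : Module.Dual ℂ M => f w) h3)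
  -- replacing `x^k` by `x^(k+d)` changes the sign `d` times
  have h5 : ∀ d : ℕ, x.1 (oppositeTest V M (k + d) (k - 1) v w)
      = (-1) ^ d * x.1 (oppositeTest V M k (k - 1) v w) := by
    intro d
    induction d with
    | zero => simp
    | succ d ih =>
      have h6 := congrArg (fun f : V →ₗ[ℂ] Module.End ℂ M => x.1 (f v w))
        (oppositeTest_succ (V := V) (M := M) (k + d) (k - 1))
      simp only [LinearMap.add_apply, map_add, ih] at h6
      rw [sub_add_cancel, h (k + d) k (by omega) le_rfl] at h6
      push_cast
      rw [← add_assoc, pow_succ]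
      linear_combination -h6
  have h6 := h5 (k.toNat - k).toNat
  rw [show k + (((k.toNat : ℤ) - k).toNat : ℤ) = k.toNat by omega, ← h4] at h6
  rw [map_zsmul, ← Int.cast_smul_eq_zsmul ℂ, smul_eq_mul]
  have h7 : ((k.negOnePow : ℤ) : ℂ) = (-1) ^ k.toNat * (-1) ^ (k.toNat - k).toNat := by
    rw [← pow_add, Int.cast_negOnePow]
    have : ((k.toNat + (k.toNat - k).toNat : ℕ) : ℤ) = k + 2 * (k.toNat - k) := by
      push_cast; omega
    rw [← zpow_natCast, this, zpow_add₀ (neg_ne_zero.mpr one_ne_zero), zpow_mul]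
    simp
  have h8 : ((-1 : ℂ) ^ k.toNat) * (-1) ^ k.toNat = 1 := by rw [← mul_pow]; simp
  rw [h7]
  linear_combination ((-1) ^ k.toNat) * h6 - ((leftMode hM v (k - 1) x).1 w) * h8

/-- On functionals on `A(M)`, the degree zero modes of `Y^R` are transposes of the left action of
`A(V)` twisted by `θ`. -/
theorem rightMode_eq_zhuLeft {x : regularDual V M (-1)} (hx : ∀ y ∈ zhuO V M, x.1 y = 0) {k : ℤ}
    {v : V} (hv : v ∈ weightSpace V V (k : ℂ)) (w : M) :
    (rightMode V M v (k - 1) x).1 w = x.1 (zhuLeft (zhuTheta v) w) := by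
  rw [rightMode_lowest (mem_killSpace_of_zhuO hx hv), ← sub_eq_zero, ← map_sub]
  exact hx _ (oppositeTest_sub_zhuLeft_mem hv w)

/-- On functionals on `A(M)`, the degree zero modes of `Y^L` are transposes of the right action of
`A(V)`. -/
theorem leftMode_eq_zhuRight (hM : IsLowestWeight V M) {x : regularDual V M (-1)}
    (hx : ∀ y ∈ zhuO V M, x.1 y = 0) {k : ℤ} {v : V} (hv : v ∈ weightSpace V V (k : ℂ)) (w : M) :
    (leftMode hM v (k - 1) x).1 w = x.1 (zhuRight w v) := by
  rw [leftMode_lowest hM (mem_killSpace_of_zhuO hx hv), ← sub_eq_zero, ← map_sub]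
  exact hx _ (oppositeTest_sub_zhuRight_mem hv w)

/-- The lowest weight condition for both actions is equivalent to the vanishing on the test
functions `x^p (1+x)^r` with `p, r ≥ wt v`: for `r` large it is the condition for `Y^R`,
for `p` large the one for `Y^L`. -/
theorem mem_killSpace_of_lowest (hM : IsLowestWeight V M) {x : regularDual V M (-1)} {k : ℤ} {v : V}
    (hR : ∀ n, k ≤ n → rightMode V M v n x = 0) (hL : ∀ n, k ≤ n → leftMode hM v n x = 0) :
    x.1 ∈ killSpace M v k k := by
  obtain ⟨K, l, h⟩ := mem_regularDual_iff.mp x.2 v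
  have hz : ∀ (ε : ℂ) (c : ℕ) (R : ℤ → Module.Dual ℂ M), (∀ n, k ≤ n → R n = 0) →
      ∀ n, k ≤ n → (shiftAdd (Module.Dual ℂ M) ε ^ c) R n = 0 := fun ε c R hR n hn => by
    rw [shiftAdd_pow_congr ε c (h := 0) hR n hn, map_zero, Pi.zero_apply]
  have h1 : ∀ r : ℤ, K ≤ r → ∀ p, k ≤ p → ∀ w, x.1 (oppositeTest V M p r v w) = 0 := by
    intro r hr p hp w
    lift r to ℕ using le_trans (Nat.cast_nonneg K) hr
    have h2 := rightLocalized_eq (localMode_spec (rightLocalData V M) v x) (k := r)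
      (killSpace_mono hr le_rfl h)
    have h3 := (hz 1 r (fun n => (rightMode V M v n x).1)
      (fun n hn => congrArg Subtype.val (hR n hn)) p hp).symm.trans (congrFun h2 p)
    exact (congrArg (fun f : Module.Dual ℂ M => f w) h3).symm
  have h2 : ∀ p : ℤ, l ≤ p → ∀ r, k ≤ r → ∀ w, x.1 (oppositeTest V M p r v w) = 0 := by
    intro p hp r hr w
    lift p to ℕ using le_trans (Nat.cast_nonneg l) hp
    have h2 := leftLocalized_eq (localMode_spec (leftLocalData hM) v x) (l := p)
      (killSpace_mono le_rfl hp h)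
    have h3 := (hz (-1) p (fun n => (leftMode hM v n x).1)
      (fun n hn => congrArg Subtype.val (hL n hn)) r hr).symm.trans (congrFun h2 r)
    exact (congrArg (fun f : Module.Dual ℂ M => f w) h3).symm
  -- descending induction, from `x^p (1+x)^r = x^p (1+x)^(r+1) - x^(p+1) (1+x)^r`
  have key : ∀ (d : ℕ) (p r : ℤ), k ≤ p → k ≤ r → (K - r).toNat + (l - p).toNat ≤ d →
      ∀ w, x.1 (oppositeTest V M p r v w) = 0 := by
    intro d
    induction d with
    | zero => exact fun p r hp hr hd w => h1 r (by omega) p hp w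
    | succ d ih =>
      intro p r hp hr hd w
      by_cases hr' : K ≤ r
      · exact h1 r hr' p hp w
      by_cases hp' : l ≤ p
      · exact h2 p hp' r hr w
      have h3 := congrArg (fun f : V →ₗ[ℂ] Module.End ℂ M => x.1 (f v w))
        (oppositeTest_succ (V := V) (M := M) p r)
      simp only [LinearMap.add_apply, map_add] at h3
      rw [ih p (r + 1) hp (by omega) (by omega), ih (p + 1) r (by omega) hr (by omega),
        add_zero] at h3
      exact h3.symm
  exact fun p r hp hr w => key _ p r hp hr le_rfl w

end LowestWeight

/-! ### Homomorphisms into the regular functionals and their restrictions -/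

section UniversalFamily

variable {V : Type*} [AddCommGroup V] [Module ℂ V] [VertexOperatorAlgebra V]
  {X : Type*} [AddCommGroup X] [Module ℂ X] {m : V →ₗ[ℂ] (ℤ → Module.End ℂ X)}
  {U : Type*} [AddCommGroup U] [Module ℂ U] [ZhuModule V U]

theorem universal_hom_ext {Φ Ψ : UniversalModule V U →ₗ[ℂ] X}
    (hΦ : ∀ v n b, Φ (mode (UniversalModule V U) v n b) = m v n (Φ b))
    (hΨ : ∀ v n b, Ψ (mode (UniversalModule V U) v n b) = m v n (Ψ b))
    (h : ∀ u, Φ (universalMap V U u) = Ψ (universalMap V U u)) : Φ = Ψ := by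
  have := universal_eq_top (LinearMap.eqLocus Φ Ψ) h fun v n b hb => by
    have hb' : Φ b = Ψ b := hb
    change Φ _ = Ψ _
    rw [hΦ, hΨ, hb']
  ext b
  have hb : b ∈ LinearMap.eqLocus Φ Ψ := by rw [this]; trivial
  exact hb

/-- `exists_universal_lift` for a linear family of maps. -/
theorem exists_universal_lift_family {P : Type*} [AddCommGroup P] [Module ℂ P]
    (h : ModeAction m) (j : P →ₗ[ℂ] U →ₗ[ℂ] X)
    (h₁ : ∀ (k n : ℤ) (v : V), v ∈ weightSpace V V (k : ℂ) → k - n - 1 < 0 →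
      ∀ t u, m v n (j t u) = 0)
    (h₂ : ∀ (k : ℤ) (v : V), v ∈ weightSpace V V (k : ℂ) →
      ∀ t u, m v (k - 1) (j t u) = j t (zhuAct V U v u)) :
    ∃ Φ : P →ₗ[ℂ] UniversalModule V U →ₗ[ℂ] X,
      (∀ v n t b, Φ t (mode (UniversalModule V U) v n b) = m v n (Φ t b)) ∧
      ∀ t u, Φ t (universalMap V U u) = j t u := by
  choose Φ hm he using fun t => exists_universal_lift h (j t)
    (fun k n v hv hn u => h₁ k n v hv hn t u) (fun k v hv u => h₂ k v hv t u)
  refine ⟨⟨⟨Φ, fun s t => ?_⟩, fun c t => ?_⟩, fun v n t b => hm t v n b, he⟩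
  · refine universal_hom_ext (m := m) (hm _) (fun v n b => ?_) fun u => ?_
    · rw [LinearMap.add_apply, LinearMap.add_apply, hm, hm, map_add]
    · rw [LinearMap.add_apply, he, he, he, map_add, LinearMap.add_apply]
  · refine universal_hom_ext (m := m) (hm _) (fun v n b => ?_) fun u => ?_
    · rw [LinearMap.smul_apply, LinearMap.smul_apply, hm, map_smul]
    · rw [RingHom.id_apply, LinearMap.smul_apply, he, he, map_smul, LinearMap.smul_apply]

end UniversalFamily

section Restriction

variable {V W : Type*} [AddCommGroup V] [Module ℂ V] [VertexOperatorAlgebra V]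
  [AddCommGroup W] [Module ℂ W] [WeakModule V W]

section Modes

variable {A B : Type*} [AddCommGroup A] [Module ℂ A] [HasModes V A]
  [AddCommGroup B] [Module ℂ B] [HasModes V B]

/-- The second tensor factor carries the action `Y^R`. -/
theorem rightMode_regularHom (ψ : regularHom V A B W (-1)) (v : V) (n : ℤ) (a : A) (b : B) :
    rightMode V W v n ⟨ψ.1 (a ⊗ₜ b), ψ.2.1 _⟩ = ⟨ψ.1 (a ⊗ₜ mode B v n b), ψ.2.1 _⟩ := by
  apply Subtype.ext
  ext w
  rw [rightMode_apply]
  exact (ψ.2.2.2 v n a b w).symm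

/-- The first tensor factor carries the action `Y^L`. -/
theorem leftMode_regularHom (hW : IsLowestWeight V W) (ψ : regularHom V A B W (-1)) (v : V)
    (n : ℤ) (a : A) (b : B) :
    leftMode hW v n ⟨ψ.1 (a ⊗ₜ b), ψ.2.1 _⟩ = ⟨ψ.1 (mode A v n a ⊗ₜ b), ψ.2.1 _⟩ := by
  apply Subtype.ext
  ext w
  rw [leftMode_apply]
  exact (ψ.2.2.1 v n a b w).symm

end Modes

variable {U₁ : Type*} [AddCommGroup U₁] [Module ℂ U₁] [ZhuModule V U₁]
  {U₂ : Type*} [AddCommGroup U₂] [Module ℂ U₂] [ZhuModule V U₂]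

/-- The image of `U₁ ⊗ U₂` consists of functionals which are lowest weight vectors for both actions,
and these annihilate `O(W)`. -/
theorem regularHom_apply_zhuO (hW : IsLowestWeight V W)
    (ψ : regularHom V (UniversalModule V U₁) (UniversalModule V U₂) W (-1)) (u₁ : U₁) (u₂ : U₂)
    {w : W} (hw : w ∈ zhuO V W) : ψ.1 (universalMap V U₁ u₁ ⊗ₜ universalMap V U₂ u₂) w = 0 := by
  refine eq_zero_of_mem_zhuO (α := ψ.1 (universalMap V U₁ u₁ ⊗ₜ universalMap V U₂ u₂))
    (fun k v hv => ?_) hw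
  refine mem_killSpace_of_lowest hW (x := ⟨_, ψ.2.1 _⟩) (fun n hn => ?_) fun n hn => ?_
  · rw [rightMode_regularHom]
    apply Subtype.ext
    change ψ.1 (_ ⊗ₜ _) = 0
    rw [universalMap_lowest hv (by omega), TensorProduct.tmul_zero, map_zero]
  · rw [leftMode_regularHom]
    apply Subtype.ext
    change ψ.1 (_ ⊗ₜ _) = 0
    rw [universalMap_lowest hv (by omega), TensorProduct.zero_tmul, map_zero]

/-- The restriction of `ψ` to `U₁ ⊗ U₂`, as a map to `A(W)^*`. -/
def restrictHom (hW : IsLowestWeight V W)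
    (ψ : regularHom V (UniversalModule V U₁) (UniversalModule V U₂) W (-1)) :
    U₁ ⊗[ℂ] U₂ →ₗ[ℂ] Module.Dual ℂ (ZhuA V W) :=
  (zhuO V W).dualQuotEquivDualAnnihilator.symm.toLinearMap ∘ₗ
    LinearMap.codRestrict (zhuO V W).dualAnnihilator
      (ψ.1 ∘ₗ TensorProduct.map (universalMap V U₁) (universalMap V U₂)) (fun t => by
        rw [Submodule.mem_dualAnnihilator]
        intro w hw
        induction t using TensorProduct.induction_on with
        | zero => simp
        | add x y hx hy => rw [map_add, LinearMap.add_apply, hx, hy, add_zero]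
        | tmul u₁ u₂ => exact regularHom_apply_zhuO hW ψ u₁ u₂ hw)

theorem restrictHom_apply (hW : IsLowestWeight V W)
    (ψ : regularHom V (UniversalModule V U₁) (UniversalModule V U₂) W (-1)) (u₁ : U₁) (u₂ : U₂)
    (w : W) : restrictHom hW ψ (u₁ ⊗ₜ u₂) (Submodule.Quotient.mk w)
      = ψ.1 (universalMap V U₁ u₁ ⊗ₜ universalMap V U₂ u₂) w := rfl

/-- The restriction is compatible with the bimodule structure of `A(W)`, since the degree zero modes
of `Y^L` and `Y^R` are the right and the left action. -/
theorem restrictHom_mem (hW : IsLowestWeight V W)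
    (ψ : regularHom V (UniversalModule V U₁) (UniversalModule V U₂) W (-1)) :
    restrictHom hW ψ ∈ zhuHom V U₁ U₂ W := by
  have hO := fun u₁ u₂ w => regularHom_apply_zhuO (w := w) hW ψ u₁ u₂
  intro v v' u₁ u₂ w
  induction v using homogeneous_induction with
  | h0 => simp [zhuRight, zhuLeft, zhuAct]
  | ha x y hx hy =>
    have e1 : zhuAct V U₁ (x + y) = zhuAct V U₁ x + zhuAct V U₁ y := by simp [zhuAct]
    rw [e1, LinearMap.add_apply, TensorProduct.add_tmul, map_add, LinearMap.add_apply, hx, hy]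
    simp only [zhuRight, zhuLeft, map_add, LinearMap.add_apply, Submodule.Quotient.mk_add]
  | hh k v hv =>
    induction v' using homogeneous_induction with
    | h0 => simp [zhuRight, zhuLeft, zhuAct]
    | ha x y hx hy =>
      have e1 : zhuAct V U₂ (x + y) = zhuAct V U₂ x + zhuAct V U₂ y := by simp [zhuAct]
      rw [e1, LinearMap.add_apply, TensorProduct.tmul_add, map_add, LinearMap.add_apply, hx, hy]
      simp only [zhuLeft, map_add, LinearMap.add_apply, Submodule.Quotient.mk_add]
    | hh k' v' hv' =>
      rw [restrictHom_apply, restrictHom_apply, ← universalMap_zhuAct hv]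
      have e1 := congrArg (fun x : regularDual V W (-1) => x.1 w)
        (leftMode_regularHom hW ψ v (k - 1) (universalMap V U₁ u₁)
          (universalMap V U₂ (zhuAct V U₂ v' u₂)))
      have e2 := congrArg (fun x : regularDual V W (-1) => x.1 (zhuRight w v))
        (rightMode_regularHom ψ v' (k' - 1) (universalMap V U₁ u₁) (universalMap V U₂ u₂))
      dsimp only at e1 e2
      rw [leftMode_eq_zhuRight hW (fun y hy => hO _ _ y hy) hv] at e1
      rw [rightMode_eq_zhuLeft (fun y hy => hO _ _ y hy) hv', universalMap_zhuAct hv'] at e2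
      rw [← e1, ← e2]

/-- A homomorphism of `V ⊗ V`-modules on `F(U₁) ⊗ F(U₂)` is determined by its restriction. -/
theorem regularHom_ext
    {ψ φ : regularHom V (UniversalModule V U₁) (UniversalModule V U₂) W (-1)}
    (h : ∀ u₁ u₂, ψ.1 (universalMap V U₁ u₁ ⊗ₜ universalMap V U₂ u₂)
      = φ.1 (universalMap V U₁ u₁ ⊗ₜ universalMap V U₂ u₂)) : ψ = φ := by
  have h1 : ∀ u₁ b, ψ.1 (universalMap V U₁ u₁ ⊗ₜ b) = φ.1 (universalMap V U₁ u₁ ⊗ₜ b) := by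
    intro u₁ b
    have := universal_eq_top (LinearMap.eqLocus
      (ψ.1 ∘ₗ TensorProduct.mk ℂ _ _ (universalMap V U₁ u₁))
      (φ.1 ∘ₗ TensorProduct.mk ℂ _ _ (universalMap V U₁ u₁))) (h u₁) fun v n b hb => by
        ext w
        have hb' : ψ.1 (universalMap V U₁ u₁ ⊗ₜ b) = φ.1 (universalMap V U₁ u₁ ⊗ₜ b) := hb
        change ψ.1 (_ ⊗ₜ _) w = φ.1 (_ ⊗ₜ _) w
        rw [ψ.2.2.2, φ.2.2.2, hb']
    have hb : b ∈ (⊤ : Submodule ℂ (UniversalModule V U₂)) := trivial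
    rw [← this] at hb
    exact hb
  apply Subtype.ext
  refine TensorProduct.ext' fun a b => ?_
  have := universal_eq_top (LinearMap.eqLocus (ψ.1 ∘ₗ (TensorProduct.mk ℂ _ _).flip b)
    (φ.1 ∘ₗ (TensorProduct.mk ℂ _ _).flip b)) (fun u => h1 u b) fun v n a ha => by
      ext w
      have ha' : ψ.1 (a ⊗ₜ b) = φ.1 (a ⊗ₜ b) := ha
      change ψ.1 (_ ⊗ₜ _) w = φ.1 (_ ⊗ₜ _) w
      rw [ψ.2.2.1, φ.2.2.1, ha']
  have ha : a ∈ (⊤ : Submodule ℂ (UniversalModule V U₁)) := trivial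
  rw [← this] at ha
  exact ha

/-- Every homomorphism `U₁ ⊗ U₂ → A(W)^*` extends to `F(U₁) ⊗ F(U₂)`: by the universal property of
`F(U₂)` and the action `Y^R`, and then by the universal property of `F(U₁)` and the action `Y^L`,
which commutes with `Y^R`. -/
theorem exists_regularHom (hW : IsLowestWeight V W) (f : zhuHom V U₁ U₂ W) :
    ∃ ψ : regularHom V (UniversalModule V U₁) (UniversalModule V U₂) W (-1),
      ∀ u₁ u₂ w, ψ.1 (universalMap V U₁ u₁ ⊗ₜ universalMap V U₂ u₂) w
        = f.1 (u₁ ⊗ₜ u₂) (Submodule.Quotient.mk w) := by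
  have hR := localMode_modeAction (rightLocalData V W)
  have hL := localMode_modeAction (leftLocalData hW)
  have hO : ∀ (t : U₁ ⊗[ℂ] U₂), ∀ y ∈ zhuO V W, (f.1 t ∘ₗ (zhuO V W).mkQ) y = 0 := fun t y hy => by
    rw [LinearMap.comp_apply, Submodule.mkQ_apply, (Submodule.Quotient.mk_eq_zero _).mpr hy,
      map_zero]
  let j₀ : U₁ ⊗[ℂ] U₂ →ₗ[ℂ] regularDual V W (-1) :=
    LinearMap.codRestrict _ ((LinearMap.lcomp ℂ ℂ (zhuO V W).mkQ) ∘ₗ f.1)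
      fun t => mem_regularDual_of_zhuO (hO t)
  have hj₀ : ∀ t w, (j₀ t).1 w = f.1 t (Submodule.Quotient.mk w) := fun _ _ => rfl
  have hO' : ∀ t, ∀ y ∈ zhuO V W, (j₀ t).1 y = 0 := hO
  let j : U₁ →ₗ[ℂ] U₂ →ₗ[ℂ] regularDual V W (-1) := TensorProduct.curry j₀
  have hj : ∀ u₁ u₂, j u₁ u₂ = j₀ (u₁ ⊗ₜ u₂) := fun _ _ => rfl
  -- `f` is a bimodule map, and acting by the vacuum on one side isolates the action on the other
  have act₁ : zhuAct V U₁ (VertexOperatorAlgebra.vac : V) = 1 := ZhuModule.act_one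
  have act₂ : zhuAct V U₂ (VertexOperatorAlgebra.vac : V) = 1 := ZhuModule.act_one
  obtain ⟨Φ, hΦ, hΦe⟩ := exists_universal_lift_family hR j
    (fun k n v hv hn t u => rightMode_eq_zero (mem_killSpace_of_zhuO (hO' _) hv) (by omega))
    (fun k v hv t u => Subtype.ext <| LinearMap.ext fun w => by
      have h1 := f.2 VertexOperatorAlgebra.vac v t u w
      rw [act₁, Module.End.one_apply, zhuRight_vac] at h1
      refine (rightMode_eq_zhuLeft (hO' _) hv w).trans ?_
      rw [hj, hj₀, hj₀]
      exact h1.symm)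
  -- `Y^L` has the lowest weight property on the image of `U₂`, and commutes with `Y^R`
  have key : ∀ (b : UniversalModule V U₂) (k : ℤ) (v : V), v ∈ weightSpace V V (k : ℂ) → ∀ u₁,
      (∀ n, k - n - 1 < 0 → leftMode hW v n (Φ u₁ b) = 0) ∧
        leftMode hW v (k - 1) (Φ u₁ b) = Φ (zhuAct V U₁ v u₁) b := by
    intro b k v hv u₁
    have h1 := universal_eq_top
      ((⨅ n : ℤ, ⨅ _ : k - n - 1 < 0, LinearMap.ker (leftMode hW v n ∘ₗ Φ u₁)) ⊓
        LinearMap.eqLocus (leftMode hW v (k - 1) ∘ₗ Φ u₁) (Φ (zhuAct V U₁ v u₁)))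
      (fun u => by
        simp only [Submodule.mem_inf, Submodule.mem_iInf, LinearMap.mem_ker, LinearMap.mem_eqLocus,
          LinearMap.comp_apply, hΦe]
        refine ⟨fun n hn => leftMode_eq_zero hW (mem_killSpace_of_zhuO (hO' _) hv) (by omega),
          Subtype.ext <| LinearMap.ext fun w => ?_⟩
        have h1 := f.2 v VertexOperatorAlgebra.vac u₁ u w
        rw [act₂, Module.End.one_apply, zhuTheta_vac, zhuLeft_vac] at h1
        refine (leftMode_eq_zhuRight hW (hO' _) hv w).trans ?_
        rw [hj, hj₀, hj₀]
        exact h1.symm)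
      (fun v' n' b hb => by
        simp only [Submodule.mem_inf, Submodule.mem_iInf, LinearMap.mem_ker, LinearMap.mem_eqLocus,
          LinearMap.comp_apply] at hb ⊢
        refine ⟨fun n hn => ?_, ?_⟩
        · rw [hΦ]
          refine (leftMode_rightMode_commute hW v v' n n' _).trans ?_
          rw [hb.1 n hn, map_zero]
        · rw [hΦ, hΦ]
          refine (leftMode_rightMode_commute hW v v' (k - 1) n' _).trans ?_
          rw [hb.2]
          rfl)
    have hb : b ∈ (⊤ : Submodule ℂ (UniversalModule V U₂)) := trivial
    rw [← h1] at hb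
    simp only [Submodule.mem_inf, Submodule.mem_iInf, LinearMap.mem_ker, LinearMap.mem_eqLocus,
      LinearMap.comp_apply] at hb
    exact hb
  obtain ⟨Ψ, hΨ, hΨe⟩ := exists_universal_lift_family hL Φ.flip
    (fun k n v hv hn b u => (key b k v hv u).1 n hn) (fun k v hv b u => (key b k v hv u).2)
  have hΨR : ∀ v n b a, Ψ (mode (UniversalModule V U₂) v n b) a = rightMode V W v n (Ψ b a) := by
    intro v n b a
    have h1 := universal_eq_top
      (LinearMap.eqLocus (Ψ (mode (UniversalModule V U₂) v n b)) (rightMode V W v n ∘ₗ Ψ b))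
      (fun u => by
        rw [LinearMap.mem_eqLocus, LinearMap.comp_apply, hΨe, hΨe, LinearMap.flip_apply,
          LinearMap.flip_apply, hΦ]
        rfl)
      (fun v' n' a ha => by
        rw [LinearMap.mem_eqLocus, LinearMap.comp_apply] at ha ⊢
        rw [hΨ, hΨ, ha]
        exact leftMode_rightMode_commute hW v' v n' n _)
    have ha : a ∈ (⊤ : Submodule ℂ (UniversalModule V U₁)) := trivial
    rw [← h1] at ha
    exact ha
  refine ⟨⟨(regularDual V W (-1)).subtype ∘ₗ TensorProduct.lift Ψ.flip, fun t => ?_,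
    fun v n a b w => ?_, fun v n a b w => ?_⟩, fun u₁ u₂ w => ?_⟩
  · exact (TensorProduct.lift Ψ.flip t).2
  · simp only [LinearMap.comp_apply, TensorProduct.lift.tmul, LinearMap.flip_apply,
      Submodule.subtype_apply, hΨ]
    exact leftMode_apply hW v n _ w
  · simp only [LinearMap.comp_apply, TensorProduct.lift.tmul, LinearMap.flip_apply,
      Submodule.subtype_apply, hΨR]
    exact rightMode_apply v n _ w
  · simp only [LinearMap.comp_apply, TensorProduct.lift.tmul, LinearMap.flip_apply,
      Submodule.subtype_apply, hΨe, hΦe]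
    rfl

end Restriction

/-! ### The Jacobi identity for `V ⊗ V`-homomorphisms -/

section BinomialSums

variable {X : Type*} [AddCommGroup X]

/-- The coefficient of `x^(-n-1)` in `(x+1)^c ∑ R m x^(-m-1)`, expanded in nonnegative powers
of `x`. -/
def binomSum (R : ℤ → X) (c n : ℤ) : X := ∑ᶠ i : ℕ, Ring.choose c i • R (n + i)

/-- The coefficient of `x^(-n-1)` in `(x-1)^c ∑ R m x^(-m-1)`, expanded in nonnegative powers
of `x`. -/
def altBinomSum (R : ℤ → X) (c n : ℤ) : X :=
  ∑ᶠ i : ℕ, (((c - i).negOnePow : ℤ) * Ring.choose c i) • R (n + i)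

theorem binomSum_succ {R : ℤ → X} (hR : ∃ N : ℤ, ∀ n, N ≤ n → R n = 0) (c n : ℤ) :
    binomSum R (c + 1) n = binomSum R c n + binomSum R c (n + 1) := by
  obtain ⟨K, hK⟩ := hR
  obtain ⟨N, hN⟩ : ∃ N : ℕ, K ≤ n + N := ⟨(K - n).toNat, by omega⟩
  simp only [binomSum]
  rw [finsum_eq_sum_range _ (N + 1) fun i hi => by rw [hK _ (by omega), smul_zero],
    finsum_eq_sum_range _ (N + 1) fun i hi => by rw [hK _ (by omega), smul_zero],
    finsum_eq_sum_range _ N fun i hi => by rw [hK _ (by omega), smul_zero],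
    Finset.sum_range_succ', Finset.sum_range_succ' _ N, add_right_comm, ← Finset.sum_add_distrib]
  congr 1
  · refine Finset.sum_congr rfl fun i _ => ?_
    rw [Ring.choose_succ_succ, add_smul,
      show n + ((i + 1 : ℕ) : ℤ) = n + 1 + i by push_cast; ring, add_comm]
  · rw [Ring.choose_zero_right, Ring.choose_zero_right]

theorem altBinomSum_succ {R : ℤ → X} (hR : ∃ N : ℤ, ∀ n, N ≤ n → R n = 0) (c n : ℤ) :
    altBinomSum R (c + 1) n = altBinomSum R c (n + 1) - altBinomSum R c n := by
  obtain ⟨K, hK⟩ := hR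
  obtain ⟨N, hN⟩ : ∃ N : ℕ, K ≤ n + N := ⟨(K - n).toNat, by omega⟩
  simp only [altBinomSum]
  rw [finsum_eq_sum_range _ (N + 1) fun i hi => by rw [hK _ (by omega), smul_zero],
    finsum_eq_sum_range _ N fun i hi => by rw [hK _ (by omega), smul_zero],
    finsum_eq_sum_range _ (N + 1) fun i hi => by rw [hK _ (by omega), smul_zero],
    Finset.sum_range_succ', Finset.sum_range_succ' _ N, ← sub_sub, ← Finset.sum_sub_distrib]
  refine Eq.trans (congrArg₂ (· + ·) ?_ ?_) (sub_eq_add_neg _ _).symm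
  · refine Finset.sum_congr rfl fun i _ => ?_
    rw [Ring.choose_succ_succ, show n + ((i + 1 : ℕ) : ℤ) = n + 1 + i by push_cast; ring,
      ← sub_smul,
      show c + 1 - ((i + 1 : ℕ) : ℤ) = c - i by push_cast; ring,
      show c - ((i + 1 : ℕ) : ℤ) = c - i - 1 by push_cast; ring, Int.negOnePow_sub (c - i) 1]
    congr 1
    simp
    ring
  · rw [Ring.choose_zero_right, Ring.choose_zero_right, ← neg_smul]
    congr 1
    rw [add_sub_right_comm, Int.negOnePow_succ]
    simp

theorem shiftAdd_one_pow_eq_binomSum [Module ℂ X] {R : ℤ → X}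
    (hR : ∃ N : ℤ, ∀ n, N ≤ n → R n = 0) (c : ℕ) (n : ℤ) :
    (shiftAdd X 1 ^ c) R n = binomSum R c n := by
  induction c generalizing n with
  | zero => simp [binomSum, finsum_choose_zero]
  | succ c ih =>
    rw [pow_succ', Module.End.mul_apply, shiftAdd_apply, one_smul, ih, ih, Nat.cast_succ,
      binomSum_succ hR, add_comm]

theorem shiftAdd_neg_one_pow_eq_altBinomSum [Module ℂ X] {R : ℤ → X}
    (hR : ∃ N : ℤ, ∀ n, N ≤ n → R n = 0) (c : ℕ) (n : ℤ) :
    (shiftAdd X (-1) ^ c) R n = altBinomSum R c n := by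
  induction c generalizing n with
  | zero =>
    rw [altBinomSum, finsum_eq_single _ 0 fun i hi => by
      rw [Nat.cast_zero, choose_zero_of_pos i (Nat.pos_of_ne_zero hi), mul_zero, zero_smul]]
    simp
  | succ c ih =>
    rw [pow_succ', Module.End.mul_apply, shiftAdd_apply, neg_one_smul, ih, ih, Nat.cast_succ,
      altBinomSum_succ hR, sub_eq_add_neg]

theorem binomSum_map {Y : Type*} [AddCommGroup Y] {R : ℤ → X}
    (hR : ∃ N : ℤ, ∀ n, N ≤ n → R n = 0) (f : X →+ Y) (c n : ℤ) :
    f (binomSum R c n) = binomSum (fun m => f (R m)) c n := by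
  obtain ⟨K, hK⟩ := hR
  rw [binomSum, binomSum, map_finsum f (finite_support_of_eventually_zero _ (K - n).toNat
    fun i hi => by rw [hK _ (by omega), smul_zero])]
  simp only [map_zsmul]

theorem altBinomSum_map {Y : Type*} [AddCommGroup Y] {R : ℤ → X}
    (hR : ∃ N : ℤ, ∀ n, N ≤ n → R n = 0) (f : X →+ Y) (c n : ℤ) :
    f (altBinomSum R c n) = altBinomSum (fun m => f (R m)) c n := by
  obtain ⟨K, hK⟩ := hR
  rw [altBinomSum, altBinomSum, map_finsum f (finite_support_of_eventually_zero _ (K - n).toNat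
    fun i hi => by rw [hK _ (by omega), smul_zero])]
  simp only [map_zsmul]

end BinomialSums

section TensorTruncation

variable {V A B X : Type*} [AddCommGroup V] [Module ℂ V] [VertexOperatorAlgebra V]
  [AddCommGroup A] [Module ℂ A] [AddCommGroup B] [Module ℂ B] [AddCommGroup X] [Module ℂ X]

theorem exists_tmul_truncation_left [WeakModule V A] (ψ : A ⊗[ℂ] B →ₗ[ℂ] X)
    (v : V) (a : A) (b : B) :
    ∃ N : ℤ, ∀ n, N ≤ n → ψ (mode A v n a ⊗ₜ b) = 0 := by
  obtain ⟨N, hN⟩ := WeakModule.truncation v a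
  exact ⟨N, fun n hn => by rw [hN n hn, TensorProduct.zero_tmul, map_zero]⟩

theorem exists_tmul_truncation_right [WeakModule V B] (ψ : A ⊗[ℂ] B →ₗ[ℂ] X)
    (v : V) (a : A) (b : B) :
    ∃ N : ℤ, ∀ n, N ≤ n → ψ (a ⊗ₜ mode B v n b) = 0 := by
  obtain ⟨N, hN⟩ := WeakModule.truncation v b
  exact ⟨N, fun n hn => by rw [hN n hn, TensorProduct.tmul_zero, map_zero]⟩

end TensorTruncation

section RegularJacobi

variable {V A B W : Type*} [AddCommGroup V] [Module ℂ V] [VertexOperatorAlgebra V]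
  [AddCommGroup A] [Module ℂ A] [WeakModule V A] [AddCommGroup B] [Module ℂ B] [WeakModule V B]
  [AddCommGroup W] [Module ℂ W] [WeakModule V W]

/-- The Jacobi identity at `x₂ = e^(πi)`: it pairs `Y°(v, x)` with the rational function
`x^p (1+x)^r`, whose residue at infinity is the sum of those at `-1` and `0`. -/
def RegularJacobi (ψ : A ⊗[ℂ] B →ₗ[ℂ] Module.Dual ℂ W) : Prop :=
  ∀ (v : V) (a : A) (b : B) (p r : ℤ),
    altBinomSum (fun n => ψ (mode A v n a ⊗ₜ b)) p r + binomSum (fun n => ψ (a ⊗ₜ mode B v n b)) r p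
      = ψ (a ⊗ₜ b) ∘ₗ oppositeTest V W p r v

/-- For `p` or `r` large one of the two residues vanishes and the identity is the definition of
`Y^L` or `Y^R`; the general case follows by descending induction. -/
theorem regularJacobi_of_regularHom (hW : IsLowestWeight V W) (ψ : regularHom V A B W (-1)) :
    RegularJacobi (V := V) ψ.1 := by
  intro v a b p r
  set x : regularDual V W (-1) := ⟨ψ.1 (a ⊗ₜ b), ψ.2.1 _⟩ with hx
  obtain ⟨k, l, h⟩ := mem_regularDual_iff.mp x.2 v
  have htL := exists_tmul_truncation_left ψ.1 v a b
  have htR := exists_tmul_truncation_right ψ.1 v a b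
  have sL := localMode_spec (leftLocalData hW) v x
  have sR := localMode_spec (rightLocalData V W) v x
  have eL : (fun n => (localMode (leftLocalData hW) v n x).1)
      = fun n => ψ.1 (mode A v n a ⊗ₜ b) := by
    funext n
    exact congrArg Subtype.val (leftMode_regularHom hW ψ v n a b)
  have eR : (fun n => (localMode (rightLocalData V W) v n x).1)
      = fun n => ψ.1 (a ⊗ₜ mode B v n b) := by
    funext n
    exact congrArg Subtype.val (rightMode_regularHom ψ v n a b)
  rw [eL] at sL
  rw [eR] at sR
  -- the powers of `x ± 1` at which the two actions vanish
  have zL : ∀ n : ℤ, k ≤ n → ψ.1 (mode A v n a ⊗ₜ b) = 0 := by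
    refine eq_zero_of_shiftAdd_pow (neg_ne_zero.mpr one_ne_zero) l htL (n₀ := k) fun n hn => ?_
    rw [leftLocalized_eq sL h]
    exact LinearMap.ext fun w => h l n le_rfl hn w
  have zR : ∀ n : ℤ, l ≤ n → ψ.1 (a ⊗ₜ mode B v n b) = 0 := by
    refine eq_zero_of_shiftAdd_pow one_ne_zero k htR (n₀ := l) fun n hn => ?_
    rw [rightLocalized_eq sR h]
    exact LinearMap.ext fun w => h n k hn le_rfl w
  have h1 : ∀ p r : ℤ, l ≤ p → altBinomSum (fun n => ψ.1 (mode A v n a ⊗ₜ b)) p r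
      + binomSum (fun n => ψ.1 (a ⊗ₜ mode B v n b)) r p = x.1 ∘ₗ oppositeTest V W p r v := by
    intro p r hp
    lift p to ℕ using le_trans (Nat.cast_nonneg l) hp
    rw [← shiftAdd_neg_one_pow_eq_altBinomSum htL,
      leftLocalized_eq sL (killSpace_mono le_rfl hp h), binomSum,
      finsum_eq_zero_of_forall_eq_zero fun i => by rw [zR _ (by omega), smul_zero], add_zero]
  have h2 : ∀ p r : ℤ, k ≤ r → altBinomSum (fun n => ψ.1 (mode A v n a ⊗ₜ b)) p r
      + binomSum (fun n => ψ.1 (a ⊗ₜ mode B v n b)) r p = x.1 ∘ₗ oppositeTest V W p r v := by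
    intro p r hr
    lift r to ℕ using le_trans (Nat.cast_nonneg k) hr
    rw [← shiftAdd_one_pow_eq_binomSum htR,
      rightLocalized_eq sR (killSpace_mono hr le_rfl h), altBinomSum,
      finsum_eq_zero_of_forall_eq_zero fun i => by rw [zL _ (by omega), smul_zero], zero_add]
  -- descending induction, from `x^p (1+x)^r = x^p (1+x)^(r+1) - x^(p+1) (1+x)^r`
  have key : ∀ (d : ℕ) (p r : ℤ), (k - r).toNat + (l - p).toNat ≤ d →
      altBinomSum (fun n => ψ.1 (mode A v n a ⊗ₜ b)) p r
      + binomSum (fun n => ψ.1 (a ⊗ₜ mode B v n b)) r p = x.1 ∘ₗ oppositeTest V W p r v := by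
    intro d
    induction d with
    | zero => exact fun p r hd => h1 p r (by omega)
    | succ d ih =>
      intro p r hd
      by_cases hr : k ≤ r
      · exact h2 p r hr
      by_cases hp : l ≤ p
      · exact h1 p r hp
      have i1 := ih p (r + 1) (by omega)
      have i2 := ih (p + 1) r (by omega)
      rw [binomSum_succ htR, oppositeTest_succ, LinearMap.add_apply, LinearMap.comp_add] at i1
      rw [altBinomSum_succ htL] at i2
      have i3 := congrArg₂ (· - ·) i1 i2
      rw [add_sub_cancel_right] at i3
      rw [← i3]
      abel
  exact key _ p r le_rfl

/-- For large `p` (for large `r`) the identity says that `ψ(v_n a ⊗ b)` (that `ψ(a ⊗ v_n b)`) is the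
localization of `ψ(a ⊗ b)` which defines `Y^L` (which defines `Y^R`). -/
theorem mem_regularHom_of_regularJacobi {ψ : A ⊗[ℂ] B →ₗ[ℂ] Module.Dual ℂ W}
    (hW : IsLowestWeight V W) (hψ : RegularJacobi (V := V) ψ) : ψ ∈ regularHom V A B W (-1) := by
  have hloc : ∀ (v : V) (a : A) (b : B), ∃ k l : ℕ, ψ (a ⊗ₜ b) ∈ killSpace W v k l ∧
      (∀ n : ℤ, k ≤ n → mode A v n a = 0) ∧ ∀ n : ℤ, l ≤ n → mode B v n b = 0 := by
    intro v a b
    obtain ⟨N, hN⟩ := WeakModule.truncation v a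
    obtain ⟨N', hN'⟩ := WeakModule.truncation v b
    refine ⟨N.toNat, N'.toNat, fun p r hp hr w => ?_, fun n hn => hN n (by omega),
      fun n hn => hN' n (by omega)⟩
    have h1 := hψ v a b p r
    rw [altBinomSum, binomSum, finsum_eq_zero_of_forall_eq_zero fun i => by
        rw [hN _ (by omega), TensorProduct.zero_tmul, map_zero, smul_zero],
      finsum_eq_zero_of_forall_eq_zero fun i => by
        rw [hN' _ (by omega), TensorProduct.tmul_zero, map_zero, smul_zero], add_zero] at h1
    exact (congrArg (fun f : Module.Dual ℂ W => f w) h1).symm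
  have hmem : ∀ t, ψ t ∈ regularDual V W (-1) := by
    intro t
    induction t using TensorProduct.induction_on with
    | zero => rw [map_zero]; exact Submodule.zero_mem _
    | add x y hx hy => rw [map_add]; exact Submodule.add_mem _ hx hy
    | tmul a b =>
      rw [mem_regularDual_iff]
      intro v
      obtain ⟨k, l, h, -⟩ := hloc v a b
      exact ⟨k, l, h⟩
  refine ⟨hmem, fun v n a b w => ?_, fun v n a b w => ?_⟩
  · obtain ⟨k, l, -, -, hl⟩ := hloc v a b
    have htL := exists_tmul_truncation_left ψ v a b
    have h1 : IsLocalized (fun n => oppositeTest V W 0 n) (-1) (ψ (a ⊗ₜ b)) v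
        (fun n => ψ (mode A v n a ⊗ₜ b)) := by
      refine ⟨htL, l, ?_⟩
      rw [shiftAdd_pow_comp, shiftAdd_neg_one_pow_oppositeTest, zero_add]
      funext n
      rw [shiftAdd_neg_one_pow_eq_altBinomSum htL, ← hψ v a b l n, binomSum,
        finsum_eq_zero_of_forall_eq_zero fun i => by
          rw [hl _ (by omega), TensorProduct.tmul_zero, map_zero, smul_zero], add_zero]
    have h2 := congrFun (h1.unique (neg_ne_zero.mpr one_ne_zero)
      (localMode_spec (leftLocalData hW) v ⟨ψ (a ⊗ₜ b), hmem _⟩)) n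
    rw [← leftMode_apply hW v n ⟨ψ (a ⊗ₜ b), hmem _⟩ w]
    exact congrArg (fun f : Module.Dual ℂ W => f w) h2
  · obtain ⟨k, l, -, hk, -⟩ := hloc v a b
    have htR := exists_tmul_truncation_right ψ v a b
    have h1 : IsLocalized (fun n => oppositeTest V W n 0) 1 (ψ (a ⊗ₜ b)) v
        (fun n => ψ (a ⊗ₜ mode B v n b)) := by
      refine ⟨htR, k, ?_⟩
      rw [shiftAdd_pow_comp, shiftAdd_one_pow_oppositeTest, zero_add]
      funext n
      rw [shiftAdd_one_pow_eq_binomSum htR, ← hψ v a b n k, altBinomSum,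
        finsum_eq_zero_of_forall_eq_zero fun i => by
          rw [hk _ (by omega), TensorProduct.zero_tmul, map_zero, smul_zero], zero_add]
    have h2 := congrFun (h1.unique one_ne_zero
      (localMode_spec (rightLocalData V W) v ⟨ψ (a ⊗ₜ b), hmem _⟩)) n
    rw [← rightMode_apply v n ⟨ψ (a ⊗ₜ b), hmem _⟩ w]
    exact congrArg (fun f : Module.Dual ℂ W => f w) h2

end RegularJacobi

/-! ### Weight decompositions -/

section Eigenspaces

variable {M X : Type*} [AddCommGroup M] [Module ℂ M] [AddCommGroup X] [Module ℂ X]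

theorem isInternal_eigenspace {f : Module.End ℂ M} (hf : ⨆ c, f.eigenspace c = ⊤) :
    DirectSum.IsInternal fun c : ℂ => f.eigenspace c :=
  DirectSum.isInternal_submodule_of_iSupIndep_of_iSup_eq_top (Module.End.eigenspaces_iSupIndep f) hf

/-- For a diagonalizable operator `f`, the linear map which is `g c` on the eigenspace of
eigenvalue `c`. -/
def extendEigen {f : Module.End ℂ M} (hf : ⨆ c, f.eigenspace c = ⊤) (g : ℂ → M →ₗ[ℂ] X) :
    M →ₗ[ℂ] X :=
  open Classical in
  DirectSum.toModule ℂ ℂ X (fun c => g c ∘ₗ (f.eigenspace c).subtype) ∘ₗ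
    (LinearEquiv.ofBijective (DirectSum.coeLinearMap fun c : ℂ => f.eigenspace c)
      (isInternal_eigenspace hf)).symm.toLinearMap

theorem extendEigen_apply {f : Module.End ℂ M} (hf : ⨆ c, f.eigenspace c = ⊤)
    (g : ℂ → M →ₗ[ℂ] X) {c : ℂ} {x : M} (hx : x ∈ f.eigenspace c) :
    extendEigen hf g x = g c x := by
  classical
  have : (LinearEquiv.ofBijective (DirectSum.coeLinearMap fun c : ℂ => f.eigenspace c)
      (isInternal_eigenspace hf)).symm x = DirectSum.lof ℂ ℂ _ c ⟨x, hx⟩ := by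
    rw [LinearEquiv.symm_apply_eq]
    exact (DirectSum.coeLinearMap_lof (fun c : ℂ => f.eigenspace c) c ⟨x, hx⟩).symm
  simp only [extendEigen, LinearMap.comp_apply, LinearEquiv.coe_coe]
  rw [this]
  convert DirectSum.toModule_lof ℂ c _
  rfl

end Eigenspaces

section WeightSpan

variable {V M : Type*} [AddCommGroup V] [Module ℂ V] [VertexOperatorAlgebra V]
  [AddCommGroup M] [Module ℂ M] [WeakModule V M]

theorem weight_induction (hM : ⨆ c, weightSpace V M c = ⊤) {P : M → Prop} (h0 : P 0)
    (ha : ∀ x y, P x → P y → P (x + y)) (hh : ∀ c, ∀ x ∈ weightSpace V M c, P x) (x : M) : P x := by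
  have hx : x ∈ ⨆ c, weightSpace V M c := by rw [hM]; trivial
  induction hx using Submodule.iSup_induction' with
  | mem c x hx => exact hh c x hx
  | zero => exact h0
  | add x y _ _ hx hy => exact ha x y hx hy

theorem weight_hom_ext (hM : ⨆ c, weightSpace V M c = ⊤) {X : Type*} [AddCommGroup X] [Module ℂ X]
    {f g : M →ₗ[ℂ] X} (h : ∀ c, ∀ x ∈ weightSpace V M c, f x = g x) : f = g := by
  ext x
  induction x using weight_induction hM with
  | h0 => rw [map_zero, map_zero]
  | ha x y hx hy => rw [map_add, map_add, hx, hy]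
  | hh c x hx => exact h c x hx

theorem IsLowestWeight.iSup_weightSpace_eq_top (hM : IsLowestWeight V M) :
    ⨆ c, weightSpace V M c = ⊤ := by
  obtain ⟨h, hint, -⟩ := hM
  rw [eq_top_iff, ← hint.submodule_iSup_eq_top]
  exact iSup_le fun n => le_iSup (weightSpace V M) (h + n)

variable (V) in
/-- `ω` acts on an irreducible finite-dimensional `U` as a scalar, the lowest weight of `F(U)`. -/
theorem iSup_weightSpace_universal {U : Type*} [AddCommGroup U] [Module ℂ U] [ZhuModule V U]
    [FiniteDimensional ℂ U] (hU : IsIrreducibleZhu V U) :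
    ⨆ c, weightSpace V (UniversalModule V U) c = ⊤ := by
  obtain ⟨hnt, hirr⟩ := hU
  obtain ⟨c, hc⟩ := Module.End.exists_eigenvalue (zhuAct V U (VertexOperatorAlgebra.conf : V))
  obtain ⟨u, hu⟩ := hc.exists_hasEigenvector
  -- the vectors of `U` mapped to weight `c` form an `A(V)`-submodule, which contains an
  -- eigenvector of `ω`
  have hS : (weightSpace V (UniversalModule V U) c).comap (universalMap V U) = ⊤ := by
    refine (hirr _ fun v u hu => ?_).resolve_left fun h => hu.2 ?_
    · rw [Submodule.mem_comap] at hu ⊢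
      induction v using homogeneous_induction with
      | h0 => simp [zhuAct]
      | ha v v' hv hv' =>
        have : zhuAct V U (v + v') u = zhuAct V U v u + zhuAct V U v' u := by simp [zhuAct]
        rw [this, map_add]
        exact Submodule.add_mem _ hv hv'
      | hh k v hv =>
        rw [← universalMap_zhuAct hv]
        have := mode_mem_weightSpace hv hu (k - 1)
        rwa [show c + k - ((k - 1 : ℤ) : ℂ) - 1 = c by push_cast; ring] at this
    · rw [← Submodule.mem_bot ℂ, ← h, Submodule.mem_comap, weightSpace,
        Module.End.mem_eigenspace_iff, vir, zero_add]
      have h2 := universalMap_zhuAct (conf_mem (V := V)) u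
      rw [hu.apply_eq_smul, map_smul] at h2
      exact h2
  refine universal_eq_top _ (fun u => ?_) fun v n b hb => ?_
  · have hu : u ∈ (weightSpace V (UniversalModule V U) c).comap (universalMap V U) := by
      rw [hS]; trivial
    exact Submodule.mem_iSup_of_mem c hu
  · induction hb using Submodule.iSup_induction' with
    | zero => rw [map_zero]; exact Submodule.zero_mem _
    | add x y _ _ hx hy => rw [map_add]; exact Submodule.add_mem _ hx hy
    | mem c b hb =>
      induction v using homogeneous_induction with
      | h0 => rw [mode_zero]; exact Submodule.zero_mem _
      | ha v v' hv hv' => rw [mode_add]; exact Submodule.add_mem _ hv hv'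
      | hh k v hv => exact Submodule.mem_iSup_of_mem _ (mode_mem_weightSpace hv hb n)

end WeightSpan

/-! ### From intertwining operators to `V ⊗ V`-homomorphisms -/

section Twist

/-- `∑ n, e^((-n-1)πi) G n`, the value at `x = e^(πi)` of `∑ n, G n x^(-n-1)`. -/
def twistSum (G : ℂ → ℂ) : ℂ := ∑ᶠ n : ℂ, Complex.exp ((-n - 1) * (Real.pi * Complex.I)) * G n

theorem exp_int_mul_pi (m : ℤ) : Complex.exp (m * (Real.pi * Complex.I)) = (m.negOnePow : ℤ) := by
  rw [Complex.exp_int_mul, Complex.exp_pi_mul_I]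
  rcases Int.even_or_odd m with h | h
  · rw [h.neg_one_zpow, Int.negOnePow_even m h]; simp
  · rw [h.neg_one_zpow, Int.negOnePow_odd m h]; simp

theorem exp_add_int_mul_pi (n : ℂ) (m : ℤ) : Complex.exp ((n + m) * (Real.pi * Complex.I))
    = (m.negOnePow : ℤ) * Complex.exp (n * (Real.pi * Complex.I)) := by
  rw [add_mul, Complex.exp_add, exp_int_mul_pi, mul_comm]

/-- Shifting the index by an integer changes the value at `e^(πi)` by a sign. -/
theorem twistSum_shift (G : ℂ → ℂ) (m : ℤ) :
    twistSum (fun q => G (q + m)) = (m.negOnePow : ℤ) * twistSum G := by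
  have h1 : twistSum G = ∑ᶠ q : ℂ,
      Complex.exp ((-(q + m) - 1) * (Real.pi * Complex.I)) * G (q + m) :=
    (finsum_comp_equiv (Equiv.addRight (m : ℂ))).symm
  rw [h1, ← smul_eq_mul, smul_finsum, twistSum]
  refine finsum_congr fun q => ?_
  have h2 := exp_add_int_mul_pi (-(q + m) - 1) m
  rw [show -(q + m) - 1 + (m : ℂ) = -q - 1 by ring] at h2
  rw [smul_eq_mul, h2, mul_assoc]

theorem twistSum_finsum {G : ℕ → ℂ → ℂ} {N : ℕ} (hN : ∀ i, N ≤ i → G i = 0)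
    (hG : ∀ i, (Function.support (G i)).Finite) (c m : ℕ → ℤ) :
    (Function.support fun q => ∑ᶠ i, c i • G i (q + m i)).Finite ∧
      twistSum (fun q => ∑ᶠ i, c i • G i (q + m i))
        = ∑ᶠ i, ((m i).negOnePow * c i : ℤ) • twistSum (G i) := by
  have h1 : ∀ q : ℂ, ∑ᶠ i, c i • G i (q + m i) = ∑ i ∈ Finset.range N, c i • G i (q + m i) :=
    fun q => finsum_eq_sum_range _ N fun i hi => by rw [hN i hi, Pi.zero_apply, smul_zero]
  have h2 : ∀ i, (Function.support fun q : ℂ => G i (q + m i)).Finite := fun i =>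
    (hG i).preimage (add_left_injective (m i : ℂ)).injOn
  simp only [h1]
  constructor
  · refine (Set.Finite.biUnion (Finset.range N).finite_toSet fun i _ => h2 i).subset fun q hq => ?_
    obtain ⟨i, hi, hne⟩ := Finset.exists_ne_zero_of_sum_ne_zero hq
    exact Set.mem_biUnion hi fun h : G i (q + m i) = 0 => hne (by rw [h, smul_zero])
  · rw [finsum_eq_sum_range _ N fun i hi => by rw [hN i hi]; simp [twistSum], twistSum]
    simp only [Finset.mul_sum]
    rw [finsum_sum_comm _ _ fun i _ => (h2 i).subset fun q hq (h : G i (q + m i) = 0) =>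
      hq (by simp only [h, smul_zero, mul_zero])]
    refine Finset.sum_congr rfl fun i _ => ?_
    have h3 := congrArg (c i • ·) (twistSum_shift (G i) (m i))
    rw [← zsmul_eq_mul, smul_smul, mul_comm (c i)] at h3
    rw [← h3, twistSum, smul_finsum]
    refine finsum_congr fun q => ?_
    rw [mul_smul_comm]

end Twist

section Intertwining

variable {V A B W : Type*} [AddCommGroup V] [Module ℂ V] [VertexOperatorAlgebra V]
  [AddCommGroup A] [Module ℂ A] [WeakModule V A] [AddCommGroup B] [Module ℂ B] [WeakModule V B]
  [AddCommGroup W] [Module ℂ W] [WeakModule V W]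

theorem finsum_choose_one {X : Type*} [AddCommGroup X] (f : ℕ → X) :
    ∑ᶠ i : ℕ, Ring.choose (1 : ℤ) i • f i = f 0 + f 1 := by
  rw [finsum_eq_sum_range _ 2 fun i hi => by rw [choose_one_of_lt i hi, zero_smul],
    Finset.sum_range_succ, Finset.sum_range_one, Ring.choose_zero_right, Ring.choose_one_right,
    one_smul, one_smul]

/-- The defect of the Jacobi identity for operators with values in `W'`, paired with `w`. -/
theorem jacobiDefect_restrictedDual (I : A →ₗ[ℂ] (ℂ → (B →ₗ[ℂ] restrictedDual V W)))
    (hI : ∀ (a : A) (b : B), ∃ N : ℝ, ∀ n : ℂ, N ≤ n.re → I a n b = 0)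
    (v : V) (a : A) (b : B) (p : ℤ) (q : ℂ) (r : ℤ) (w : W) :
    (jacobiDefect (fun v n => mode A v n) (fun v n => mode B v n)
      (fun v n => mode (restrictedDual V W) v n) (fun a n => I a n) v a b p q r).1 w
    = (∑ᶠ i : ℕ, Ring.choose p i • (I (mode A v (r + i) a) (q + ((p - i : ℤ) : ℂ)) b).1 w)
      - ((∑ᶠ i : ℕ, ((-1) ^ i * Ring.choose r i) •
          (I a (q + ((i : ℤ) : ℂ)) b).1 (oppositeMode V W (p + r - i) v w))
        - (∑ᶠ i : ℕ, ((r.negOnePow : ℤ) * ((-1) ^ i * Ring.choose r i)) •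
          (I a (q + ((r - i : ℤ) : ℂ)) (mode B v (p + i) b)).1 w)) := by
  obtain ⟨f1, f2, f3⟩ := jacobiFinite_of_truncation I hI v a b p q r
  let e : restrictedDual V W →+ ℂ :=
    (LinearMap.applyₗ w ∘ₗ (restrictedDual V W).subtype).toAddMonoidHom
  have he : ∀ f : restrictedDual V W, f.1 w = e f := fun _ => rfl
  rw [he, jacobiDefect, map_sub, map_sub, map_finsum e f1, map_finsum e f2, map_finsum e f3]
  simp only [map_zsmul, Int.cast_natCast]
  rfl

theorem negOnePow_mul_neg_one_pow (i : ℕ) (c : ℤ) :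
    ((i : ℤ).negOnePow : ℤ) * ((-1) ^ i * c) = c := by
  rw [Int.negOnePow_def, zpow_natCast, ← mul_assoc]
  push_cast
  rw [← mul_pow]
  simp

theorem negOnePow_sub_mul_negOnePow (r : ℤ) (i : ℕ) (c : ℤ) :
    ((r - i).negOnePow : ℤ) * ((r.negOnePow : ℤ) * ((-1) ^ i * c)) = c := by
  have h1 := negOnePow_mul_neg_one_pow i c
  have h2 : (r.negOnePow : ℤ) * r.negOnePow = 1 := by
    rw [← Units.val_mul, ← Int.negOnePow_add, ← two_mul, Int.negOnePow_two_mul, Units.val_one]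
  rw [Int.negOnePow_sub, Units.val_mul]
  linear_combination (r.negOnePow : ℤ) * (r.negOnePow : ℤ) * h1 + c * h2

/-- The identity `RegularJacobi` with all binomial sums and signs written out. -/
theorem regularJacobi_iff {ψ : A ⊗[ℂ] B →ₗ[ℂ] Module.Dual ℂ W} :
    RegularJacobi (V := V) ψ ↔ ∀ (v : V) (a : A) (b : B) (w : W) (p r : ℤ),
      (∑ᶠ i : ℕ, (((p - i).negOnePow : ℤ) * Ring.choose p i) • ψ (mode A v (r + i) a ⊗ₜ b) w)
        + ∑ᶠ i : ℕ, Ring.choose r i • ψ (a ⊗ₜ mode B v (p + i) b) w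
      = ∑ᶠ i : ℕ, Ring.choose r i • ψ (a ⊗ₜ b) (oppositeMode V W (p + r - i) v w) := by
  have key : ∀ (v : V) (a : A) (b : B) (w : W) (p r : ℤ),
      (altBinomSum (fun n => ψ (mode A v n a ⊗ₜ b)) p r
        + binomSum (fun n => ψ (a ⊗ₜ mode B v n b)) r p) w
        = (∑ᶠ i : ℕ, (((p - i).negOnePow : ℤ) * Ring.choose p i) • ψ (mode A v (r + i) a ⊗ₜ b) w)
          + ∑ᶠ i : ℕ, Ring.choose r i • ψ (a ⊗ₜ mode B v (p + i) b) w ∧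
      (ψ (a ⊗ₜ b) ∘ₗ oppositeTest V W p r v) w
        = ∑ᶠ i : ℕ, Ring.choose r i • ψ (a ⊗ₜ b) (oppositeMode V W (p + r - i) v w) := by
    intro v a b w p r
    obtain ⟨N, hN⟩ := exists_nat_opposite_truncation v w (p + r)
    let e : Module.Dual ℂ W →+ ℂ := (LinearMap.applyₗ w).toAddMonoidHom
    constructor
    · change e (altBinomSum _ _ _) + e (binomSum _ _ _) = _
      rw [altBinomSum_map (exists_tmul_truncation_left ψ v a b),
        binomSum_map (exists_tmul_truncation_right ψ v a b)]
      rfl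
    · rw [LinearMap.comp_apply, oppositeTest_apply,
        map_finsum _ (finite_support_of_eventually_zero _ N fun i hi => by rw [hN i hi, smul_zero])]
      simp only [map_zsmul]
  constructor
  · intro h v a b w p r
    rw [← (key v a b w p r).1, ← (key v a b w p r).2, h]
  · intro h v a b p r
    ext w
    rw [(key v a b w p r).1, (key v a b w p r).2, h]

variable {I : A →ₗ[ℂ] (ℂ → (B →ₗ[ℂ] restrictedDual V W))}

/-- Weights are conserved: this is the Jacobi identity for `ω` and the derivative property. -/
theorem intertwining_eq_zero (hI : I ∈ intertwiningOperators V A B (restrictedDual V W))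
    {c₁ c₂ c₃ n : ℂ} {a : A} {b : B} {w : W} (ha : a ∈ weightSpace V A c₁)
    (hb : b ∈ weightSpace V B c₂) (hw : w ∈ weightSpace V W c₃) (hn : c₁ + c₂ - n - 1 ≠ c₃) :
    (I a n b).1 w = 0 := by
  have h1 := congrArg (fun f : restrictedDual V W => f.1 w)
    (hI.2.2 (VertexOperatorAlgebra.conf : V) a b 1 n 0)
  rw [jacobiDefect_restrictedDual I hI.1, finsum_choose_one] at h1
  have h2 := finsum_alternating_choose_zero 1 fun i : ℕ =>
    (I a (n + ((i : ℤ) : ℂ)) b).1 (oppositeMode V W (1 + 0 - i) (VertexOperatorAlgebra.conf : V) w)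
  have h3 := finsum_alternating_choose_zero ((0 : ℤ).negOnePow : ℤ) fun i : ℕ =>
    (I a (n + ((0 - i : ℤ) : ℂ)) (mode B (VertexOperatorAlgebra.conf : V) (1 + i) b)).1 w
  simp only [one_mul] at h2
  rw [h2, h3, opposite_conf] at h1
  have h4 := hI.2.1 a (n + 1)
  rw [vir, show (-1 + 1 : ℤ) = 0 by norm_num, add_sub_cancel_right] at h4
  norm_num at h1
  rw [h4, conf_mode_one ha, conf_mode_one hb, conf_mode_one hw] at h1
  simp only [map_smul, Pi.smul_apply, LinearMap.smul_apply, Submodule.coe_smul, smul_eq_mul] at h1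
  have h5 : (c₁ + c₂ - n - 1 - c₃) * (I a n b).1 w = 0 := by
    linear_combination h1
  exact (mul_eq_zero.mp h5).resolve_left (sub_ne_zero.mpr hn)

/-- By conservation of weights, the sum defining `⟨𝒴(a, e^(πi))b, w⟩` is finite. -/
theorem intertwining_finite (hA : ⨆ c, weightSpace V A c = ⊤) (hB : ⨆ c, weightSpace V B c = ⊤)
    (hW : ⨆ c, weightSpace V W c = ⊤)
    (hI : I ∈ intertwiningOperators V A B (restrictedDual V W)) (a : A) (b : B) (w : W) :
    (Function.support fun n => (I a n b).1 w).Finite := by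
  induction a using weight_induction hA with
  | h0 => simp
  | ha x y hx hy =>
    refine (hx.union hy).subset fun n hn => ?_
    by_contra h
    simp only [Set.mem_union, Function.mem_support, not_or, not_not] at h
    exact hn (by simp [h.1, h.2])
  | hh c₁ a ha =>
  induction b using weight_induction hB with
  | h0 => simp
  | ha x y hx hy =>
    refine (hx.union hy).subset fun n hn => ?_
    by_contra h
    simp only [Set.mem_union, Function.mem_support, not_or, not_not] at h
    exact hn (by simp [h.1, h.2])
  | hh c₂ b hb =>
  induction w using weight_induction hW with
  | h0 => simp
  | ha x y hx hy =>
    refine (hx.union hy).subset fun n hn => ?_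
    by_contra h
    simp only [Set.mem_union, Function.mem_support, not_or, not_not] at h
    exact hn (by simp [h.1, h.2])
  | hh c₃ w hw =>
  refine (Set.finite_singleton (c₁ + c₂ - c₃ - 1)).subset fun n hn => ?_
  by_contra h
  refine hn (intertwining_eq_zero hI ha hb hw fun h' => h ?_)
  rw [Set.mem_singleton_iff, ← h']
  ring

theorem twistSum_add {F G : ℂ → ℂ} (hF : (Function.support F).Finite)
    (hG : (Function.support G).Finite) :
    twistSum (fun n => F n + G n) = twistSum F + twistSum G := by
  simp only [twistSum, mul_add]
  exact finsum_add_distrib (hF.subset fun n hn (h : F n = 0) => hn (by simp only [h, mul_zero]))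
    (hG.subset fun n hn (h : G n = 0) => hn (by simp only [h, mul_zero]))

theorem twistSum_smul (c : ℂ) (F : ℂ → ℂ) : twistSum (fun n => c * F n) = c * twistSum F := by
  rw [twistSum, twistSum, ← smul_eq_mul c, smul_finsum]
  exact finsum_congr fun n => by rw [smul_eq_mul]; ring

/-- `a ⊗ b ↦ 𝒴(a, e^(πi))b`. -/
def evalAtPi (hA : ⨆ c, weightSpace V A c = ⊤) (hB : ⨆ c, weightSpace V B c = ⊤)
    (hW : ⨆ c, weightSpace V W c = ⊤)
    (hI : I ∈ intertwiningOperators V A B (restrictedDual V W)) :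
    A ⊗[ℂ] B →ₗ[ℂ] Module.Dual ℂ W :=
  TensorProduct.lift <| LinearMap.mk₂ ℂ
    (fun a b =>
      { toFun := fun w => twistSum fun n => (I a n b).1 w
        map_add' := fun w w' => by
          simp only [map_add]
          exact twistSum_add (intertwining_finite hA hB hW hI a b w)
            (intertwining_finite hA hB hW hI a b w')
        map_smul' := fun c w => by
          simp only [map_smul, smul_eq_mul, RingHom.id_apply]
          exact twistSum_smul c _ })
    (fun a a' b => by
      ext w
      exact (congrArg twistSum (by funext n; simp)).trans
        (twistSum_add (intertwining_finite hA hB hW hI a b w)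
          (intertwining_finite hA hB hW hI a' b w)))
    (fun c a b => by
      ext w
      exact (congrArg twistSum (by funext n; simp)).trans (twistSum_smul c _))
    (fun a b b' => by
      ext w
      exact (congrArg twistSum (by funext n; simp)).trans
        (twistSum_add (intertwining_finite hA hB hW hI a b w)
          (intertwining_finite hA hB hW hI a b' w)))
    (fun c a b => by
      ext w
      exact (congrArg twistSum (by funext n; simp)).trans (twistSum_smul c _))

variable (hA : ⨆ c, weightSpace V A c = ⊤) (hB : ⨆ c, weightSpace V B c = ⊤)
  (hW : ⨆ c, weightSpace V W c = ⊤) (hI : I ∈ intertwiningOperators V A B (restrictedDual V W))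

theorem evalAtPi_apply (a : A) (b : B) (w : W) :
    evalAtPi hA hB hW hI (a ⊗ₜ b) w = twistSum fun n => (I a n b).1 w := rfl

/-- The Jacobi identity of an intertwining operator, multiplied by `e^((-q-1)πi)` and summed over
all `q ∈ ℂ`. -/
theorem regularJacobi_evalAtPi : RegularJacobi (V := V) (evalAtPi hA hB hW hI) := by
  rw [regularJacobi_iff]
  intro v a b w p r
  have hfin := intertwining_finite hA hB hW hI
  obtain ⟨N₁, h₁⟩ := exists_nat_truncation v a r
  obtain ⟨N₂, h₂⟩ := exists_nat_opposite_truncation v w (p + r)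
  obtain ⟨N₃, h₃⟩ := exists_nat_truncation v b p
  obtain ⟨f1, e1⟩ := twistSum_finsum (G := fun i n => (I (mode A v (r + i) a) n b).1 w) (N := N₁)
    (fun i hi => by funext n; simp [h₁ i hi]) (fun i => hfin _ _ _)
    (fun i => Ring.choose p i) (fun i => p - i)
  obtain ⟨f2, e2⟩ := twistSum_finsum
    (G := fun i n => (I a n b).1 (oppositeMode V W (p + r - i) v w)) (N := N₂)
    (fun i hi => by funext n; simp [h₂ i hi]) (fun i => hfin _ _ _)
    (fun i => (-1) ^ i * Ring.choose r i) (fun i => i)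
  obtain ⟨f3, e3⟩ := twistSum_finsum (G := fun i n => (I a n (mode B v (p + i) b)).1 w) (N := N₃)
    (fun i hi => by funext n; simp [h₃ i hi]) (fun i => hfin _ _ _)
    (fun i => (r.negOnePow : ℤ) * ((-1) ^ i * Ring.choose r i)) (fun i => r - i)
  have hJ : ∀ q : ℂ, (∑ᶠ i : ℕ, Ring.choose p i •
        (I (mode A v (r + i) a) (q + ((p - i : ℤ) : ℂ)) b).1 w)
      + (∑ᶠ i : ℕ, ((r.negOnePow : ℤ) * ((-1) ^ i * Ring.choose r i)) •
          (I a (q + ((r - i : ℤ) : ℂ)) (mode B v (p + i) b)).1 w)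
      = ∑ᶠ i : ℕ, ((-1) ^ i * Ring.choose r i) •
          (I a (q + ((i : ℤ) : ℂ)) b).1 (oppositeMode V W (p + r - i) v w) := fun q => by
    have h := congrArg (fun f : restrictedDual V W => f.1 w) (hI.2.2 v a b p q r)
    rw [jacobiDefect_restrictedDual I hI.1] at h
    rw [← sub_eq_zero, ← sub_sub_eq_add_sub]
    exact h
  have key := congrArg twistSum (funext hJ)
  rw [twistSum_add f1 f3, e1, e2, e3] at key
  simp only [negOnePow_mul_neg_one_pow, negOnePow_sub_mul_negOnePow] at key
  exact key

end Intertwining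

/-! ### From `V ⊗ V`-homomorphisms to intertwining operators -/

section Inverse

variable {V A B W : Type*} [AddCommGroup V] [Module ℂ V] [VertexOperatorAlgebra V]
  [AddCommGroup A] [Module ℂ A] [WeakModule V A] [AddCommGroup B] [Module ℂ B] [WeakModule V B]
  [AddCommGroup W] [Module ℂ W] [WeakModule V W]

variable (V A B) in
/-- `L(0) ⊗ 1 + 1 ⊗ L(0)`. -/
def totalWeight : Module.End ℂ (A ⊗[ℂ] B) := (vir V A 0).rTensor B + (vir V B 0).lTensor A

theorem tmul_mem_totalWeight {c₁ c₂ : ℂ} {a : A} {b : B} (ha : a ∈ weightSpace V A c₁)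
    (hb : b ∈ weightSpace V B c₂) : a ⊗ₜ[ℂ] b ∈ (totalWeight V A B).eigenspace (c₁ + c₂) := by
  rw [weightSpace, Module.End.mem_eigenspace_iff] at ha hb
  rw [Module.End.mem_eigenspace_iff, totalWeight, LinearMap.add_apply, LinearMap.rTensor_tmul,
    LinearMap.lTensor_tmul, ha, hb, TensorProduct.tmul_smul, ← TensorProduct.smul_tmul', add_smul]

/-- `A ⊗ B` is spanned by its weight vectors for `L(0) ⊗ 1 + 1 ⊗ L(0)`. -/
theorem iSup_totalWeight (hA : ⨆ c, weightSpace V A c = ⊤) (hB : ⨆ c, weightSpace V B c = ⊤) :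
    ⨆ c, (totalWeight V A B).eigenspace c = ⊤ := by
  refine Submodule.eq_top_iff'.mpr fun t => ?_
  induction t using TensorProduct.induction_on with
  | zero => exact Submodule.zero_mem _
  | add x y hx hy => exact Submodule.add_mem _ hx hy
  | tmul a b =>
    induction a using weight_induction hA with
    | h0 => rw [TensorProduct.zero_tmul]; exact Submodule.zero_mem _
    | ha x y hx hy => rw [TensorProduct.add_tmul]; exact Submodule.add_mem _ hx hy
    | hh c₁ a ha =>
    induction b using weight_induction hB with
    | h0 => rw [TensorProduct.tmul_zero]; exact Submodule.zero_mem _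
    | ha x y hx hy => rw [TensorProduct.tmul_add]; exact Submodule.add_mem _ hx hy
    | hh c₂ b hb => exact Submodule.mem_iSup_of_mem _ (tmul_mem_totalWeight ha hb)

/-- The projection of `W` onto its weight space of weight `c`. -/
def weightProj (hW : ⨆ c, weightSpace V W c = ⊤) (c : ℂ) : Module.End ℂ W :=
  open Classical in extendEigen hW fun c' => if c' = c then 1 else 0

theorem weightProj_apply (hW : ⨆ c, weightSpace V W c = ⊤) {c c' : ℂ} {w : W}
    (hw : w ∈ weightSpace V W c') [Decidable (c' = c)] :
    weightProj hW c w = if c' = c then w else 0 := by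
  rw [weightProj, extendEigen_apply (f := vir V W 0) hW _ hw]
  split_ifs <;> rfl

/-- The restriction of a functional to the weight space of weight `c`, extended by zero. -/
def dualProj (hW : ⨆ c, weightSpace V W c = ⊤) (c : ℂ) :
    Module.Dual ℂ W →ₗ[ℂ] restrictedDual V W :=
  LinearMap.codRestrict _ (LinearMap.lcomp ℂ ℂ (weightProj hW c)) fun f => by
    classical
    refine (Set.finite_singleton c).subset ?_
    rintro c' ⟨w, hw, hne⟩
    by_contra h
    rw [LinearMap.lcomp_apply, weightProj_apply hW hw, if_neg (by simpa using h), map_zero] at hne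
    exact hne rfl

variable (hA : ⨆ c, weightSpace V A c = ⊤) (hB : ⨆ c, weightSpace V B c = ⊤)
  (hW : ⨆ c, weightSpace V W c = ⊤)

/-- The family of operators with `⟨a_n b, w⟩ = e^((n+1)πi) ψ(a ⊗ b)(w)` for homogeneous `a`, `b`
and `w` such that `wt a + wt b - n - 1 = wt w`, the other matrix coefficients between homogeneous
vectors being zero. -/
def formalExpansion (ψ : A ⊗[ℂ] B →ₗ[ℂ] Module.Dual ℂ W) :
    A →ₗ[ℂ] (ℂ → (B →ₗ[ℂ] restrictedDual V W)) :=
  LinearMap.pi fun n => TensorProduct.curry <|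
    extendEigen (iSup_totalWeight hA hB) fun c =>
      Complex.exp ((n + 1) * (Real.pi * Complex.I)) • dualProj hW (c - n - 1) ∘ₗ ψ

theorem formalExpansion_apply (ψ : A ⊗[ℂ] B →ₗ[ℂ] Module.Dual ℂ W) {c₁ c₂ c₃ : ℂ} {a : A} {b : B}
    {w : W} (ha : a ∈ weightSpace V A c₁) (hb : b ∈ weightSpace V B c₂)
    (hw : w ∈ weightSpace V W c₃) (n : ℂ) [Decidable (c₁ + c₂ - n - 1 = c₃)] :
    (formalExpansion hA hB hW ψ a n b).1 w = if c₁ + c₂ - n - 1 = c₃ then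
      Complex.exp ((n + 1) * (Real.pi * Complex.I)) * ψ (a ⊗ₜ b) w else 0 := by
  classical
  rw [formalExpansion, LinearMap.pi_apply, TensorProduct.curry_apply,
    extendEigen_apply _ _ (tmul_mem_totalWeight ha hb)]
  change _ * ψ (a ⊗ₜ b) (weightProj hW _ w) = _
  rw [weightProj_apply hW hw]
  by_cases h : c₁ + c₂ - n - 1 = c₃
  · rw [if_pos h.symm, if_pos h]
  · rw [if_neg (Ne.symm h), if_neg h, map_zero, mul_zero]

/-- The weights of `W` are bounded below. -/
theorem formalExpansion_truncation (hW' : IsLowestWeight V W)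
    (ψ : A ⊗[ℂ] B →ₗ[ℂ] Module.Dual ℂ W) (a : A) (b : B) :
    ∃ N : ℝ, ∀ n : ℂ, N ≤ n.re → formalExpansion hA hB hW ψ a n b = 0 := by
  classical
  obtain ⟨h, hint, -⟩ := hW'
  induction a using weight_induction hA with
  | h0 => exact ⟨0, fun n _ => by simp⟩
  | ha x y hx hy =>
    obtain ⟨N, hN⟩ := hx
    obtain ⟨N', hN'⟩ := hy
    exact ⟨max N N', fun n hn => by
      rw [map_add, Pi.add_apply, LinearMap.add_apply, hN n (le_trans (le_max_left _ _) hn),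
        hN' n (le_trans (le_max_right _ _) hn), add_zero]⟩
  | hh c₁ a ha =>
  induction b using weight_induction hB with
  | h0 => exact ⟨0, fun n _ => by simp⟩
  | ha x y hx hy =>
    obtain ⟨N, hN⟩ := hx
    obtain ⟨N', hN'⟩ := hy
    exact ⟨max N N', fun n hn => by
      rw [map_add, hN n (le_trans (le_max_left _ _) hn),
        hN' n (le_trans (le_max_right _ _) hn), add_zero]⟩
  | hh c₂ b hb =>
  refine ⟨(c₁ + c₂ - h).re, fun n hn => Subtype.ext (weight_hom_ext hW fun c₃ w hw => ?_)⟩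
  rw [formalExpansion_apply hA hB hW ψ ha hb hw]
  split_ifs with hc
  · -- the weights of `W` lie in `h + ℕ`
    have hw0 : w = 0 := by
      rw [weightSpace_eq_bot hint (c := c₃) fun m hm => ?_] at hw
      · simpa using hw
      · have h1 := congrArg Complex.re (hc.trans hm)
        simp at h1 hn
        have h2 : (0 : ℝ) ≤ m := Nat.cast_nonneg m
        linarith
    rw [hw0, map_zero, mul_zero]
    rfl
  · rfl

/-- The case `v = ω`, `p = 1`, `r = 0`; it determines the action of `L(-1)` on the first factor. -/
theorem RegularJacobi.conf {ψ : A ⊗[ℂ] B →ₗ[ℂ] Module.Dual ℂ W} (hψ : RegularJacobi (V := V) ψ)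
    {c₁ c₂ c₃ : ℂ} {a : A} {b : B} {w : W} (ha : a ∈ weightSpace V A c₁)
    (hb : b ∈ weightSpace V B c₂) (hw : w ∈ weightSpace V W c₃) :
    ψ (vir V A (-1) a ⊗ₜ b) w = (c₁ + c₂ - c₃) * ψ (a ⊗ₜ b) w := by
  have h1 := congrArg (fun f : Module.Dual ℂ W => f w) (hψ VertexOperatorAlgebra.conf a b 1 0)
  have h2 : altBinomSum (fun n => ψ (mode A (VertexOperatorAlgebra.conf : V) n a ⊗ₜ b)) 1 0
      = - ψ (vir V A (-1) a ⊗ₜ b) + c₁ • ψ (a ⊗ₜ b) := by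
    rw [altBinomSum, finsum_eq_sum_range _ 2 fun i hi => by
        rw [choose_one_of_lt i hi, mul_zero, zero_smul],
      Finset.sum_range_succ, Finset.sum_range_one, Ring.choose_zero_right, Ring.choose_one_right,
      vir]
    simp [conf_mode_one ha, ← TensorProduct.smul_tmul']
  have h3 : binomSum (fun n => ψ (a ⊗ₜ mode B (VertexOperatorAlgebra.conf : V) n b)) 0 1
      = c₂ • ψ (a ⊗ₜ b) := by
    rw [binomSum, finsum_choose_zero]
    simp [conf_mode_one hb]
  rw [h2, h3, oppositeTest_zero] at h1
  simp only [LinearMap.add_apply, LinearMap.neg_apply, LinearMap.smul_apply, smul_eq_mul,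
    LinearMap.comp_apply, opposite_conf, show (2 - 1 : ℤ) = 1 by norm_num, conf_mode_one hw,
    map_smul] at h1
  linear_combination -h1

theorem formalExpansion_derivative {ψ : A ⊗[ℂ] B →ₗ[ℂ] Module.Dual ℂ W}
    (hψ : RegularJacobi (V := V) ψ) (a : A) (n : ℂ) :
    formalExpansion hA hB hW ψ (vir V A (-1) a) n
      = (-n) • formalExpansion hA hB hW ψ a (n - 1) := by
  classical
  induction a using weight_induction hA with
  | h0 => simp
  | ha x y hx hy =>
    simp only [map_add, Pi.add_apply, smul_add]
    rw [hx, hy]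
  | hh c₁ a ha =>
  refine weight_hom_ext hB fun c₂ b hb => Subtype.ext (weight_hom_ext hW fun c₃ w hw => ?_)
  have ha' : vir V A (-1) a ∈ weightSpace V A (c₁ + 1) := by
    have := mode_mem_weightSpace (conf_mem (V := V)) ha 0
    rwa [show c₁ + ((2 : ℤ) : ℂ) - ((0 : ℤ) : ℂ) - 1 = c₁ + 1 by push_cast; ring] at this
  rw [formalExpansion_apply hA hB hW ψ ha' hb hw, hψ.conf ha hb hw]
  change _ = -n * (formalExpansion hA hB hW ψ a (n - 1) b).1 w
  rw [formalExpansion_apply hA hB hW ψ ha hb hw]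
  by_cases h : c₁ + 1 + c₂ - n - 1 = c₃
  · have h1 := exp_add_int_mul_pi n 1
    rw [Int.negOnePow_one] at h1
    push_cast at h1
    rw [if_pos h, if_pos (by rw [← h]; ring), sub_add_cancel, h1, ← h]
    ring
  · rw [if_neg h, if_neg fun h' => h (by rw [← h']; ring), mul_zero]

theorem finsum_smul_mul_smul (c s : ℕ → ℤ) (e : ℂ) (x : ℕ → ℂ) :
    ∑ᶠ i, c i • (e * (s i • x i)) = e * ∑ᶠ i, (s i * c i) • x i := by
  rw [← smul_eq_mul e, smul_finsum]
  refine finsum_congr fun i => ?_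
  rw [smul_eq_mul, mul_comm (s i), mul_smul]
  simp only [mul_smul_comm]

/-- On homogeneous vectors every term of the Jacobi identity is subject to the same condition on the
weights, and carries the same factor `e^((q+1)πi)` up to sign. -/
theorem formalExpansion_jacobi_homogeneous {ψ : A ⊗[ℂ] B →ₗ[ℂ] Module.Dual ℂ W}
    (hW' : IsLowestWeight V W) (hψ : RegularJacobi (V := V) ψ) {k : ℤ} {c₁ c₂ : ℂ} {v : V} {a : A}
    {b : B} (hv : v ∈ weightSpace V V (k : ℂ)) (ha : a ∈ weightSpace V A c₁)
    (hb : b ∈ weightSpace V B c₂) (p : ℤ) (q : ℂ) (r : ℤ) :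
    jacobiDefect (fun v n => mode A v n) (fun v n => mode B v n)
      (fun v n => mode (restrictedDual V W) v n) (fun a n => formalExpansion hA hB hW ψ a n)
      v a b p q r = 0 := by
  classical
  refine Subtype.ext (weight_hom_ext hW fun c₃ w hw => ?_)
  rw [jacobiDefect_restrictedDual _ (formalExpansion_truncation hA hB hW hW' ψ)]
  -- all terms carry the same condition on the weights
  have t1 : ∀ i : ℕ, (formalExpansion hA hB hW ψ (mode A v (r + i) a)
      (q + ((p - i : ℤ) : ℂ)) b).1 w = if c₁ + c₂ + k - r - q - p - 2 = c₃ then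
        Complex.exp ((q + 1) * (Real.pi * Complex.I))
          * (((p - i).negOnePow : ℤ) • ψ (mode A v (r + i) a ⊗ₜ b) w) else 0 := fun i => by
    rw [formalExpansion_apply hA hB hW ψ (mode_mem_weightSpace hv ha _) hb hw, add_right_comm,
      exp_add_int_mul_pi, zsmul_eq_mul]
    refine if_congr (by rw [iff_iff_eq]; congr 1; push_cast; ring) (by ring) rfl
  have t2 : ∀ i : ℕ, (formalExpansion hA hB hW ψ a (q + ((i : ℤ) : ℂ)) b).1
      (oppositeMode V W (p + r - i) v w) = if c₁ + c₂ + k - r - q - p - 2 = c₃ then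
        Complex.exp ((q + 1) * (Real.pi * Complex.I))
          * (((i : ℤ).negOnePow : ℤ) • ψ (a ⊗ₜ b) (oppositeMode V W (p + r - i) v w))
        else 0 := fun i => by
    rw [formalExpansion_apply hA hB hW ψ ha hb (oppositeMode_mem_weightSpace hv hw _),
      add_right_comm q, exp_add_int_mul_pi, zsmul_eq_mul]
    refine if_congr ?_ (by ring) rfl
    rw [← sub_eq_zero, ← sub_eq_zero (b := c₃), iff_iff_eq]
    congr 1
    push_cast
    ring
  have t3 : ∀ i : ℕ, (formalExpansion hA hB hW ψ a
      (q + ((r - i : ℤ) : ℂ)) (mode B v (p + i) b)).1 w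
      = if c₁ + c₂ + k - r - q - p - 2 = c₃ then
        Complex.exp ((q + 1) * (Real.pi * Complex.I))
          * (((r - i).negOnePow : ℤ) • ψ (a ⊗ₜ mode B v (p + i) b) w) else 0 := fun i => by
    rw [formalExpansion_apply hA hB hW ψ ha (mode_mem_weightSpace hv hb _) hw, add_right_comm,
      exp_add_int_mul_pi, zsmul_eq_mul]
    refine if_congr (by rw [iff_iff_eq]; congr 1; push_cast; ring) (by ring) rfl
  simp only [t1, t2, t3]
  split_ifs with hc
  · simp only [finsum_smul_mul_smul, negOnePow_mul_neg_one_pow, negOnePow_sub_mul_negOnePow]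
    rw [← regularJacobi_iff.mp hψ]
    change _ = (0 : ℂ)
    ring
  · simp

theorem formalExpansion_jacobi {ψ : A ⊗[ℂ] B →ₗ[ℂ] Module.Dual ℂ W}
    (hW' : IsLowestWeight V W) (hψ : RegularJacobi (V := V) ψ) (v : V) (a : A)
    (b : B) (p : ℤ) (q : ℂ) (r : ℤ) :
    jacobiDefect (fun v n => mode A v n) (fun v n => mode B v n)
      (fun v n => mode (restrictedDual V W) v n) (fun a n => formalExpansion hA hB hW ψ a n)
      v a b p q r = 0 := by
  have hfin := fun v a b => jacobiFinite_of_truncation (V := V) _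
    (formalExpansion_truncation hA hB hW hW' ψ) v a b p q r
  induction v using homogeneous_induction with
  | h0 => simp [jacobiDefect, mode_zero]
  | ha x y hx hy =>
    refine Eq.trans ?_ ((congrArg₂ (· + ·) hx hy).trans (add_zero _))
    obtain ⟨f1, f2, f3⟩ := hfin x a b
    obtain ⟨g1, g2, g3⟩ := hfin y a b
    unfold jacobiDefect
    simp only [mode_add, LinearMap.add_apply, Pi.add_apply, map_add, smul_add]
    rw [finsum_add_distrib f1 g1, finsum_add_distrib f2 g2, finsum_add_distrib f3 g3]
    abel
  | hh k v hv =>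
  induction a using weight_induction hA with
  | h0 => simp [jacobiDefect]
  | ha x y hx hy =>
    refine Eq.trans ?_ ((congrArg₂ (· + ·) hx hy).trans (add_zero _))
    obtain ⟨f1, f2, f3⟩ := hfin v x b
    obtain ⟨g1, g2, g3⟩ := hfin v y b
    unfold jacobiDefect
    simp only [LinearMap.add_apply, Pi.add_apply, map_add, smul_add]
    rw [finsum_add_distrib f1 g1, finsum_add_distrib f2 g2, finsum_add_distrib f3 g3]
    abel
  | hh c₁ a ha =>
  induction b using weight_induction hB with
  | h0 => simp [jacobiDefect]
  | ha x y hx hy =>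
    refine Eq.trans ?_ ((congrArg₂ (· + ·) hx hy).trans (add_zero _))
    obtain ⟨f1, f2, f3⟩ := hfin v a x
    obtain ⟨g1, g2, g3⟩ := hfin v a y
    unfold jacobiDefect
    simp only [map_add, smul_add]
    rw [finsum_add_distrib f1 g1, finsum_add_distrib f2 g2, finsum_add_distrib f3 g3]
    abel
  | hh c₂ b hb => exact formalExpansion_jacobi_homogeneous hA hB hW hW' hψ hv ha hb p q r

theorem formalExpansion_mem {ψ : A ⊗[ℂ] B →ₗ[ℂ] Module.Dual ℂ W}
    (hW' : IsLowestWeight V W) (hψ : RegularJacobi (V := V) ψ) :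
    formalExpansion hA hB hW ψ ∈ intertwiningOperators V A B (restrictedDual V W) :=
  ⟨formalExpansion_truncation hA hB hW hW' ψ, formalExpansion_derivative hA hB hW hψ,
    formalExpansion_jacobi hA hB hW hW' hψ⟩

theorem bilinear_weight_ext (hA : ⨆ c, weightSpace V A c = ⊤) (hB : ⨆ c, weightSpace V B c = ⊤)
    {X : Type*} [AddCommGroup X] [Module ℂ X] {φ ψ : A ⊗[ℂ] B →ₗ[ℂ] X}
    (h : ∀ c₁, ∀ a ∈ weightSpace V A c₁, ∀ c₂, ∀ b ∈ weightSpace V B c₂,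
      φ (a ⊗ₜ b) = ψ (a ⊗ₜ b)) : φ = ψ :=
  TensorProduct.ext <| weight_hom_ext hA fun c₁ a ha => weight_hom_ext hB fun c₂ b hb =>
    h c₁ a ha c₂ b hb

/-- On homogeneous vectors the series `𝒴(a, x)b` paired with `w` has a single term. -/
theorem twistSum_eq_of_weight {G : ℂ → ℂ} {c : ℂ} (hG : ∀ n, n ≠ c → G n = 0) :
    twistSum G = Complex.exp ((-c - 1) * (Real.pi * Complex.I)) * G c :=
  finsum_eq_single _ c fun n hn => by rw [hG n hn, mul_zero]

theorem evalAtPi_formalExpansion {ψ : A ⊗[ℂ] B →ₗ[ℂ] Module.Dual ℂ W}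
    (hI : formalExpansion hA hB hW ψ ∈ intertwiningOperators V A B (restrictedDual V W)) :
    evalAtPi hA hB hW hI = ψ := by
  classical
  refine bilinear_weight_ext hA hB fun c₁ a ha c₂ b hb => weight_hom_ext hW fun c₃ w hw => ?_
  rw [evalAtPi_apply, twistSum_eq_of_weight (c := c₁ + c₂ - c₃ - 1) fun n hn => ?_,
    formalExpansion_apply hA hB hW ψ ha hb hw, if_pos (by ring), ← mul_assoc, ← Complex.exp_add]
  · rw [← add_mul]
    ring_nf
    rw [Complex.exp_zero, one_mul]
  · rw [formalExpansion_apply hA hB hW ψ ha hb hw, if_neg fun h => hn (by rw [← h]; ring)]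

/-- By conservation of weights, `𝒴` is determined by its value at `e^(πi)`. -/
theorem formalExpansion_evalAtPi {I : A →ₗ[ℂ] (ℂ → (B →ₗ[ℂ] restrictedDual V W))}
    (hI : I ∈ intertwiningOperators V A B (restrictedDual V W)) :
    formalExpansion hA hB hW (evalAtPi hA hB hW hI) = I := by
  classical
  refine weight_hom_ext hA fun c₁ a ha => funext fun n => weight_hom_ext hB fun c₂ b hb =>
    Subtype.ext (weight_hom_ext hW fun c₃ w hw => ?_)
  rw [formalExpansion_apply hA hB hW _ ha hb hw]
  split_ifs with h
  · rw [evalAtPi_apply, twistSum_eq_of_weight (c := n) fun m hm =>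
      intertwining_eq_zero hI ha hb hw fun h' => hm (by linear_combination h - h'), ← mul_assoc,
      ← Complex.exp_add, ← add_mul]
    ring_nf
    rw [Complex.exp_zero, one_mul]
  · exact (intertwining_eq_zero hI ha hb hw h).symm

/-- The map `𝓕`, `𝓕(𝒴)(a ⊗ b) = 𝒴(a, e^(πi))b`. -/
def intertwiningToRegular (hW' : IsLowestWeight V W) :
    intertwiningOperators V A B (restrictedDual V W) →ₗ[ℂ] regularHom V A B W (-1) where
  toFun I := ⟨evalAtPi hA hB hW'.iSup_weightSpace_eq_top I.2,
    mem_regularHom_of_regularJacobi hW' (regularJacobi_evalAtPi hA hB _ I.2)⟩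
  map_add' I J := Subtype.ext <| TensorProduct.ext' fun a b => LinearMap.ext fun w =>
    twistSum_add (intertwining_finite hA hB hW'.iSup_weightSpace_eq_top I.2 a b w)
      (intertwining_finite hA hB hW'.iSup_weightSpace_eq_top J.2 a b w)
  map_smul' c _ := Subtype.ext <| TensorProduct.ext' fun _ _ => LinearMap.ext fun _ =>
    twistSum_smul c _

theorem intertwiningToRegular_bijective (hW' : IsLowestWeight V W) :
    Function.Bijective (intertwiningToRegular (V := V) (W := W) hA hB hW') := by
  have hW := hW'.iSup_weightSpace_eq_top
  constructor
  · intro I J h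
    have h1 : evalAtPi hA hB hW I.2 = evalAtPi hA hB hW J.2 := congrArg Subtype.val h
    apply Subtype.ext
    rw [← formalExpansion_evalAtPi hA hB hW I.2, h1, formalExpansion_evalAtPi]
  · intro ψ
    have hI := formalExpansion_mem hA hB hW hW' (regularJacobi_of_regularHom hW' ψ)
    exact ⟨⟨_, hI⟩, Subtype.ext (evalAtPi_formalExpansion hA hB hW hI)⟩

end Inverse

/-! ### The maps `𝓕` and `Ω_T` -/

section Restriction

variable {V W : Type*} [AddCommGroup V] [Module ℂ V] [VertexOperatorAlgebra V]
  [AddCommGroup W] [Module ℂ W] [WeakModule V W]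
  {U₁ U₂ : Type*} [AddCommGroup U₁] [Module ℂ U₁] [ZhuModule V U₁]
  [AddCommGroup U₂] [Module ℂ U₂] [ZhuModule V U₂]

variable (U₁ U₂) in
/-- The map `Ω_T` of restriction to `U₁ ⊗ U₂`. -/
def regularToZhu (hW : IsLowestWeight V W) :
    regularHom V (UniversalModule V U₁) (UniversalModule V U₂) W (-1) →ₗ[ℂ] zhuHom V U₁ U₂ W where
  toFun ψ := ⟨restrictHom hW ψ, restrictHom_mem hW ψ⟩
  map_add' ψ φ := Subtype.ext <| TensorProduct.ext' fun u₁ u₂ => LinearMap.ext fun w => by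
    obtain ⟨w, rfl⟩ := Submodule.Quotient.mk_surjective _ w
    rfl
  map_smul' c ψ := Subtype.ext <| TensorProduct.ext' fun u₁ u₂ => LinearMap.ext fun w => by
    obtain ⟨w, rfl⟩ := Submodule.Quotient.mk_surjective _ w
    rfl

theorem regularToZhu_bijective (hW : IsLowestWeight V W) :
    Function.Bijective (regularToZhu U₁ U₂ hW) := by
  constructor
  · refine fun ψ φ h => regularHom_ext fun u₁ u₂ => LinearMap.ext fun w => ?_
    have h1 : restrictHom hW ψ = restrictHom hW φ := congrArg Subtype.val h
    rw [← restrictHom_apply hW, h1, restrictHom_apply]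
  · intro f
    obtain ⟨ψ, hψ⟩ := exists_regularHom hW f
    refine ⟨ψ, Subtype.ext <| TensorProduct.ext' fun u₁ u₂ => LinearMap.ext fun w => ?_⟩
    obtain ⟨w, rfl⟩ := Submodule.Quotient.mk_surjective _ w
    exact hψ u₁ u₂ w

end Restriction

theorem theorem4p14
    {V : Type*} [AddCommGroup V] [Module ℂ V] [VertexOperatorAlgebra V]
    {W : Type*} [AddCommGroup W] [Module ℂ W] [WeakModule V W] (hW : IsLowestWeight V W)
    {U₁ : Type*} [AddCommGroup U₁] [Module ℂ U₁] [ZhuModule V U₁] [FiniteDimensional ℂ U₁]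
    (hU₁ : IsIrreducibleZhu V U₁)
    {U₂ : Type*} [AddCommGroup U₂] [Module ℂ U₂] [ZhuModule V U₂] [FiniteDimensional ℂ U₂]
    (hU₂ : IsIrreducibleZhu V U₂) :
    ∃ (𝓕 : intertwiningOperators V (UniversalModule V U₁) (UniversalModule V U₂)
          (restrictedDual V W) →ₗ[ℂ]
        regularHom V (UniversalModule V U₁) (UniversalModule V U₂) W (-1))
      (Ω_T : regularHom V (UniversalModule V U₁) (UniversalModule V U₂) W (-1) →ₗ[ℂ]
        zhuHom V U₁ U₂ W),
      (∀ I (a : UniversalModule V U₁) (b : UniversalModule V U₂) (w : W),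
        (𝓕 I).1 (a ⊗ₜ[ℂ] b) w = intertwiningEval I.1 (Real.pi * Complex.I) a b w) ∧
      (∀ ψ (u₁ : U₁) (u₂ : U₂) (w : W),
        (Ω_T ψ).1 (u₁ ⊗ₜ[ℂ] u₂) (Submodule.Quotient.mk w)
          = ψ.1 (universalMap V U₁ u₁ ⊗ₜ[ℂ] universalMap V U₂ u₂) w) ∧
      Function.Bijective (Ω_T ∘ₗ 𝓕) := by
  have hA := iSup_weightSpace_universal V hU₁
  have hB := iSup_weightSpace_universal V hU₂
  refine ⟨intertwiningToRegular hA hB hW, regularToZhu U₁ U₂ hW, fun I a b w => rfl,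
    fun ψ u₁ u₂ w => rfl, ?_⟩
  exact (regularToZhu_bijective hW).comp (intertwiningToRegular_bijective hA hB hW)

end
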